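/- Let $k$ be a field. All tensor products are over $k$. For an algebra map $f:H\to R$ and an $R$-module $M$, the weight space of $\lambda\in\mathrm{Hom}_{k\text{-alg}}(H,k)$ is $M_\lambda=\{m: f(h)m=\lambda(h)m\ \forall h\in H\}$, and $M$ is $H$-semisimple if it is the direct sum of its weight spaces. A regular triangular algebra (RTA) is a $k$-algebra $A$ with unital subalgebras $B_\pm$, $H_0\subset H$ such that: (1) multiplication $B_-\otimes H\otimes B_+\to A$ is bijective; (2) there is an algebra map $\mathrm{ad}:H\to\mathrm{End}_k(A)$ preserving $H$ and $B_\pm$, and the images of $H\otimes B_\pm$ in $A$ are subalgebras; (3) a group $\mathcal P$ acts freely (by $*$) on $G=\mathrm{Hom}_{k\text{-alg}}(H,k)$, and there is $0_G\in G$ with $\mathrm{ad}\,h(h')=0_G(h)h'$ for $h,h'\in H$; (4) a free abelian group $\mathcal P_0$ of finite rank with basis $\Delta$ acts freely on $G_0=\mathrm{Hom}_{k\text{-alg}}(H_0,k)$, and the restriction map $\pi:G\to G_0$ sends $\mathcal P*0_G$ onto $\mathcal P_0*\pi(0_G)$, by way of a map $\pi:\mathcal P\to\mathcal P_0$ with $\pi(\theta*\lambda)=\pi(\theta)*\pi(\lambda)$;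 (5) writing $A_\theta$, $(B_\pm)_\theta$ for the $\mathrm{ad}\,H$-weight spaces of weight $\theta*0_G$, $B_\pm=\bigoplus_{\theta\in\mathcal P:\ \pi(\theta)\in\pm\mathbb Z_{\ge0}\Delta}(B_\pm)_\theta$; (6) for $\theta_0\in\mathcal P_0$ let $(B_\pm)_{\theta_0}$ be the sum of the $\mathrm{ad}\,H$-weight spaces of $B_\pm$ for the $\lambda\in G$ with $\pi(\lambda)=\theta_0*\pi(0_G)$; then $(B_\pm)_0=k$ and $\dim (B_\pm)_{\theta_0}<\infty$ for $\theta_0\in\pm\mathbb Z_{\ge0}\Delta$; (7) $A_\theta A_{\theta'}\subset A_{\theta\theta'}$, and $A_\theta M_\lambda\subset M_{\theta*\lambda}$ for every $A$-module $M$, where $\theta,\theta'\in\mathcal P$ and $\lambda\in G$; (8) $A$ has a $k$-linear anti-involution which is the identity on $H$ and takes $A_\theta$ to $A_{\theta^{-1}}$. Let $N_\pm$ be the augmentation ideal of $B_\pm$, that is, the sum of its weight spaces for the $\lambda\in G$ with $\pi(\lambda)\ne\pi(0_G)$. For $1\le i\le n$ let $A_i$ be an RTA (with data $B_{i,\pm}$,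 $N_{i,\pm}$, $H_i$, $G_i$, $\Delta_i$, etc.) and let $\Gamma_i$ be a finite group acting on $A_i$ by $k$-algebra automorphisms, such that $\Gamma_i$ preserves $H_i$, $(H_0)_i$ and $N_{i,\pm}$; $\gamma(\mathrm{ad}\,h(a))=\mathrm{ad}\,\gamma(h)(\gamma(a))$ for $h\in H_i$, $a\in A_i$; $\Gamma_i$ commutes with the anti-involution; the induced action on $G_i$ preserves $\mathcal P_i*0_{G_i}$ and satisfies $\gamma(\theta)*\gamma(\lambda)=\gamma(\theta*\lambda)$; and the induced action on $(G_0)_i$ preserves $\Delta_i$. Assume that $k$ is algebraically closed of characteristic $0$ if some $\Gamma_i$ is nontrivial. Let $A_i\rtimes\Gamma_i$ and $H_i\rtimes\Gamma_i$ be the skew group rings (with $\gamma a=\gamma(a)\gamma$). Put $A=\bigotimes_iA_i$, $H=\bigotimes_iH_i$, $B_+=\bigotimes_iB_{i,+}$, $N_+=\sum_i B_{1,+}\otimes\dots\otimes N_{i,+}\otimes\dots\otimes B_{n,+}$, and let $\Gamma=\prod_i\Gamma_i$ act on $A$ and $H$ factorwise. Let $X_i$ (resp. $X$) be the set of isomorphism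 classes of simple finite-dimensional $H_i$-semisimple $H_i\rtimes\Gamma_i$-modules (resp. $H$-semisimple $H\rtimes\Gamma$-modules). Let $\mathcal O_i$ (resp. $\mathcal O$) be the category of finitely generated $H_i$-semisimple $A_i\rtimes\Gamma_i$-modules with finite-dimensional weight spaces and locally finite action of $B_{i,+}$ (resp. the same for $A\rtimes\Gamma$, $H$, $B_+$). For $x\in X_i$ let $Z_i(x)$ be the Verma module, induced to $A_i\rtimes\Gamma_i$ from $x$ with $N_{i,+}$ acting by $0$, and let $V_i(x)$ be its quotient by the sum of all proper submodules; similarly $Z(x)$ and $V(x)$ for $x\in X$. Then: (a) The map $(x_i)_i\mapsto\bigotimes_ix_i$ is a bijection $\prod_iX_i\to X$. (b) For $x_i\in X_i$, each $V_i(x_i)$ is a simple object of $\mathcal O_i$, and $\bigotimes_iV_i(x_i)\cong V(\bigotimes_ix_i)$. A module $V$ over $A\rtimes\Gamma$ is a simple object of $\mathcal O$ if and only if $V\cong\bigotimes_iV_i(x_i)$ for some $x_i\in X_i$; equivalently, if and only if $V\cong\bigotimes_iW_i$ for some simple objects $W_i$ of $\mathcal O_i$. (c) Restriction of weights identifies $G=\mathrm{Hom}_{k\text{-alg}}(H,k)$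 with $\prod_iG_i$, and if $V\cong\bigotimes_iW_i$ with $W_i$ simple in $\mathcal O_i$, then $\mathrm{ch}_V=\prod_i\mathrm{ch}_{W_i}$; that is, $\dim V_\lambda=\prod_i\dim(W_i)_{\lambda_i}$ for every $\lambda=(\lambda_i)_i\in G$. -/

import Mathlib

open scoped TensorProduct

universe u

noncomputable section

namespace BGG

/-! ### Modules, weight spaces -/

/-- A left module over a `k`-algebra `R`, with its induced `k`-vector space structure. -/
structure AlgModule (k R : Type u) [Field k] [Ring R] [Algebra k R] where
  carrier : Type u
  [addCommGroup : AddCommGroup carrier]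
  [moduleField : Module k carrier]
  [moduleAlg : Module R carrier]
  [isScalarTower : IsScalarTower k R carrier]

namespace AlgModule

instance {k R : Type u} [Field k] [Ring R] [Algebra k R] :
    CoeSort (AlgModule k R) (Type u) := ⟨AlgModule.carrier⟩

attribute [instance] addCommGroup moduleField moduleAlg isScalarTower

/-- Two `R`-modules are isomorphic. -/
def Iso {k R : Type u} [Field k] [Ring R] [Algebra k R] (M N : AlgModule k R) : Prop :=
  Nonempty (M ≃ₗ[R] N)

end AlgModule

section Weights

variable {k H R : Type u} [Field k] [Ring H] [Algebra k H] [Ring R] [Algebra k R]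

/-- The `lam`-weight space `{m : f(h) m = lam(h) m for all h in H}` of an `R`-module `M`,
where `H` acts on `M` through the algebra map `f : H → R`. -/
def weightSpace (f : H →ₐ[k] R) (M : Type u) [AddCommGroup M] [Module k M] [Module R M]
    [IsScalarTower k R M] (lam : H →ₐ[k] k) : Submodule k M where
  carrier := {m | ∀ h : H, f h • m = lam h • m}
  zero_mem' := fun h => by simp
  add_mem' := fun {a b} ha hb h => by rw [smul_add, smul_add, ha h, hb h]
  smul_mem' := fun c m hm h => by
    rw [smul_comm (lam h) c m, ← hm h, ← algebraMap_smul R c m,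
      ← algebraMap_smul R c (f h • m), smul_smul, smul_smul, Algebra.commutes]

/-- `M` is `H`-semisimple: it is the sum of its weight spaces (the sum is automatically direct,
since distinct algebra maps `H → k` are linearly independent). -/
def IsWeightSemisimple (f : H →ₐ[k] R) (M : Type u) [AddCommGroup M] [Module k M] [Module R M]
    [IsScalarTower k R M] : Prop :=
  ⨆ lam : H →ₐ[k] k, weightSpace f M lam = ⊤

end Weights

/-! ### Regular triangular algebras -/

section RTA

variable {k A : Type u} [Field k] [Ring A] [Algebra k A]

/-- Restriction of weights `Hom(H, k) → Hom(H₀, k)` for subalgebras `H₀ ≤ H`. -/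
def restrictWeight {H₀ H : Subalgebra k A} (h : H₀ ≤ H) (lam : H →ₐ[k] k) : H₀ →ₐ[k] k :=
  lam.comp (Subalgebra.inclusion h)

/-- The multiplication map `B₋ ⊗ H ⊗ B₊ → A`. -/
def tripleMul (Bm H Bp : Subalgebra k A) : (Bm ⊗[k] (H ⊗[k] Bp)) →ₗ[k] A :=
  LinearMap.mul' k A ∘ₗ TensorProduct.map Bm.val.toLinearMap
    (LinearMap.mul' k A ∘ₗ TensorProduct.map H.val.toLinearMap Bp.val.toLinearMap)

variable (k A) in
/-- A regular triangular algebra structure on the `k`-algebra `A`. -/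
structure RTA where
  /-- the subalgebras `B₋`, `H`, `B₊`, and `H₀ ⊆ H` -/
  Bm : Subalgebra k A
  H : Subalgebra k A
  Bp : Subalgebra k A
  H₀ : Subalgebra k A
  H₀_le : H₀ ≤ H
  /-- the triangular decomposition `B₋ ⊗ H ⊗ B₊ ≅ A` -/
  triangular : Function.Bijective (tripleMul Bm H Bp)
  /-- the adjoint action of `H` on `A` -/
  ad : H →ₐ[k] Module.End k A
  ad_H : ∀ h : H, ∀ a ∈ H, ad h a ∈ H
  ad_Bm : ∀ h : H, ∀ a ∈ Bm, ad h a ∈ Bm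
  ad_Bp : ∀ h : H, ∀ a ∈ Bp, ad h a ∈ Bp
  /-- the images of `H ⊗ B₋` and `H ⊗ B₊` in `A` are subalgebras -/
  mul_H_Bm : (Subalgebra.toSubmodule H * Subalgebra.toSubmodule Bm) *
    (Subalgebra.toSubmodule H * Subalgebra.toSubmodule Bm) ≤
      Subalgebra.toSubmodule H * Subalgebra.toSubmodule Bm
  mul_H_Bp : (Subalgebra.toSubmodule H * Subalgebra.toSubmodule Bp) *
    (Subalgebra.toSubmodule H * Subalgebra.toSubmodule Bp) ≤
      Subalgebra.toSubmodule H * Subalgebra.toSubmodule Bp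
  /-- the group `P`, acting freely on the set of weights `G = Hom(H, k)` -/
  P : Type u
  [groupP : Group P]
  act : P →* Equiv.Perm (H →ₐ[k] k)
  act_free : ∀ (θ : P) (lam : H →ₐ[k] k), act θ lam = lam → θ = 1
  /-- the distinguished weight `0_G`, with `H = H_{0_G}` as an `ad H`-module -/
  zeroG : H →ₐ[k] k
  ad_H_eq : ∀ h h' : H, ad h h' = zeroG h • (h' : A)
  /-- the free abelian group `P₀` of finite rank, with its basis `Δ` of simple roots,
  acting freely on the set of restricted weights `G₀ = Hom(H₀, k)` -/
  P₀ : Type u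
  [addCommGroupP₀ : AddCommGroup P₀]
  rank : ℕ
  simpleRoot : Module.Basis (Fin rank) ℤ P₀
  act₀ : Multiplicative P₀ →* Equiv.Perm (H₀ →ₐ[k] k)
  act₀_free : ∀ (θ : P₀) (lam : H₀ →ₐ[k] k), act₀ (Multiplicative.ofAdd θ) lam = lam → θ = 0
  /-- the restriction map `π : G → G₀` sends `P * 0_G` onto `P₀ * π(0_G)`, by way of a map
  `P → P₀`, and intertwines the actions -/
  proj : P → P₀
  proj_surjective : Function.Surjective proj
  restrict_act : ∀ (θ : P) (lam : H →ₐ[k] k),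
    restrictWeight H₀_le (act θ lam) =
      act₀ (Multiplicative.ofAdd (proj θ)) (restrictWeight H₀_le lam)
  /-- `B₊` is the sum of its weight spaces for the `θ ∈ P` with `π(θ) ∈ ℤ≥0 Δ`, and `B₋` is the
  sum of its weight spaces for the `θ ∈ P` with `π(θ) ∈ -ℤ≥0 Δ` -/
  Bp_eq : Subalgebra.toSubmodule Bp =
    ⨆ (θ : P) (_ : ∀ j, 0 ≤ simpleRoot.repr (proj θ) j),
      Subalgebra.toSubmodule Bp ⊓ weightSpace ad A (act θ zeroG)
  Bm_eq : Subalgebra.toSubmodule Bm =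
    ⨆ (θ : P) (_ : ∀ j, simpleRoot.repr (proj θ) j ≤ 0),
      Subalgebra.toSubmodule Bm ⊓ weightSpace ad A (act θ zeroG)
  /-- regularity: `(B₊)₀ = (B₋)₀ = k`, and the `P₀`-graded pieces are finite-dimensional -/
  Bp_zero : ⨆ (lam : H →ₐ[k] k) (_ : restrictWeight H₀_le lam = restrictWeight H₀_le zeroG),
    Subalgebra.toSubmodule Bp ⊓ weightSpace ad A lam = Subalgebra.toSubmodule ⊥
  Bm_zero : ⨆ (lam : H →ₐ[k] k) (_ : restrictWeight H₀_le lam = restrictWeight H₀_le zeroG),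
    Subalgebra.toSubmodule Bm ⊓ weightSpace ad A lam = Subalgebra.toSubmodule ⊥
  Bp_finite : ∀ θ : P₀, (∀ j, 0 ≤ simpleRoot.repr θ j) →
    FiniteDimensional k ↥(⨆ (lam : H →ₐ[k] k) (_ : restrictWeight H₀_le lam =
      act₀ (Multiplicative.ofAdd θ) (restrictWeight H₀_le zeroG)),
        Subalgebra.toSubmodule Bp ⊓ weightSpace ad A lam)
  Bm_finite : ∀ θ : P₀, (∀ j, simpleRoot.repr θ j ≤ 0) →
    FiniteDimensional k ↥(⨆ (lam : H →ₐ[k] k) (_ : restrictWeight H₀_le lam =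
      act₀ (Multiplicative.ofAdd θ) (restrictWeight H₀_le zeroG)),
        Subalgebra.toSubmodule Bm ⊓ weightSpace ad A lam)
  /-- the property of weights, for `A` itself and for all `A`-modules -/
  weight_mul : ∀ (θ θ' : P) (a b : A), a ∈ weightSpace ad A (act θ zeroG) →
    b ∈ weightSpace ad A (act θ' zeroG) → a * b ∈ weightSpace ad A (act (θ * θ') zeroG)
  weight_smul : ∀ (M : Type u) [AddCommGroup M] [Module k M] [Module A M] [IsScalarTower k A M]
    (θ : P) (lam : H →ₐ[k] k) (a : A) (m : M), a ∈ weightSpace ad A (act θ zeroG) →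
      m ∈ weightSpace H.val M lam → a • m ∈ weightSpace H.val M (act θ lam)
  /-- the anti-involution `i` of `A` -/
  anti : A →ₗ[k] A
  anti_mul : ∀ a b : A, anti (a * b) = anti b * anti a
  anti_anti : ∀ a : A, anti (anti a) = a
  anti_H : ∀ a ∈ H, anti a = a
  anti_weight : ∀ (θ : P) (a : A), a ∈ weightSpace ad A (act θ zeroG) →
    anti a ∈ weightSpace ad A (act θ⁻¹ zeroG)

attribute [instance] RTA.groupP RTA.addCommGroupP₀

/-- The augmentation ideal `N₊` of `B₊`: the sum of the weight spaces of `B₊` for the weights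
whose restriction to `H₀` differs from that of `0_G`. -/
def RTA.Np (S : RTA k A) : Submodule k A :=
  ⨆ (lam : S.H →ₐ[k] k) (_ : restrictWeight S.H₀_le lam ≠ restrictWeight S.H₀_le S.zeroG),
    Subalgebra.toSubmodule S.Bp ⊓ weightSpace S.ad A lam

/-- The augmentation ideal `N₋` of `B₋`. -/
def RTA.Nm (S : RTA k A) : Submodule k A :=
  ⨆ (lam : S.H →ₐ[k] k) (_ : restrictWeight S.H₀_le lam ≠ restrictWeight S.H₀_le S.zeroG),
    Subalgebra.toSubmodule S.Bm ⊓ weightSpace S.ad A lam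

variable {Γ : Type u} [Group Γ] [MulSemiringAction Γ A] [SMulCommClass Γ k A]

/-- The automorphism of a `Γ`-stable subalgebra given by `γ`. -/
def stableAct (B : Subalgebra k A) (hB : ∀ γ : Γ, ∀ a ∈ B, γ • a ∈ B) (γ : Γ) : B →ₐ[k] B :=
  ((MulSemiringAction.toAlgHom k A γ).comp B.val).codRestrict B (fun b => hB γ b b.2)

/-- The action of `Γ` on the weights of a `Γ`-stable subalgebra: `γ(lam) = lam ∘ γ⁻¹`. -/
def weightAct (B : Subalgebra k A) (hB : ∀ γ : Γ, ∀ a ∈ B, γ • a ∈ B) (γ : Γ)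
    (lam : B →ₐ[k] k) : B →ₐ[k] k :=
  lam.comp (stableAct B hB γ⁻¹)

variable (k A Γ) in
/-- A regular triangular algebra structure on `A` which is compatible with an action of `Γ` on `A`
by `k`-algebra automorphisms, and such that `Γ` preserves the set `Δ` of simple roots; that is,
the datum of a skew group ring `A ⋊ Γ` over a regular triangular algebra. -/
structure SkewRTA extends RTA k A where
  smul_H : ∀ γ : Γ, ∀ a ∈ H, γ • a ∈ H
  smul_H₀ : ∀ γ : Γ, ∀ a ∈ H₀, γ • a ∈ H₀
  smul_Np : ∀ γ : Γ, ∀ a ∈ toRTA.Np, γ • a ∈ toRTA.Np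
  smul_Nm : ∀ γ : Γ, ∀ a ∈ toRTA.Nm, γ • a ∈ toRTA.Nm
  /-- `ad` on `H` and the action of `Γ` combine to an algebra map `H ⋊ Γ → End_k(A)` (the
  operators `ad h` preserve `k`, `N₋`, `N₊`, `H₀`, `H`, since each is a sum of subspaces on which
  `ad h` acts by scalars) -/
  smul_ad : ∀ (γ : Γ) (h : H) (a : A), γ • ad h a = ad (stableAct H smul_H γ h) (γ • a)
  anti_smul : ∀ (γ : Γ) (a : A), anti (γ • a) = γ • anti a
  /-- the action of `Γ` on `G` preserves `P * 0_G` and the action `*` -/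
  smul_act : ∀ (γ : Γ) (θ : P), ∃ θ' : P,
    weightAct H smul_H γ (act θ zeroG) = act θ' zeroG ∧
      ∀ lam : H →ₐ[k] k, weightAct H smul_H γ (act θ lam) = act θ' (weightAct H smul_H γ lam)
  /-- the action of `Γ` on `G₀` preserves `Δ` -/
  smul_simpleRoot : ∀ (γ : Γ) (j : Fin rank), ∃ j' : Fin rank,
    weightAct H₀ smul_H₀ γ
        (act₀ (Multiplicative.ofAdd (simpleRoot j)) (restrictWeight H₀_le zeroG)) =
      act₀ (Multiplicative.ofAdd (simpleRoot j')) (restrictWeight H₀_le zeroG)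

/-- The action of `Γ` on `H`. -/
instance SkewRTA.mulSemiringActionH (S : SkewRTA k A Γ) : MulSemiringAction Γ S.H where
  smul γ h := stableAct S.H S.smul_H γ h
  one_smul h := Subtype.ext (one_smul Γ (h : A))
  mul_smul γ γ' h := Subtype.ext (mul_smul γ γ' (h : A))
  smul_zero γ := map_zero (stableAct S.H S.smul_H γ)
  smul_add γ := map_add (stableAct S.H S.smul_H γ)
  smul_one γ := map_one (stableAct S.H S.smul_H γ)
  smul_mul γ := map_mul (stableAct S.H S.smul_H γ)

instance SkewRTA.smulCommClassH (S : SkewRTA k A Γ) : SMulCommClass Γ k S.H where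
  smul_comm γ c h := map_smul (stableAct S.H S.smul_H γ) c h

end RTA

/-! ### Categories of modules over a skew group ring

`SkewMonoidAlgebra A Γ` is the skew group ring `A ⋊ Γ`, in which `γ a = γ(a) γ`. -/

section Skew

variable {k A H Γ : Type u} [Field k] [Ring A] [Algebra k A] [Ring H] [Algebra k H] [Group Γ]
  [MulSemiringAction Γ A] [SMulCommClass Γ k A] [MulSemiringAction Γ H] [SMulCommClass Γ k H]

variable (k A Γ) in
/-- The inclusion `A → A ⋊ Γ`. -/
def inclAlg : A →ₐ[k] SkewMonoidAlgebra A Γ where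
  __ := (SkewMonoidAlgebra.singleOneRingHom : A →+* SkewMonoidAlgebra A Γ)
  commutes' _ := rfl

variable (k H Γ) in
/-- `M` is a simple object of the category of finite-dimensional `H`-semisimple
`H ⋊ Γ`-modules. -/
structure IsSimpleWeightModule (M : AlgModule k (SkewMonoidAlgebra H Γ)) : Prop where
  simple : IsSimpleModule (SkewMonoidAlgebra H Γ) M
  finite : FiniteDimensional k M
  semisimple : IsWeightSemisimple (inclAlg k H Γ) M

/-- `M` is an object of the BGG category `𝒪` of `A ⋊ Γ`, for a Cartan part `f : H → A` and a
subalgebra `B₊` of `A`. -/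
structure IsCategoryO (f : H →ₐ[k] A) (Bp : Subalgebra k A)
    (M : AlgModule k (SkewMonoidAlgebra A Γ)) : Prop where
  finitelyGenerated : Module.Finite (SkewMonoidAlgebra A Γ) M
  semisimple : IsWeightSemisimple ((inclAlg k A Γ).comp f) M
  finite_weightSpace : ∀ lam : H →ₐ[k] k,
    FiniteDimensional k (weightSpace ((inclAlg k A Γ).comp f) M lam)
  locallyFinite : ∀ m : M, FiniteDimensional k
    ↥(Submodule.span k (Set.range fun b : Bp => inclAlg k A Γ b • m))

/-- `M` is a simple object of `𝒪`. -/
def IsSimpleInO (f : H →ₐ[k] A) (Bp : Subalgebra k A)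
    (M : AlgModule k (SkewMonoidAlgebra A Γ)) : Prop :=
  IsCategoryO f Bp M ∧ IsSimpleModule (SkewMonoidAlgebra A Γ) M

/-- The formal character of `M`, as the function `lam ↦ dim M_lam` on the set of weights. -/
def character (f : H →ₐ[k] A) (M : AlgModule k (SkewMonoidAlgebra A Γ)) (lam : H →ₐ[k] k) : ℕ :=
  Module.finrank k (weightSpace ((inclAlg k A Γ).comp f) M lam)

/-- The relations which define the Verma module on an `H ⋊ Γ`-module `E`, inside `(A ⋊ Γ) ⊗ E`:
`h ⊗ e = 1 ⊗ h e`, `γ ⊗ e = 1 ⊗ γ e` and `n ⊗ e = 0`, for `h ∈ H`, `γ ∈ Γ` and `n ∈ N₊`. -/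
def vermaRelations (f : H →ₐ[k] A) (Np : Submodule k A)
    (E : AlgModule k (SkewMonoidAlgebra H Γ)) :
    Submodule (SkewMonoidAlgebra A Γ) (SkewMonoidAlgebra A Γ ⊗[k] E) :=
  Submodule.span (SkewMonoidAlgebra A Γ)
    ({t | ∃ (h : H) (e : E), t = inclAlg k A Γ (f h) ⊗ₜ[k] e - 1 ⊗ₜ[k] (inclAlg k H Γ h • e)} ∪
      {t | ∃ (γ : Γ) (e : E), t = SkewMonoidAlgebra.of A Γ γ ⊗ₜ[k] e -
        1 ⊗ₜ[k] (SkewMonoidAlgebra.of H Γ γ • e)} ∪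
      {t | ∃ n ∈ Np, ∃ e : E, t = inclAlg k A Γ n ⊗ₜ[k] e})

/-- The Verma module `Z(E)`: the `A ⋊ Γ`-module induced from the `(H ⊗ B₊) ⋊ Γ`-module `E` on
which `N₊` acts by zero. -/
def verma (f : H →ₐ[k] A) (Np : Submodule k A)
    (E : AlgModule k (SkewMonoidAlgebra H Γ)) : AlgModule k (SkewMonoidAlgebra A Γ) where
  carrier := (SkewMonoidAlgebra A Γ ⊗[k] E) ⧸ vermaRelations f Np E

/-- The module `V(E)`: the quotient of the Verma module `Z(E)` by the sum of all its proper
submodules. -/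
def vermaHead (f : H →ₐ[k] A) (Np : Submodule k A)
    (E : AlgModule k (SkewMonoidAlgebra H Γ)) : AlgModule k (SkewMonoidAlgebra A Γ) where
  carrier := verma f Np E ⧸
    sSup {N : Submodule (SkewMonoidAlgebra A Γ) (verma f Np E) | N ≠ ⊤}

end Skew

/-! ### Tensor products -/

section Tensor

variable {k : Type u} [Field k] {n : ℕ} {A H Γ : Fin n → Type u} [∀ i, Ring (A i)]
  [∀ i, Algebra k (A i)] [∀ i, Ring (H i)] [∀ i, Algebra k (H i)] [∀ i, Group (Γ i)]
  [∀ i, MulSemiringAction (Γ i) (A i)] [∀ i, SMulCommClass (Γ i) k (A i)]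

/-- The tensor product of algebra maps. -/
def tensorAlgHom (f : ∀ i, H i →ₐ[k] A i) : (⨂[k] i, H i) →ₐ[k] (⨂[k] i, A i) :=
  PiTensorProduct.liftAlgHom
    ((PiTensorProduct.tprod k).compLinearMap fun i => (f i).toLinearMap)
    (by simp only [MultilinearMap.compLinearMap_apply, AlgHom.toLinearMap_apply, Pi.one_apply,
          map_one]; rfl)
    (fun x y => by
      simp only [MultilinearMap.compLinearMap_apply, AlgHom.toLinearMap_apply, Pi.mul_apply,
        map_mul, PiTensorProduct.tprod_mul_tprod]
      rfl)

theorem tensorAlgHom_tprod (f : ∀ i, H i →ₐ[k] A i) (x : ∀ i, H i) :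
    tensorAlgHom f (PiTensorProduct.tprod k x) = PiTensorProduct.tprod k fun i => f i (x i) := by
  simp [tensorAlgHom]

/-- `(γ₁, …, γₙ)` acts on `⨂ Aᵢ` by `a₁ ⊗ ⋯ ⊗ aₙ ↦ γ₁(a₁) ⊗ ⋯ ⊗ γₙ(aₙ)`. -/
instance tensorAction : MulSemiringAction (∀ i, Γ i) (⨂[k] i, A i) where
  smul γ := tensorAlgHom fun i => MulSemiringAction.toAlgHom k (A i) (γ i)
  one_smul a := by
    change tensorAlgHom _ a = a
    induction a using PiTensorProduct.induction_on with
    | smul_tprod c x => rw [map_smul, tensorAlgHom_tprod]; simp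
    | add x y hx hy => rw [map_add, hx, hy]
  mul_smul γ γ' a := by
    change tensorAlgHom _ a = tensorAlgHom _ (tensorAlgHom _ a)
    induction a using PiTensorProduct.induction_on with
    | smul_tprod c x => simp only [map_smul, tensorAlgHom_tprod]; simp [mul_smul]
    | add x y hx hy => simp only [map_add, hx, hy]
  smul_zero γ := map_zero (tensorAlgHom fun i => MulSemiringAction.toAlgHom k (A i) (γ i))
  smul_add γ := map_add (tensorAlgHom fun i => MulSemiringAction.toAlgHom k (A i) (γ i))
  smul_one γ := map_one (tensorAlgHom fun i => MulSemiringAction.toAlgHom k (A i) (γ i))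
  smul_mul γ := map_mul (tensorAlgHom fun i => MulSemiringAction.toAlgHom k (A i) (γ i))

theorem tensorAction_tprod (γ : ∀ i, Γ i) (a : ∀ i, A i) :
    γ • (PiTensorProduct.tprod k a) = PiTensorProduct.tprod k fun i => γ i • a i :=
  tensorAlgHom_tprod _ a

instance tensorAction_smulCommClass : SMulCommClass (∀ i, Γ i) k (⨂[k] i, A i) where
  smul_comm γ c a := map_smul (tensorAlgHom fun i => MulSemiringAction.toAlgHom k (A i) (γ i)) c a

theorem of_mul_inclAlg {k A Γ : Type u} [Field k] [Ring A] [Algebra k A] [Group Γ]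
    [MulSemiringAction Γ A] [SMulCommClass Γ k A] (γ : Γ) (a : A) :
    inclAlg k A Γ (γ • a) * SkewMonoidAlgebra.of A Γ γ =
      SkewMonoidAlgebra.of A Γ γ * inclAlg k A Γ a := by
  change SkewMonoidAlgebra.single 1 (γ • a) * SkewMonoidAlgebra.of A Γ γ =
    SkewMonoidAlgebra.of A Γ γ * SkewMonoidAlgebra.single 1 a
  simp [SkewMonoidAlgebra.single_mul_single]

/-- The action of `⨂ Aᵢ` on `⨂ Mᵢ`, for `Aᵢ ⋊ Γᵢ`-modules `Mᵢ`. -/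
def tensorRepAlg (M : ∀ i, AlgModule k (SkewMonoidAlgebra (A i) (Γ i))) :
    (⨂[k] i, A i) →ₐ[k] Module.End k (⨂[k] i, M i) :=
  PiTensorProduct.liftAlgHom
    ((PiTensorProduct.mapMultilinear k (fun i => M i) (fun i => M i)).compLinearMap fun i =>
      ((Algebra.lsmul k k (M i)).comp (inclAlg k (A i) (Γ i))).toLinearMap)
    (by
      refine PiTensorProduct.ext (MultilinearMap.ext fun m => ?_)
      simp)
    (fun x y => by
      refine PiTensorProduct.ext (MultilinearMap.ext fun m => ?_)
      simp)

theorem tensorRepAlg_tprod (M : ∀ i, AlgModule k (SkewMonoidAlgebra (A i) (Γ i)))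
    (a : ∀ i, A i) (m : ∀ i, M i) :
    tensorRepAlg M (PiTensorProduct.tprod k a) (PiTensorProduct.tprod k m) =
      PiTensorProduct.tprod k fun i => inclAlg k (A i) (Γ i) (a i) • m i := by
  simp [tensorRepAlg]

/-- The action of `∏ Γᵢ` on `⨂ Mᵢ`, for `Aᵢ ⋊ Γᵢ`-modules `Mᵢ`. -/
def tensorRepGroup (M : ∀ i, AlgModule k (SkewMonoidAlgebra (A i) (Γ i))) :
    (∀ i, Γ i) →* Module.End k (⨂[k] i, M i) where
  toFun γ := PiTensorProduct.map fun i =>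
    Algebra.lsmul k k (M i) (SkewMonoidAlgebra.of (A i) (Γ i) (γ i))
  map_one' := by
    refine PiTensorProduct.ext (MultilinearMap.ext fun m => ?_)
    simp only [Pi.one_apply, map_one]
    simp
  map_mul' γ γ' := by
    refine PiTensorProduct.ext (MultilinearMap.ext fun m => ?_)
    simp only [Pi.mul_apply, map_mul]
    simp

theorem tensorRepGroup_tprod (M : ∀ i, AlgModule k (SkewMonoidAlgebra (A i) (Γ i)))
    (γ : ∀ i, Γ i) (m : ∀ i, M i) :
    tensorRepGroup M γ (PiTensorProduct.tprod k m) =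
      PiTensorProduct.tprod k fun i => SkewMonoidAlgebra.of (A i) (Γ i) (γ i) • m i := by
  simp only [tensorRepGroup, MonoidHom.coe_mk, OneHom.coe_mk, PiTensorProduct.map_tprod,
    Algebra.lsmul_coe]

/-- The action of `(⨂ Aᵢ) ⋊ (∏ Γᵢ)` on `⨂ Mᵢ`, for `Aᵢ ⋊ Γᵢ`-modules `Mᵢ`. -/
def tensorRep (M : ∀ i, AlgModule k (SkewMonoidAlgebra (A i) (Γ i))) :
    SkewMonoidAlgebra (⨂[k] i, A i) (∀ i, Γ i) →ₐ[k] Module.End k (⨂[k] i, M i) :=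
  SkewMonoidAlgebra.liftNCAlgHom (tensorRepAlg M) (tensorRepGroup M) (by
    intro x γ
    induction x using PiTensorProduct.induction_on with
    | smul_tprod c x =>
      rw [smul_comm γ c, tensorAction_tprod, map_smul (tensorRepAlg M) c,
        map_smul (tensorRepAlg M) c, smul_mul_assoc, mul_smul_comm]
      congr 1
      refine PiTensorProduct.ext (MultilinearMap.ext fun m => ?_)
      simp only [LinearMap.compMultilinearMap_apply, Module.End.mul_apply, tensorRepGroup_tprod,
        tensorRepAlg_tprod, smul_smul, of_mul_inclAlg]
    | add x y hx hy => rw [smul_add, map_add, map_add, add_mul, mul_add, hx, hy])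

/-- The `(⨂ Aᵢ) ⋊ (∏ Γᵢ)`-module `⨂ Mᵢ`. -/
def tensorModule (M : ∀ i, AlgModule k (SkewMonoidAlgebra (A i) (Γ i))) :
    AlgModule k (SkewMonoidAlgebra (⨂[k] i, A i) (∀ i, Γ i)) :=
  letI : Module (SkewMonoidAlgebra (⨂[k] i, A i) (∀ i, Γ i)) (⨂[k] i, M i) :=
    Module.compHom _ (tensorRep M).toRingHom
  { carrier := ⨂[k] i, M i
    isScalarTower := ⟨fun c r m => by
      change tensorRep M (c • r) m = c • tensorRep M r m
      rw [map_smul]; rfl⟩ }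

/-- `((a₁ ⊗ ⋯ ⊗ aₙ) (γ₁, …, γₙ)) (m₁ ⊗ ⋯ ⊗ mₙ) = (a₁ γ₁ m₁) ⊗ ⋯ ⊗ (aₙ γₙ mₙ)`. -/
theorem tensorModule_smul_tprod (M : ∀ i, AlgModule k (SkewMonoidAlgebra (A i) (Γ i)))
    (a : ∀ i, A i) (γ : ∀ i, Γ i) (m : ∀ i, M i) :
    SkewMonoidAlgebra.single γ (PiTensorProduct.tprod k a) •
        (show tensorModule M from PiTensorProduct.tprod k m) =
      (show tensorModule M from
        PiTensorProduct.tprod k fun i => SkewMonoidAlgebra.single (γ i) (a i) • m i) := by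
  change tensorRep M (SkewMonoidAlgebra.single γ (PiTensorProduct.tprod k a))
    (PiTensorProduct.tprod k m) = PiTensorProduct.tprod k fun i => _
  have h : tensorRep M (SkewMonoidAlgebra.single γ (PiTensorProduct.tprod k a)) =
      tensorRepAlg M (PiTensorProduct.tprod k a) * tensorRepGroup M γ := by
    simp [tensorRep, SkewMonoidAlgebra.liftNCAlgHom, SkewMonoidAlgebra.liftNCRingHom]
  rw [h, Module.End.mul_apply, tensorRepGroup_tprod, tensorRepAlg_tprod]
  congr 1
  funext i
  rw [smul_smul]
  change (SkewMonoidAlgebra.single 1 (a i) * SkewMonoidAlgebra.of (A i) (Γ i) (γ i)) • m i = _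
  simp [SkewMonoidAlgebra.single_mul_single]

/-- The subalgebra `⨂ Bᵢ` of `⨂ Aᵢ`. -/
def tensorSubalgebra (B : ∀ i, Subalgebra k (A i)) : Subalgebra k (⨂[k] i, A i) :=
  (tensorAlgHom fun i => (B i).val).range

/-- The augmentation ideal of `⨂ Bᵢ`, for algebras `Bᵢ` with augmentation ideals `Nᵢ`: it is
spanned by the `b₁ ⊗ ⋯ ⊗ bₙ` with some `bᵢ` in `Nᵢ`. -/
def tensorAugmentation (B : ∀ i, Subalgebra k (A i)) (N : ∀ i, Submodule k (A i)) :
    Submodule k (⨂[k] i, A i) :=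
  Submodule.span k {t | ∃ b : ∀ i, A i, (∀ i, b i ∈ B i) ∧ (∃ i, b i ∈ N i) ∧
    t = PiTensorProduct.tprod k b}

end Tensor

/-! ### The objects attached to a skew group ring over a regular triangular algebra -/

namespace SkewRTA

section Single

variable {k A Γ : Type u} [Field k] [Ring A] [Algebra k A] [Group Γ] [MulSemiringAction Γ A]
  [SMulCommClass Γ k A] (S : SkewRTA k A Γ)

/-- Modules over `H ⋊ Γ`. -/
abbrev CartanModule : Type (u + 1) := AlgModule k (SkewMonoidAlgebra S.H Γ)

/-- The (isomorphism class of the) `H ⋊ Γ`-module `x` is in `X`. -/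
def MemX (x : S.CartanModule) : Prop := IsSimpleWeightModule k S.H Γ x

/-- The simple quotient `V(x)` of the Verma module `Z(x)` of `A ⋊ Γ`. -/
def simpleModule (x : S.CartanModule) : AlgModule k (SkewMonoidAlgebra A Γ) :=
  vermaHead S.H.val S.Np x

/-- `V` is a simple object of the category `𝒪` of `A ⋊ Γ`. -/
def IsSimpleObject (V : AlgModule k (SkewMonoidAlgebra A Γ)) : Prop :=
  IsSimpleInO S.H.val S.Bp V

/-- The formal character of `V`. -/
def ch (V : AlgModule k (SkewMonoidAlgebra A Γ)) : (S.H →ₐ[k] k) → ℕ := character S.H.val V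

end Single

section Family

variable {k : Type u} [Field k] {n : ℕ} {A Γ : Fin n → Type u} [∀ i, Ring (A i)]
  [∀ i, Algebra k (A i)] [∀ i, Group (Γ i)] [∀ i, MulSemiringAction (Γ i) (A i)]
  [∀ i, SMulCommClass (Γ i) k (A i)] (S : ∀ i, SkewRTA k (A i) (Γ i))

/-- The Cartan part `H = ⨂ Hᵢ` of `A = ⨂ Aᵢ`. -/
abbrev TensorH : Type u := ⨂[k] i, (S i).H

/-- The inclusion of `H = ⨂ Hᵢ` in `A = ⨂ Aᵢ`. -/
def tensorInclH : TensorH S →ₐ[k] (⨂[k] i, A i) := tensorAlgHom fun i => (S i).H.val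

/-- Modules over `H ⋊ Γ`, for `H = ⨂ Hᵢ` and `Γ = ∏ Γᵢ`. -/
abbrev TensorCartanModule : Type (u + 1) := AlgModule k (SkewMonoidAlgebra (TensorH S) (∀ i, Γ i))

/-- The `H ⋊ Γ`-module `⨂ xᵢ`, for `Hᵢ ⋊ Γᵢ`-modules `xᵢ`. -/
def tensorCartanModule (x : ∀ i, (S i).CartanModule) : TensorCartanModule S :=
  tensorModule (k := k) (A := fun i => (S i).H) (Γ := Γ) x

/-- The (isomorphism class of the) `H ⋊ Γ`-module `y` is in `X`. -/
def TensorMemX (y : TensorCartanModule S) : Prop :=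
  IsSimpleWeightModule k (TensorH S) (∀ i, Γ i) y

/-- The simple quotient `V(y)` of the Verma module `Z(y)` of `A ⋊ Γ`. -/
def tensorSimpleModule (y : TensorCartanModule S) :
    AlgModule k (SkewMonoidAlgebra (⨂[k] i, A i) (∀ i, Γ i)) :=
  vermaHead (tensorInclH S) (tensorAugmentation (fun i => (S i).Bp) fun i => (S i).Np) y

/-- `V` is a simple object of the category `𝒪` of `A ⋊ Γ`, for `A = ⨂ Aᵢ` and `Γ = ∏ Γᵢ`. -/
def TensorIsSimpleObject (V : AlgModule k (SkewMonoidAlgebra (⨂[k] i, A i) (∀ i, Γ i))) : Prop :=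
  IsSimpleInO (tensorInclH S) (tensorSubalgebra fun i => (S i).Bp) V

/-- The formal character of `V`. -/
def tensorCh (V : AlgModule k (SkewMonoidAlgebra (⨂[k] i, A i) (∀ i, Γ i))) :
    (TensorH S →ₐ[k] k) → ℕ :=
  character (tensorInclH S) V

/-- The identification `G = ×ᵢ Gᵢ` of the weights of `H = ⨂ Hᵢ` with the tuples of weights of
the `Hᵢ`, by restriction along `h ↦ 1 ⊗ ⋯ ⊗ h ⊗ ⋯ ⊗ 1`. -/
def weightComponents (lam : TensorH S →ₐ[k] k) (i : Fin n) : (S i).H →ₐ[k] k :=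
  lam.comp (PiTensorProduct.singleAlgHom (R := k) (A := fun i => (S i).H) i)

end Family

end SkewRTA

end BGG

end

/-! Everything rests on highest weight theory, carried out once for an abstract triangular
decomposition (`IsTriangular`) and then applied both to each `Aᵢ` and to `A`. The abstract data are
a Γ-invariant relative height on weights, an `N₊` spanned by raising elements, a spanning set of
products `b h c` in which `b` is 1 or lowering and `c` is 1 or in `N₊`, and a projection of `A` onto
`H` killing `A N₊`. For a regular triangular algebra the height of `θ ∈ P` is the sum of the
coordinates of `π(θ)`; it is Γ-invariant because Γ permutes the simple roots (`SkewRTA.height_eq`).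
The abstract structure passes to tensor products by adding heights (`IsTriangular.tensor`), so the
tensor product never has to be made into a regular triangular algebra.

The weights of a simple `x` form one Γ-orbit, and since Γ is finite, comparable weights of an orbit
have relative height 0 (`IsHeight.eq_zero`). In a module generated by an image of `x` killed by
`N₊`, strictly lowered vectors never return to an orbit weight, so the weight spaces at orbit
weights lie in the image of `x` (`IsTriangular.mem_range`). A proper submodule therefore misses
these weights, the sum of all proper submodules is proper, and `V(x)` is simple. A simple module
with a nonzero singular map from `x` is `V(x)` (`IsTriangular.vermaHead_iso`). In a simple object of
`𝒪`, a nonzero weight vector of maximal height in some `B₊ v` is singular, and its Γ-span contains a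
suitable `x`; so the simple objects are modules `V(x)`.

For tensor products the point is that endomorphisms are scalars. This holds for `xᵢ`, which is a
line if `Γᵢ` is trivial and is covered by Schur's lemma over an algebraically closed field
otherwise; it holds for `Vᵢ(xᵢ)` because an endomorphism is determined on the copy of `xᵢ`. By
Jacobson density a tensor product of such simple modules is simple (`tensorModule_simple`).
Conversely, a simple finite-dimensional `H ⋊ Γ`-module contains a vector generating a simple module
over every factor, and is the tensor product of these (`IsSimpleWeightModule.exists_tensor`). Now `⨂
Vᵢ(xᵢ)` is simple and receives a nonzero singular map from `⨂ xᵢ`, so it is `V(⨂ xᵢ)`. Characters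
multiply because tensor products of weight bases are weight bases. -/

noncomputable section

namespace BGG

/-! ### Weight spaces -/

section Weights

variable {k H R : Type u} [Field k] [Ring H] [Algebra k H] [Ring R] [Algebra k R]

/-- Multiply the factors `(g - nu g) / (lam g - nu g)`, one for each `nu` in `s`, as in Lagrange
interpolation. Such elements act as weight projections on any given finite sum of weight vectors. -/
theorem exists_separating (lam : H →ₐ[k] k) (s : Finset (H →ₐ[k] k)) (hs : lam ∉ s) :
    ∃ h : H, lam h = 1 ∧ ∀ mu ∈ s, mu h = 0 := by
  classical
  induction s using Finset.induction_on with
  | empty => exact ⟨1, map_one lam, by simp⟩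
  | insert nu s _ ih =>
    simp only [Finset.mem_insert, not_or] at hs
    obtain ⟨h, h1, h2⟩ := ih hs.2
    obtain ⟨g, hg⟩ : ∃ g, lam g ≠ nu g := by
      by_contra! hc
      exact hs.1 (AlgHom.ext hc)
    have hne : lam g - nu g ≠ 0 := sub_ne_zero.2 hg
    refine ⟨h * ((lam g - nu g)⁻¹ • (g - algebraMap k H (nu g))), ?_, ?_⟩
    · simp [h1, hne]
    · intro mu hmu
      rcases Finset.mem_insert.1 hmu with rfl | hmu
      · simp
      · simp [h2 mu hmu]

variable (f : H →ₐ[k] R) {M : Type u} [AddCommGroup M] [Module k M] [Module R M]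
  [IsScalarTower k R M]

theorem smul_comm_of_algebra (c : k) (r : R) (m : M) : r • c • m = c • r • m := by
  rw [← algebraMap_smul R c m, ← algebraMap_smul R c (r • m), smul_smul, smul_smul,
    Algebra.commutes]

/-- An element of `H` that is 1 at `lam` and 0 at the other weights involved fixes `m` and removes
every summand of another weight. Several indices may share a weight, which is what graded pieces
indexed by `P` require. -/
theorem mem_iSup_of_mem_weightSpace {ι : Type*} {N : ι → Submodule k M} {wt : ι → H →ₐ[k] k}
    (hN : ∀ i, N i ≤ weightSpace f M (wt i)) {m : M} (hm : m ∈ ⨆ i, N i) {lam : H →ₐ[k] k}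
    (hm' : m ∈ weightSpace f M lam) : m ∈ ⨆ (i) (_ : wt i = lam), N i := by
  classical
  obtain ⟨c, hc, rfl⟩ := (Submodule.mem_iSup_iff_exists_finsupp _ _).1 hm
  obtain ⟨h, h1, h2⟩ := exists_separating lam ((c.support.image wt).erase lam) (by simp)
  have h3 := hm' h
  rw [h1, one_smul] at h3
  rw [← h3, Finsupp.sum, Finset.smul_sum]
  refine Submodule.sum_mem _ fun i hi => ?_
  rw [hN i (hc i) h]
  by_cases hl : wt i = lam
  · exact Submodule.smul_mem _ _ (Submodule.mem_iSup_of_mem i (Submodule.mem_iSup_of_mem hl (hc i)))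
  · rw [h2 (wt i) (by simp only [Finset.mem_erase, Finset.mem_image]; exact ⟨hl, i, hi, rfl⟩),
      zero_smul]
    exact Submodule.zero_mem _

theorem mem_of_mem_iSup_weightSpace {N : (H →ₐ[k] k) → Submodule k M}
    (hN : ∀ mu, N mu ≤ weightSpace f M mu) {m : M} (hm : m ∈ ⨆ mu, N mu) {lam : H →ₐ[k] k}
    (hm' : m ∈ weightSpace f M lam) : m ∈ N lam := by
  have := mem_iSup_of_mem_weightSpace f (wt := id) hN hm hm'
  simpa using this

/-- The components are obtained by acting with elements of `H`; hence they stay in every `H`-stable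
subspace. -/
theorem exists_weight_components {m : M} (hm : m ∈ ⨆ lam : H →ₐ[k] k, weightSpace f M lam) :
    ∃ c : (H →ₐ[k] k) →₀ M, m = c.sum (fun _ x => x) ∧ (∀ lam, c lam ∈ weightSpace f M lam) ∧
      ∀ lam, ∃ h, c lam = f h • m := by
  classical
  obtain ⟨c, hc, rfl⟩ := (Submodule.mem_iSup_iff_exists_finsupp _ _).1 hm
  refine ⟨c, rfl, hc, fun lam => ?_⟩
  obtain ⟨h, h1, h2⟩ := exists_separating lam (c.support.erase lam) (by simp)
  refine ⟨h, ?_⟩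
  rw [Finsupp.sum, Finset.smul_sum]
  have h3 : ∀ mu ∈ c.support, mu ≠ lam → f h • c mu = 0 := fun mu hmu hne => by
    rw [hc mu h, h2 mu (by simp [hne] at hmu ⊢; exact hmu), zero_smul]
  rw [Finset.sum_eq_single lam h3, hc lam h, h1, one_smul]
  intro hl
  rw [Finsupp.notMem_support_iff.1 hl, smul_zero]

theorem IsWeightSemisimple.eq_iSup_inf {f : H →ₐ[k] R} (hM : IsWeightSemisimple f M) (N : Submodule k M)
    (hN : ∀ (h : H) (m : M), m ∈ N → f h • m ∈ N) : N = ⨆ lam, N ⊓ weightSpace f M lam := by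
  refine le_antisymm (fun m hm => ?_) (iSup_le fun _ => inf_le_left)
  obtain ⟨c, h1, h2, h3⟩ := exists_weight_components f (m := m) (by
    rw [hM]; exact Submodule.mem_top)
  rw [h1]
  refine Submodule.sum_mem _ fun lam _ => Submodule.mem_iSup_of_mem lam ⟨?_, h2 lam⟩
  obtain ⟨h, hh⟩ := h3 lam
  rw [hh]
  exact hN h m hm

theorem exists_weight_vector [Nontrivial M] (hM : IsWeightSemisimple f M) :
    ∃ (lam : H →ₐ[k] k) (m : M), m ∈ weightSpace f M lam ∧ m ≠ 0 := by
  by_contra! hc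
  have : (⊤ : Submodule k M) = ⊥ := by
    rw [← hM, eq_bot_iff]
    exact iSup_le fun lam m hm => (Submodule.mem_bot k).2 (hc lam m hm)
  exact top_ne_bot this

variable {f} {M' : Type u} [AddCommGroup M'] [Module k M']

variable [Module R M'] [IsScalarTower k R M']

theorem map_mem_weightSpace (φ : M →ₗ[k] M')
    (hφ : ∀ h m, φ (f h • m) = f h • φ m) {lam : H →ₐ[k] k} {m : M}
    (hm : m ∈ weightSpace f M lam) : φ m ∈ weightSpace f M' lam := fun h => by
  rw [← hφ, hm, map_smul]

theorem IsWeightSemisimple.of_surjective (hM : IsWeightSemisimple f M) (φ : M →ₗ[R] M')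
    (hφ : Function.Surjective φ) : IsWeightSemisimple f M' := by
  rw [IsWeightSemisimple, eq_top_iff] at *
  intro m _
  obtain ⟨m, rfl⟩ := hφ m
  obtain ⟨c, h1, h2, -⟩ := exists_weight_components f (hM (Submodule.mem_top (x := m)))
  rw [h1, map_finsuppSum]
  exact Submodule.sum_mem _ fun lam _ => Submodule.mem_iSup_of_mem lam
    (map_mem_weightSpace (φ.restrictScalars k) (fun h m => φ.map_smul _ _) (h2 lam))

/-- Isomorphic modules have isomorphic weight spaces. -/
def weightSpaceEquiv (e : M ≃ₗ[R] M') (lam : H →ₐ[k] k) :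
    weightSpace f M lam ≃ₗ[k] weightSpace f M' lam :=
  LinearEquiv.ofLinearMap
    (LinearMap.restrict (e.restrictScalars k).toLinearMap fun _ hm =>
      map_mem_weightSpace (e.restrictScalars k).toLinearMap (fun _ _ => e.map_smul _ _) hm)
    (LinearMap.restrict (e.symm.restrictScalars k).toLinearMap fun _ hm =>
      map_mem_weightSpace (e.symm.restrictScalars k).toLinearMap (fun _ _ => e.symm.map_smul _ _) hm)
    (by ext; simp) (by ext; simp)

end Weights

/-! ### Constructions with modules -/

namespace AlgModule

variable {k R R' : Type u} [Field k] [Ring R] [Algebra k R] [Ring R'] [Algebra k R']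

theorem Iso.symm {M N : AlgModule k R} (h : M.Iso N) : N.Iso M := h.map LinearEquiv.symm

theorem Iso.trans {M N P : AlgModule k R} (h : M.Iso N) (h' : N.Iso P) : M.Iso P :=
  ⟨h.some.trans h'.some⟩

/-- Restriction of scalars along an algebra map. -/
def pull (φ : R →ₐ[k] R') (M : AlgModule k R') : AlgModule k R :=
  letI : Module R M := Module.compHom M φ.toRingHom
  { carrier := M
    isScalarTower := ⟨fun c r m => by
      change φ (c • r) • m = c • φ r • m
      rw [map_smul, smul_assoc]⟩ }

/-- A submodule, as a module. -/
def sub (M : AlgModule k R) (N : Submodule R M) : AlgModule k R where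
  carrier := N

end AlgModule

/-! ### Skew group rings -/

section Skew

variable {k A H Γ : Type u} [Field k] [Ring A] [Algebra k A] [Ring H] [Algebra k H] [Group Γ]
  [MulSemiringAction Γ A] [SMulCommClass Γ k A] [MulSemiringAction Γ H] [SMulCommClass Γ k H]

theorem single_eq_inclAlg_mul_of (γ : Γ) (a : A) :
    SkewMonoidAlgebra.single γ a = inclAlg k A Γ a * SkewMonoidAlgebra.of A Γ γ := by
  change _ = SkewMonoidAlgebra.single 1 a * _
  simp [SkewMonoidAlgebra.single_mul_single]

theorem inclAlg_apply (a : A) : inclAlg k A Γ a = SkewMonoidAlgebra.single 1 a := rfl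

/-- A `k`-subspace which is stable under `A` and `Γ` is an `A ⋊ Γ`-submodule. -/
def skewSubmodule {M : Type u} [AddCommGroup M] [Module k M] [Module (SkewMonoidAlgebra A Γ) M]
    (W : Submodule k M) (hA : ∀ a : A, ∀ m ∈ W, inclAlg k A Γ a • m ∈ W)
    (hΓ : ∀ γ : Γ, ∀ m ∈ W, SkewMonoidAlgebra.of A Γ γ • m ∈ W) :
    Submodule (SkewMonoidAlgebra A Γ) M where
  carrier := W
  zero_mem' := W.zero_mem
  add_mem' := W.add_mem
  smul_mem' r m hm := by
    induction r using SkewMonoidAlgebra.induction_on with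
    | zero => rw [zero_smul]; exact W.zero_mem
    | single γ a =>
      rw [single_eq_inclAlg_mul_of (k := k), mul_smul]
      exact hA _ _ (hΓ _ _ hm)
    | add r s hr hs => rw [add_smul]; exact W.add_mem hr hs

/-- A `k`-linear map which commutes with `A` and `Γ` is `A ⋊ Γ`-linear. -/
def skewLinearMap {M N : Type u} [AddCommGroup M] [Module k M] [Module (SkewMonoidAlgebra A Γ) M]
    [AddCommGroup N] [Module k N] [Module (SkewMonoidAlgebra A Γ) N] (φ : M →ₗ[k] N)
    (hA : ∀ (a : A) m, φ (inclAlg k A Γ a • m) = inclAlg k A Γ a • φ m)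
    (hΓ : ∀ (γ : Γ) m, φ (SkewMonoidAlgebra.of A Γ γ • m) = SkewMonoidAlgebra.of A Γ γ • φ m) :
    M →ₗ[SkewMonoidAlgebra A Γ] N where
  toFun := φ
  map_add' := map_add φ
  map_smul' r m := by
    induction r using SkewMonoidAlgebra.induction_on with
    | zero => simp
    | single γ a =>
      rw [single_eq_inclAlg_mul_of (k := k), mul_smul, hA, hΓ, RingHom.id_apply, mul_smul]
    | add r s hr hs => simp only [add_smul, map_add, hr, hs, RingHom.id_apply]

/-- The algebra map `H ⋊ Γ → A ⋊ Γ` induced by a `Γ`-equivariant map `H → A`. -/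
def skewMap (f : H →ₐ[k] A) (hf : ∀ (γ : Γ) (h : H), f (γ • h) = γ • f h) :
    SkewMonoidAlgebra H Γ →ₐ[k] SkewMonoidAlgebra A Γ :=
  SkewMonoidAlgebra.liftNCAlgHom ((inclAlg k A Γ).comp f) (SkewMonoidAlgebra.of A Γ) (by
    intro h γ
    simp only [AlgHom.comp_apply, hf, of_mul_inclAlg])

theorem skewMap_inclAlg (f : H →ₐ[k] A) (hf : ∀ (γ : Γ) (h : H), f (γ • h) = γ • f h) (h : H) :
    skewMap f hf (inclAlg k H Γ h) = inclAlg k A Γ (f h) := by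
  simp [skewMap, SkewMonoidAlgebra.liftNCAlgHom, SkewMonoidAlgebra.liftNCRingHom, inclAlg_apply]

theorem skewMap_of (f : H →ₐ[k] A) (hf : ∀ (γ : Γ) (h : H), f (γ • h) = γ • f h) (γ : Γ) :
    skewMap f hf (SkewMonoidAlgebra.of H Γ γ) = SkewMonoidAlgebra.of A Γ γ := by
  simp [skewMap, SkewMonoidAlgebra.liftNCAlgHom, SkewMonoidAlgebra.liftNCRingHom]

/-- The action of `Γ` on the weights of `H`. -/
def dualAct (γ : Γ) (lam : H →ₐ[k] k) : H →ₐ[k] k :=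
  lam.comp (MulSemiringAction.toAlgHom k H γ⁻¹)

theorem dualAct_apply (γ : Γ) (lam : H →ₐ[k] k) (h : H) : dualAct γ lam h = lam (γ⁻¹ • h) := rfl

theorem dualAct_one (lam : H →ₐ[k] k) : dualAct (1 : Γ) lam = lam := by
  ext h; simp [dualAct_apply]

theorem dualAct_mul (γ γ' : Γ) (lam : H →ₐ[k] k) :
    dualAct (γ * γ') lam = dualAct γ (dualAct γ' lam) := by
  ext h; simp [dualAct_apply, mul_smul]

/-- In the skew group ring `h γ = γ γ⁻¹(h)`, so `γ` moves the weight `lam` to `lam ∘ γ⁻¹`. -/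
theorem of_smul_mem_weightSpace {f : H →ₐ[k] A} (hf : ∀ (γ : Γ) (h : H), f (γ • h) = γ • f h)
    {M : Type u} [AddCommGroup M] [Module k M] [Module (SkewMonoidAlgebra A Γ) M]
    [IsScalarTower k (SkewMonoidAlgebra A Γ) M] (γ : Γ) {lam : H →ₐ[k] k} {m : M}
    (hm : m ∈ weightSpace ((inclAlg k A Γ).comp f) M lam) :
    SkewMonoidAlgebra.of A Γ γ • m ∈
      weightSpace ((inclAlg k A Γ).comp f) M (dualAct γ lam) := fun h => by
  have h1 : f h = γ • f (γ⁻¹ • h) := by rw [← hf, smul_inv_smul]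
  rw [AlgHom.comp_apply, h1, smul_smul, of_mul_inclAlg, mul_smul, dualAct_apply,
    ← smul_comm_of_algebra]
  congr 1
  exact hm _

end Skew

/-! ### Independence of weight vectors, and submodules of weight modules -/

section Weights

variable {k H R : Type u} [Field k] [Ring H] [Algebra k H] [Ring R] [Algebra k R]
  (f : H →ₐ[k] R) {M : Type u} [AddCommGroup M] [Module k M] [Module R M] [IsScalarTower k R M]

theorem linearIndependent_of_weight {ι : Type*} {w : ι → M} {wt : ι → H →ₐ[k] k}
    (hwt : Function.Injective wt) (hw : ∀ i, w i ∈ weightSpace f M (wt i)) (h0 : ∀ i, w i ≠ 0) :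
    LinearIndependent k w := by
  classical
  rw [linearIndependent_iff']
  intro s g hg i hi
  obtain ⟨h, h1, h2⟩ := exists_separating (wt i) ((s.image wt).erase (wt i)) (by simp)
  have h3 : f h • ∑ j ∈ s, g j • w j = 0 := by rw [hg, smul_zero]
  rw [Finset.smul_sum, Finset.sum_eq_single i] at h3
  · rw [smul_comm_of_algebra, hw i h, h1, one_smul] at h3
    exact (smul_eq_zero.1 h3).resolve_right (h0 i)
  · intro j hj hji
    have : wt j h = 0 := h2 _ (Finset.mem_erase.2 ⟨fun he => hji (hwt he), Finset.mem_image_of_mem _ hj⟩)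
    rw [smul_comm_of_algebra, hw j h, this, zero_smul, smul_zero]
  · exact fun hn => absurd hi hn

variable {f} in
theorem IsWeightSemisimple.submodule (hM : IsWeightSemisimple f M) (N : Submodule R M) :
    IsWeightSemisimple f N := by
  rw [IsWeightSemisimple, eq_top_iff]
  intro n _
  obtain ⟨c, h1, h2, h3⟩ := exists_weight_components f (m := (n : M)) (by
    rw [hM]; exact Submodule.mem_top)
  choose h hh using h3
  have h4 : n = ∑ lam ∈ c.support, f (h lam) • n := Subtype.ext (by
    rw [Submodule.coe_sum]
    simp only [Submodule.coe_smul, ← hh]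
    exact h1)
  rw [h4]
  refine Submodule.sum_mem _ fun lam _ => Submodule.mem_iSup_of_mem lam fun g => Subtype.ext ?_
  have h5 := h2 lam g
  rw [hh] at h5
  exact h5

end Weights

/-! ### Highest weight theory for an abstract triangular decomposition -/

section HighestWeight

variable {k A H Γ : Type u} [Field k] [Ring A] [Algebra k A] [Ring H] [Algebra k H] [Group Γ]
  [MulSemiringAction Γ A] [SMulCommClass Γ k A] [MulSemiringAction Γ H] [SMulCommClass Γ k H]

/-- `a` shifts weights by the height `d`, for the height relation `T` on weights, in which
`T d lam mu` means that `mu` is above `lam` by `d`. -/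
def Shift (Γ : Type u) [Group Γ] [MulSemiringAction Γ A] [SMulCommClass Γ k A] (f : H →ₐ[k] A)
    (T : ℤ → (H →ₐ[k] k) → (H →ₐ[k] k) → Prop) (d : ℤ) (a : A) : Prop :=
  ∀ (M : AlgModule k (SkewMonoidAlgebra A Γ)) (lam : H →ₐ[k] k) (m : M),
    m ∈ weightSpace ((inclAlg k A Γ).comp f) M lam → ∃ mu, T d lam mu ∧
      inclAlg k A Γ a • m ∈ weightSpace ((inclAlg k A Γ).comp f) M mu

/-- A `Γ`-invariant relative height on weights. -/
structure IsHeight (Γ : Type u) [Group Γ] [MulSemiringAction Γ H] [SMulCommClass Γ k H]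
    (T : ℤ → (H →ₐ[k] k) → (H →ₐ[k] k) → Prop) : Prop where
  refl : ∀ lam, T 0 lam lam
  symm : ∀ {d lam mu}, T d lam mu → T (-d) mu lam
  trans : ∀ {d e lam mu nu}, T d lam mu → T e mu nu → T (d + e) lam nu
  unique : ∀ {d e lam mu}, T d lam mu → T e lam mu → d = e
  smul : ∀ (γ : Γ) {d lam mu}, T d lam mu → T d (dualAct γ lam) (dualAct γ mu)

/-- The features of a triangular decomposition on which the theory of highest weight modules
rests. -/
structure IsTriangular (Γ : Type u) [Group Γ] [MulSemiringAction Γ A] [SMulCommClass Γ k A]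
    [MulSemiringAction Γ H] [SMulCommClass Γ k H] (T : ℤ → (H →ₐ[k] k) → (H →ₐ[k] k) → Prop)
    (f : H →ₐ[k] A) (Bp : Subalgebra k A) (Np : Submodule k A) : Prop extends IsHeight Γ T where
  equivariant : ∀ (γ : Γ) (h : H), f (γ • h) = γ • f h
  Np_le : Np ≤ Subalgebra.toSubmodule Bp
  smul_Np : ∀ (γ : Γ), ∀ n ∈ Np, γ • n ∈ Np
  -- The homogeneous elements are themselves in `N₊`, so they can be multiplied with elements of
  -- `B₊` without leaving `B₊`.
  Np_le_span : Np ≤ Submodule.span k {n | n ∈ Np ∧ ∃ d > 0, Shift Γ f T d n}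
  Bp_le_sup : Subalgebra.toSubmodule Bp ≤ Submodule.span k {1} ⊔ Np
  -- On a singular vector `b f(h) c` vanishes when `c ∈ N₊` and acts as `b f(h)` when `c = 1`, so
  -- only the identity and lowering operators move it out of the `H`-module it generates.
  span_lower : Submodule.span k {a | ∃ (b : A) (h : H) (c : A), a = b * f h * c ∧
    (b = 1 ∨ ∃ d < 0, Shift Γ f T d b) ∧ (c = 1 ∨ c ∈ Np)} = ⊤
  -- This induces a retraction of the Verma module onto `E`, which shows that `E` embeds.
  exists_proj : ∃ p : A →ₗ[k] H, p 1 = 1 ∧ (∀ a h, p (a * f h) = p a * h) ∧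
    ∀ a, ∀ n ∈ Np, p (a * n) = 0

/-- A triangular decomposition with finite-dimensional pieces. -/
structure IsFiniteTriangular (Γ : Type u) [Group Γ] [MulSemiringAction Γ A] [SMulCommClass Γ k A]
    [MulSemiringAction Γ H] [SMulCommClass Γ k H] (T : ℤ → (H →ₐ[k] k) → (H →ₐ[k] k) → Prop)
    (f : H →ₐ[k] A) (Bp : Subalgebra k A) (Np : Submodule k A) : Prop extends
    IsTriangular Γ T f Bp Np where
  -- Only a finite-dimensional space of lowering operators is needed to reach heights at least `D`;
  -- this bounds weight spaces.
  lower_finite : ∀ D : ℤ, ∃ F : Submodule k A, FiniteDimensional k F ∧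
    Submodule.span k {a | ∃ (b : A) (h : H) (c : A), a = b * f h * c ∧
      (b ∈ F ∨ ∃ d < D, Shift Γ f T d b) ∧ (c = 1 ∨ c ∈ Np)} = ⊤
  -- Modulo operators that raise by more than `D`, the algebra `B₊` is finite-dimensional; this
  -- gives local finiteness.
  raise_finite : ∀ D : ℤ, ∃ F : Submodule k A, FiniteDimensional k F ∧
    Subalgebra.toSubmodule Bp ≤ F ⊔ Submodule.span k {b | ∃ d > D, Shift Γ f T d b}

theorem IsHeight.pow {T : ℤ → (H →ₐ[k] k) → (H →ₐ[k] k) → Prop} (hT : IsHeight Γ T) {d : ℤ}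
    {γ : Γ} {lam : H →ₐ[k] k} (h : T d lam (dualAct γ lam)) (m : ℕ) :
    T (m * d) lam (dualAct (γ ^ m) lam) := by
  induction m with
  | zero => simpa [dualAct_one] using hT.refl lam
  | succ m ih =>
    have := hT.trans h (hT.smul γ ih)
    rw [← dualAct_mul, ← pow_succ'] at this
    convert this using 1
    push_cast; ring

/-- Replace `γ'(lam)` by `lam`. Iterating a step of height `d` along `γ` gives height `m d` between
`lam` and `γ^m(lam)`; at the order of `γ` the two weights agree, and uniqueness of heights forces `d
= 0`. -/
theorem IsHeight.eq_zero [Finite Γ] {T : ℤ → (H →ₐ[k] k) → (H →ₐ[k] k) → Prop}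
    (hT : IsHeight Γ T) {d : ℤ} {γ γ' : Γ} {lam : H →ₐ[k] k}
    (h : T d (dualAct γ' lam) (dualAct γ lam)) : d = 0 := by
  have h1 : T d (dualAct γ' lam) (dualAct (γ * γ'⁻¹) (dualAct γ' lam)) := by
    rwa [← dualAct_mul, inv_mul_cancel_right]
  have h2 := hT.pow h1 (orderOf (γ * γ'⁻¹))
  rw [pow_orderOf_eq_one, dualAct_one] at h2
  have h3 := hT.unique h2 (hT.refl _)
  have h4 := orderOf_pos (γ * γ'⁻¹)
  rcases mul_eq_zero.1 h3 with h5 | h5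
  · omega
  · exact h5

/-- Hence the height of a weight relative to a whole Γ-orbit is well defined. -/
theorem IsHeight.eq [Finite Γ] {T : ℤ → (H →ₐ[k] k) → (H →ₐ[k] k) → Prop}
    (hT : IsHeight Γ T) {d e : ℤ} {γ γ' : Γ} {lam mu : H →ₐ[k] k}
    (h : T d (dualAct γ lam) mu) (h' : T e (dualAct γ' lam) mu) : d = e := by
  have := hT.eq_zero (hT.trans h (hT.symm h'))
  omega

/-! ### Maps from an `H ⋊ Γ`-module onto singular vectors -/

/-- `ψ : E → M` is `H ⋊ Γ`-linear with image annihilated by `N₊`. -/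
structure IsSingularMap (f : H →ₐ[k] A) (Np : Submodule k A)
    {E : AlgModule k (SkewMonoidAlgebra H Γ)} {M : AlgModule k (SkewMonoidAlgebra A Γ)}
    (ψ : E →ₗ[k] M) : Prop where
  map_H : ∀ (h : H) (e : E), ψ (inclAlg k H Γ h • e) = inclAlg k A Γ (f h) • ψ e
  map_group : ∀ (γ : Γ) (e : E),
    ψ (SkewMonoidAlgebra.of H Γ γ • e) = SkewMonoidAlgebra.of A Γ γ • ψ e
  map_Np : ∀ n ∈ Np, ∀ e : E, inclAlg k A Γ n • ψ e = 0

variable {f : H →ₐ[k] A} {Np : Submodule k A} {Bp : Subalgebra k A}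
  {T : ℤ → (H →ₐ[k] k) → (H →ₐ[k] k) → Prop}
  {E : AlgModule k (SkewMonoidAlgebra H Γ)} {M M' : AlgModule k (SkewMonoidAlgebra A Γ)}
  {ψ : E →ₗ[k] M}

theorem IsSingularMap.comp (hψ : IsSingularMap f Np ψ) (φ : M →ₗ[SkewMonoidAlgebra A Γ] M') :
    IsSingularMap f Np (φ.restrictScalars k ∘ₗ ψ) where
  map_H h e := by simp [hψ.map_H]
  map_group γ e := by
    simp only [LinearMap.comp_apply, hψ.map_group, LinearMap.restrictScalars_apply, map_smul]
  map_Np n hn e := by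
    simp only [LinearMap.comp_apply, LinearMap.restrictScalars_apply, ← map_smul,
      hψ.map_Np n hn, map_zero]

/-- The preimage of a submodule under a singular map. -/
def IsSingularMap.comap (hψ : IsSingularMap f Np ψ) (N : Submodule (SkewMonoidAlgebra A Γ) M) :
    Submodule (SkewMonoidAlgebra H Γ) E :=
  skewSubmodule ((N.restrictScalars k).comap ψ)
    (fun h e he => by
      simp only [Submodule.mem_comap, Submodule.restrictScalars_mem] at he ⊢
      rw [hψ.map_H]; exact N.smul_mem _ he)
    (fun γ e he => by
      simp only [Submodule.mem_comap, Submodule.restrictScalars_mem] at he ⊢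
      rw [hψ.map_group]; exact N.smul_mem _ he)

theorem IsSingularMap.mem_comap (hψ : IsSingularMap f Np ψ)
    {N : Submodule (SkewMonoidAlgebra A Γ) M} {e : E} : e ∈ hψ.comap N ↔ ψ e ∈ N := Iff.rfl

/-- The preimage of `N` is a submodule of the simple module `E`, so it is everything as soon as it
is nonzero. -/
theorem IsSingularMap.range_le [IsSimpleModule (SkewMonoidAlgebra H Γ) E]
    (hψ : IsSingularMap f Np ψ) {N : Submodule (SkewMonoidAlgebra A Γ) M} {e : E} (he : e ≠ 0)
    (hN : ψ e ∈ N) (e' : E) : ψ e' ∈ N := by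
  rcases eq_bot_or_eq_top (hψ.comap N) with h | h
  · have h1 : e ∈ hψ.comap N := hψ.mem_comap.2 hN
    rw [h, Submodule.mem_bot] at h1
    exact absurd h1 he
  · rw [← hψ.mem_comap, h]; exact Submodule.mem_top

theorem IsSingularMap.injective [IsSimpleModule (SkewMonoidAlgebra H Γ) E]
    (hψ : IsSingularMap f Np ψ) (h0 : ψ ≠ 0) : Function.Injective ψ := by
  rw [injective_iff_map_eq_zero]
  intro e he
  by_contra hne
  refine h0 (LinearMap.ext fun e' => ?_)
  have := hψ.range_le (N := ⊥) hne (by rw [he]; exact Submodule.zero_mem _) e'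
  simpa using this

theorem IsSingularMap.span_range_eq_top [IsSimpleModule (SkewMonoidAlgebra A Γ) M] (h0 : ψ ≠ 0) :
    Submodule.span (SkewMonoidAlgebra A Γ) (Set.range ψ) = ⊤ := by
  refine (eq_bot_or_eq_top _).resolve_left fun h => h0 (LinearMap.ext fun e => ?_)
  rw [Submodule.span_eq_bot] at h
  exact h _ ⟨e, rfl⟩

/-! ### Weights of a simple `H ⋊ Γ`-module -/

/-- The weight spaces over one Γ-orbit add up to a nonzero `H ⋊ Γ`-submodule, which simplicity makes
the whole module. -/
theorem IsSimpleWeightModule.exists_orbit (hE : IsSimpleWeightModule k H Γ E) :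
    ∃ lam : H →ₐ[k] k, (∃ e ∈ weightSpace (inclAlg k H Γ) E lam, e ≠ 0) ∧
      ⨆ γ : Γ, weightSpace (inclAlg k H Γ) E (dualAct γ lam) = ⊤ := by
  have := hE.simple
  have := IsSimpleModule.nontrivial (SkewMonoidAlgebra H Γ) E
  obtain ⟨lam, e, he, h0⟩ := exists_weight_vector (inclAlg k H Γ) hE.semisimple
  refine ⟨lam, ⟨e, he, h0⟩, ?_⟩
  set W := ⨆ γ : Γ, weightSpace (inclAlg k H Γ) E (dualAct γ lam) with hW
  let S := skewSubmodule (A := H) (Γ := Γ) W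
    (fun h m hm => by
      induction hm using Submodule.iSup_induction' with
      | mem γ m hm =>
        rw [hm h]
        exact W.smul_mem _ (Submodule.mem_iSup_of_mem γ hm)
      | zero => rw [smul_zero]; exact W.zero_mem
      | add x y _ _ hx hy => rw [smul_add]; exact W.add_mem hx hy)
    (fun γ m hm => by
      induction hm using Submodule.iSup_induction' with
      | mem γ' m hm =>
        refine Submodule.mem_iSup_of_mem (γ * γ') ?_
        rw [dualAct_mul]
        exact of_smul_mem_weightSpace (f := AlgHom.id k H) (fun _ _ => rfl) γ hm
      | zero => rw [smul_zero]; exact W.zero_mem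
      | add x y _ _ hx hy => rw [smul_add]; exact W.add_mem hx hy)
  have h1 : e ∈ S := Submodule.mem_iSup_of_mem (p := fun γ : Γ =>
    weightSpace (inclAlg k H Γ) E (dualAct γ lam)) 1 (by rwa [dualAct_one])
  rcases eq_bot_or_eq_top S with h | h
  · rw [h, Submodule.mem_bot] at h1
    exact absurd h1 h0
  · rw [eq_top_iff]
    intro m _
    have : m ∈ S := by rw [h]; exact Submodule.mem_top
    exact this

/-! ### Highest weight modules -/

theorem IsSingularMap.map_mem_weightSpace (hψ : IsSingularMap f Np ψ) {lam : H →ₐ[k] k} {e : E}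
    (he : e ∈ weightSpace (inclAlg k H Γ) E lam) :
    ψ e ∈ weightSpace ((inclAlg k A Γ).comp f) M lam := fun h => by
  rw [AlgHom.comp_apply, ← hψ.map_H, he h, map_smul]

/-- If the `b f(h) c` with `b ∈ L` and `c = 1` or `c ∈ N₊` span `A`, then the `b ψ(e)` with
`b ∈ L` span the module generated by the image of `ψ`. -/
theorem IsSingularMap.mem_of_span (hψ : IsSingularMap f Np ψ)
    (hgen : Submodule.span (SkewMonoidAlgebra A Γ) (Set.range ψ) = ⊤) {L : Set A}
    (hL : Submodule.span k {a | ∃ (b : A) (h : H) (c : A), a = b * f h * c ∧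
      b ∈ L ∧ (c = 1 ∨ c ∈ Np)} = ⊤)
    {lam : H →ₐ[k] k} (htop : ⨆ γ : Γ, weightSpace (inclAlg k H Γ) E (dualAct γ lam) = ⊤)
    {W : Submodule k M} (hW : ∀ b ∈ L, ∀ (γ : Γ) (e : E),
      e ∈ weightSpace (inclAlg k H Γ) E (dualAct γ lam) → inclAlg k A Γ b • ψ e ∈ W) (m : M) :
    m ∈ W := by
  have h1 : ∀ b ∈ L, ∀ e : E, inclAlg k A Γ b • ψ e ∈ W := fun b hb e => by
    have he : e ∈ ⨆ γ : Γ, weightSpace (inclAlg k H Γ) E (dualAct γ lam) := by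
      rw [htop]; exact Submodule.mem_top
    induction he using Submodule.iSup_induction' with
    | mem γ e he => exact hW b hb γ e he
    | zero => rw [map_zero, smul_zero]; exact W.zero_mem
    | add x y _ _ hx hy => rw [map_add, smul_add]; exact W.add_mem hx hy
  have h2 : ∀ (a : A) (e : E), inclAlg k A Γ a • ψ e ∈ W := fun a e => by
    have ha : a ∈ Submodule.span k {a | ∃ (b : A) (h : H) (c : A), a = b * f h * c ∧
      b ∈ L ∧ (c = 1 ∨ c ∈ Np)} := by rw [hL]; exact Submodule.mem_top
    induction ha using Submodule.span_induction with
    | mem a ha =>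
      obtain ⟨b, h, c, rfl, hb, hc | hc⟩ := ha
      · rw [hc, mul_one, map_mul, mul_smul, ← hψ.map_H]
        exact h1 b hb _
      · rw [map_mul, mul_smul, hψ.map_Np c hc, smul_zero]
        exact W.zero_mem
    | zero => rw [map_zero, zero_smul]; exact W.zero_mem
    | add x y _ _ hx hy => rw [map_add, add_smul]; exact W.add_mem hx hy
    | smul c x _ hx => rw [map_smul, smul_assoc]; exact W.smul_mem c hx
  have hm : m ∈ Submodule.span (SkewMonoidAlgebra A Γ) (Set.range ψ) := by
    rw [hgen]; exact Submodule.mem_top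
  obtain ⟨c, rfl⟩ := (Finsupp.mem_span_range_iff_exists_finsupp).1 hm
  refine W.sum_mem fun e _ => ?_
  change c e • ψ e ∈ W
  generalize c e = r
  -- The group part is absorbed by the equivariance of `ψ`, leaving only elements of `A`.
  induction r using SkewMonoidAlgebra.induction_on with
  | zero => rw [zero_smul]; exact W.zero_mem
  | single γ a =>
    rw [single_eq_inclAlg_mul_of (k := k), mul_smul, ← hψ.map_group]
    exact h2 _ _
  | add r s hr hs => rw [add_smul]; exact W.add_mem hr hs

/-- The module is spanned by the image of `ψ`, with weights in the orbit, and by vectors strictly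
below it. The family `N` is left free: different choices give semisimplicity, the description of the
orbit weight spaces and the upper bound on weights. -/
theorem IsTriangular.iSup_eq_top (hT : IsTriangular Γ T f Bp Np) (hψ : IsSingularMap f Np ψ)
    (hgen : Submodule.span (SkewMonoidAlgebra A Γ) (Set.range ψ) = ⊤)
    {lam : H →ₐ[k] k} (htop : ⨆ γ : Γ, weightSpace (inclAlg k H Γ) E (dualAct γ lam) = ⊤)
    {N : (H →ₐ[k] k) → Submodule k M}
    (h1 : ∀ (γ : Γ) (e : E), e ∈ weightSpace (inclAlg k H Γ) E (dualAct γ lam) →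
      ψ e ∈ N (dualAct γ lam))
    (h2 : ∀ mu, (∃ (γ : Γ), ∃ d < 0, T d (dualAct γ lam) mu) →
      weightSpace ((inclAlg k A Γ).comp f) M mu ≤ N mu) : ⨆ mu, N mu = ⊤ := by
  rw [eq_top_iff]
  intro m _
  refine hψ.mem_of_span hgen (L := {b | b = 1 ∨ ∃ d < 0, Shift Γ f T d b}) hT.span_lower htop ?_ m
  rintro b (rfl | ⟨d, hd, hb⟩) γ e he
  · rw [map_one, one_smul]
    exact Submodule.mem_iSup_of_mem _ (h1 γ e he)
  · obtain ⟨mu, h3, h4⟩ := hb M _ _ (hψ.map_mem_weightSpace he)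
    exact Submodule.mem_iSup_of_mem mu (h2 mu ⟨γ, d, hd, h3⟩ h4)

theorem IsTriangular.weightSemisimple (hT : IsTriangular Γ T f Bp Np) (hψ : IsSingularMap f Np ψ)
    (hgen : Submodule.span (SkewMonoidAlgebra A Γ) (Set.range ψ) = ⊤)
    {lam : H →ₐ[k] k} (htop : ⨆ γ : Γ, weightSpace (inclAlg k H Γ) E (dualAct γ lam) = ⊤) :
    IsWeightSemisimple ((inclAlg k A Γ).comp f) M :=
  hT.iSup_eq_top hψ hgen htop (fun _ _ he => hψ.map_mem_weightSpace he) fun _ _ => le_rfl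

variable [Finite Γ]

/-- A strictly lowered vector has a weight of negative height relative to the orbit, hence outside
the orbit; so vectors of orbit weight come from `ψ` alone. -/
theorem IsTriangular.mem_range (hT : IsTriangular Γ T f Bp Np) (hψ : IsSingularMap f Np ψ)
    (hgen : Submodule.span (SkewMonoidAlgebra A Γ) (Set.range ψ) = ⊤)
    {lam : H →ₐ[k] k} (htop : ⨆ γ : Γ, weightSpace (inclAlg k H Γ) E (dualAct γ lam) = ⊤)
    {γ : Γ} {m : M} (hm : m ∈ weightSpace ((inclAlg k A Γ).comp f) M (dualAct γ lam)) :
    m ∈ LinearMap.range ψ := by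
  -- The infimum over a proposition imposes membership in the range only at orbit weights.
  let N : (H →ₐ[k] k) → Submodule k M := fun mu =>
    weightSpace ((inclAlg k A Γ).comp f) M mu ⊓ ⨅ (_ : ∃ γ : Γ, mu = dualAct γ lam),
      LinearMap.range ψ
  have h1 : ⨆ mu, N mu = ⊤ := hT.iSup_eq_top hψ hgen htop
    (fun γ e he => ⟨hψ.map_mem_weightSpace he, (Submodule.mem_iInf _).2 fun _ => ⟨e, rfl⟩⟩)
    (fun mu ⟨γ, d, hd, hmu⟩ => le_inf le_rfl (le_iInf fun ⟨γ', h'⟩ => by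
      subst h'
      have := hT.toIsHeight.eq_zero hmu
      omega))
  have h2 := mem_of_mem_iSup_weightSpace _ (N := N) (fun mu => inf_le_left)
    (by rw [h1]; exact Submodule.mem_top) hm
  exact (Submodule.mem_iInf _).1 h2.2 ⟨γ, rfl⟩

/-- A submodule is the sum of its weight parts. A nonzero vector of weight `lam` in it would be some
`ψ e`, and then simplicity of `E` would put all generators into the submodule. -/
theorem IsTriangular.le_of_ne_top (hT : IsTriangular Γ T f Bp Np) (hψ : IsSingularMap f Np ψ)
    [IsSimpleModule (SkewMonoidAlgebra H Γ) E]
    (hgen : Submodule.span (SkewMonoidAlgebra A Γ) (Set.range ψ) = ⊤)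
    {lam : H →ₐ[k] k} (htop : ⨆ γ : Γ, weightSpace (inclAlg k H Γ) E (dualAct γ lam) = ⊤)
    {N : Submodule (SkewMonoidAlgebra A Γ) M} (hN : N ≠ ⊤) :
    N.restrictScalars k ≤ ⨆ (mu) (_ : mu ≠ lam), weightSpace ((inclAlg k A Γ).comp f) M mu := by
  rw [(hT.weightSemisimple hψ hgen htop).eq_iSup_inf (N.restrictScalars k)
    (fun h m hm => N.smul_mem _ hm)]
  refine iSup_le fun mu => ?_
  by_cases hmu : mu = lam
  · intro m hm
    rw [hmu] at hm
    obtain ⟨e, rfl⟩ := hT.mem_range hψ hgen htop (γ := 1) (by rw [dualAct_one]; exact hm.2)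
    by_cases he : e = 0
    · rw [he, map_zero]; exact Submodule.zero_mem _
    · refine absurd ?_ hN
      rw [eq_top_iff, ← hgen, Submodule.span_le]
      rintro _ ⟨e', rfl⟩
      exact hψ.range_le he hm.1 e'
  · exact le_trans inf_le_right (le_iSup₂_of_le mu hmu le_rfl)

/-- All proper submodules lie in the sum of the weight spaces other than that of `lam`, a subspace
which does not contain the nonzero vector `ψ e` of weight `lam`. -/
theorem IsTriangular.sSup_ne_top (hT : IsTriangular Γ T f Bp Np) (hψ : IsSingularMap f Np ψ)
    (hE : IsSimpleWeightModule k H Γ E) (h0 : ψ ≠ 0)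
    (hgen : Submodule.span (SkewMonoidAlgebra A Γ) (Set.range ψ) = ⊤) :
    sSup {N : Submodule (SkewMonoidAlgebra A Γ) M | N ≠ ⊤} ≠ ⊤ := by
  have := hE.simple
  obtain ⟨lam, ⟨e, he, hne⟩, htop⟩ := hE.exists_orbit
  intro hs
  have h1 : ψ e ∈ sSup {N : Submodule (SkewMonoidAlgebra A Γ) M | N ≠ ⊤} := by
    rw [hs]; exact Submodule.mem_top
  have h2 : ∀ m ∈ sSup {N : Submodule (SkewMonoidAlgebra A Γ) M | N ≠ ⊤},
      m ∈ ⨆ (mu) (_ : mu ≠ lam), weightSpace ((inclAlg k A Γ).comp f) M mu := fun m hm => by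
    rw [sSup_eq_iSup'] at hm
    induction hm using Submodule.iSup_induction' with
    | mem N m hm => exact hT.le_of_ne_top hψ hgen htop N.2 hm
    | zero => exact Submodule.zero_mem _
    | add x y _ _ hx hy => exact Submodule.add_mem _ hx hy
  have h3 := h2 _ h1
  have h4 := mem_of_mem_iSup_weightSpace _
    (N := fun mu => ⨆ (_ : mu ≠ lam), weightSpace ((inclAlg k A Γ).comp f) M mu)
    (fun mu => iSup_le fun _ => le_rfl) h3 (hψ.map_mem_weightSpace he)
  simp only [ne_eq, not_true_eq_false, iSup_false, Submodule.mem_bot] at h4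
  exact hne (hψ.injective h0 (by rw [h4, map_zero]))

/-! ### Verma modules -/

omit [Finite Γ]

variable (f Np E) in
/-- The quotient map onto the Verma module. -/
def vermaQuot : (SkewMonoidAlgebra A Γ ⊗[k] E) →ₗ[SkewMonoidAlgebra A Γ] verma f Np E :=
  (vermaRelations f Np E).mkQ

theorem vermaQuot_surjective : Function.Surjective (vermaQuot f Np E) :=
  (vermaRelations f Np E).mkQ_surjective

theorem vermaQuot_eq_zero {t : SkewMonoidAlgebra A Γ ⊗[k] E} :
    vermaQuot f Np E t = 0 ↔ t ∈ vermaRelations f Np E :=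
  Submodule.Quotient.mk_eq_zero _

variable (f Np E) in
/-- The canonical map from `E` to the Verma module. -/
def vermaMk : E →ₗ[k] verma f Np E :=
  (vermaQuot f Np E).restrictScalars k ∘ₗ TensorProduct.mk k (SkewMonoidAlgebra A Γ) E 1

theorem vermaMk_apply (e : E) : vermaMk f Np E e = vermaQuot f Np E (1 ⊗ₜ[k] e) := rfl

theorem smul_vermaMk (r : SkewMonoidAlgebra A Γ) (e : E) :
    r • vermaMk f Np E e = vermaQuot f Np E (r ⊗ₜ[k] e) := by
  rw [vermaMk_apply, ← map_smul, TensorProduct.smul_tmul', smul_eq_mul, mul_one]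

theorem isSingularMap_vermaMk : IsSingularMap f Np (vermaMk f Np E) where
  map_H h e := by
    rw [smul_vermaMk, vermaMk_apply, eq_comm, ← sub_eq_zero, ← map_sub, vermaQuot_eq_zero]
    exact Submodule.subset_span (Or.inl (Or.inl ⟨h, e, rfl⟩))
  map_group γ e := by
    rw [smul_vermaMk, vermaMk_apply, eq_comm, ← sub_eq_zero, ← map_sub, vermaQuot_eq_zero]
    exact Submodule.subset_span (Or.inl (Or.inr ⟨γ, e, rfl⟩))
  map_Np n hn e := by
    rw [smul_vermaMk, vermaQuot_eq_zero]
    exact Submodule.subset_span (Or.inr ⟨n, hn, e, rfl⟩)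

theorem span_range_vermaMk :
    Submodule.span (SkewMonoidAlgebra A Γ) (Set.range (vermaMk f Np E)) = ⊤ := by
  rw [eq_top_iff]
  intro z _
  obtain ⟨t, rfl⟩ := vermaQuot_surjective z
  induction t using TensorProduct.induction_on with
  | zero => rw [map_zero]; exact Submodule.zero_mem _
  | tmul r e =>
    rw [← smul_vermaMk]
    exact Submodule.smul_mem _ _ (Submodule.subset_span ⟨e, rfl⟩)
  | add x y hx hy =>
    rw [map_add]
    exact Submodule.add_mem _ (hx Submodule.mem_top) (hy Submodule.mem_top)

/-- The universal property of the Verma module. -/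
theorem IsSingularMap.exists_lift (hψ : IsSingularMap f Np ψ) :
    ∃ Φ : verma f Np E →ₗ[SkewMonoidAlgebra A Γ] M, ∀ e, Φ (vermaMk f Np E e) = ψ e := by
  let Ψ : (SkewMonoidAlgebra A Γ ⊗[k] E) →ₗ[SkewMonoidAlgebra A Γ] M :=
    TensorProduct.AlgebraTensorModule.lift
      (LinearMap.toSpanSingleton (SkewMonoidAlgebra A Γ) (E →ₗ[k] M) ψ)
  have hΨ : ∀ r e, Ψ (r ⊗ₜ[k] e) = r • ψ e := fun r e => rfl
  have hker : vermaRelations f Np E ≤ LinearMap.ker Ψ := by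
    rw [vermaRelations, Submodule.span_le]
    rintro _ ((⟨h, e, rfl⟩ | ⟨γ, e, rfl⟩) | ⟨n, hn, e, rfl⟩)
    · rw [SetLike.mem_coe, LinearMap.mem_ker, map_sub, hΨ, hΨ, one_smul, hψ.map_H, sub_self]
    · rw [SetLike.mem_coe, LinearMap.mem_ker, map_sub, hΨ, hΨ, one_smul, hψ.map_group, sub_self]
    · rw [SetLike.mem_coe, LinearMap.mem_ker, hΨ, hψ.map_Np n hn]
  exact ⟨(vermaRelations f Np E).liftQ Ψ hker, fun e => (hΨ 1 e).trans (one_smul _ _)⟩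

/-- The projection of `A` onto `H`, applied to coefficients, gives `q : A ⋊ Γ → H ⋊ Γ`. The map `r ⊗
e ↦ q(r) e` kills the Verma relations and sends `1 ⊗ e` back to `e`. -/
theorem IsTriangular.vermaMk_injective (hT : IsTriangular Γ T f Bp Np) :
    Function.Injective (vermaMk f Np E) := by
  obtain ⟨p, p1, pH, pN⟩ := hT.exists_proj
  let q : SkewMonoidAlgebra A Γ →ₗ[k] SkewMonoidAlgebra H Γ :=
    (SkewMonoidAlgebra.coeffLinearEquiv (S := k)).symm.toLinearMap ∘ₗ Finsupp.mapRange.linearMap p ∘ₗ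
      (SkewMonoidAlgebra.coeffLinearEquiv (S := k)).toLinearMap
  have hq : ∀ γ a, q (SkewMonoidAlgebra.single γ a) = SkewMonoidAlgebra.single γ (p a) := by
    intro γ a
    change SkewMonoidAlgebra.ofCoeff (Finsupp.mapRange p (map_zero p) (Finsupp.single γ a)) = _
    rw [Finsupp.mapRange_single]; rfl
  let φ : (SkewMonoidAlgebra A Γ ⊗[k] E) →ₗ[k] E :=
    TensorProduct.lift ((Algebra.lsmul k k E).toLinearMap ∘ₗ q)
  have hφ : ∀ r e, φ (r ⊗ₜ[k] e) = q r • e := fun r e => rfl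
  -- As `φ` is only `k`-linear, its vanishing is proved on all multiples `r • t`, which makes the
  -- induction over the `A ⋊ Γ`-span possible.
  have hrel : ∀ t ∈ vermaRelations f Np E, ∀ r : SkewMonoidAlgebra A Γ, φ (r • t) = 0 := by
    intro t ht
    induction ht using Submodule.span_induction with
    | mem t ht =>
      intro r
      induction r using SkewMonoidAlgebra.induction_on with
      | zero => rw [zero_smul, map_zero]
      | add r s hr hs => rw [add_smul, map_add, hr, hs, add_zero]
      | single γ a =>
        obtain ((⟨h, e, rfl⟩ | ⟨γ', e, rfl⟩) | ⟨n, hn, e, rfl⟩) := ht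
        · rw [smul_sub, map_sub, TensorProduct.smul_tmul', TensorProduct.smul_tmul', hφ, hφ,
            smul_eq_mul, smul_eq_mul, mul_one, smul_smul, inclAlg_apply, inclAlg_apply,
            SkewMonoidAlgebra.single_mul_single, hq, hq, SkewMonoidAlgebra.single_mul_single,
            ← hT.equivariant, pH, sub_self]
        · rw [smul_sub, map_sub, TensorProduct.smul_tmul', TensorProduct.smul_tmul', hφ, hφ,
            smul_eq_mul, smul_eq_mul, mul_one, smul_smul, SkewMonoidAlgebra.of_apply,
            SkewMonoidAlgebra.of_apply, SkewMonoidAlgebra.single_mul_single, hq, hq,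
            SkewMonoidAlgebra.single_mul_single, smul_one, smul_one, mul_one, mul_one, sub_self]
        -- Moving `n` past `γ` turns it into `γ • n`, which is again in `N₊`.
        · rw [TensorProduct.smul_tmul', hφ, smul_eq_mul, inclAlg_apply,
            SkewMonoidAlgebra.single_mul_single, hq, pN _ _ (hT.smul_Np γ n hn),
            SkewMonoidAlgebra.single_zero, zero_smul]
    | zero => intro r; rw [smul_zero, map_zero]
    | add x y _ _ hx hy => intro r; rw [smul_add, map_add, hx, hy, add_zero]
    | smul s x _ hx => intro r; rw [smul_smul, hx]
  rw [injective_iff_map_eq_zero]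
  intro e he
  rw [vermaMk_apply, vermaQuot_eq_zero] at he
  have := hrel _ he 1
  rwa [one_smul, hφ, SkewMonoidAlgebra.one_def, hq, p1, ← SkewMonoidAlgebra.one_def,
    one_smul] at this

/-! ### The simple quotient of a Verma module -/

variable (f Np E) in
/-- The canonical map from `E` to the simple quotient of the Verma module. -/
def vermaHeadMk : E →ₗ[k] vermaHead f Np E :=
  (Submodule.mkQ (sSup {N : Submodule (SkewMonoidAlgebra A Γ) (verma f Np E) | N ≠ ⊤})).restrictScalars
    k ∘ₗ vermaMk f Np E

theorem isSingularMap_vermaHeadMk : IsSingularMap f Np (vermaHeadMk f Np E) :=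
  isSingularMap_vermaMk.comp (M' := vermaHead f Np E) (Submodule.mkQ _)

variable [Finite Γ]

/-- The sum of the proper submodules is proper, so it is the largest proper submodule. -/
theorem IsTriangular.isCoatom_sSup (hT : IsTriangular Γ T f Bp Np)
    (hE : IsSimpleWeightModule k H Γ E) :
    IsCoatom (sSup {N : Submodule (SkewMonoidAlgebra A Γ) (verma f Np E) | N ≠ ⊤}) := by
  have := hE.simple
  have := IsSimpleModule.nontrivial (SkewMonoidAlgebra H Γ) E
  refine ⟨hT.sSup_ne_top isSingularMap_vermaMk hE (fun h => ?_) span_range_vermaMk, fun N hN => ?_⟩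
  · obtain ⟨e, he⟩ := exists_ne (0 : E)
    exact he (hT.vermaMk_injective (by rw [h]; rfl))
  · by_contra h
    exact not_lt_of_ge (le_sSup (a := N) h) hN

theorem IsTriangular.vermaHead_simple (hT : IsTriangular Γ T f Bp Np)
    (hE : IsSimpleWeightModule k H Γ E) :
    IsSimpleModule (SkewMonoidAlgebra A Γ) (vermaHead f Np E) :=
  isSimpleModule_iff_isCoatom.2 (hT.isCoatom_sSup hE)

omit [Finite Γ] in
theorem span_range_vermaHeadMk :
    Submodule.span (SkewMonoidAlgebra A Γ) (Set.range (vermaHeadMk f Np E)) = ⊤ := by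
  have h1 := congrArg (Submodule.map (Submodule.mkQ
    (sSup {N : Submodule (SkewMonoidAlgebra A Γ) (verma f Np E) | N ≠ ⊤})))
      (span_range_vermaMk (f := f) (Np := Np) (E := E))
  rw [Submodule.map_span, Submodule.map_top, Submodule.range_mkQ, ← Set.range_comp] at h1
  exact h1

theorem IsTriangular.vermaHeadMk_ne_zero (hT : IsTriangular Γ T f Bp Np)
    (hE : IsSimpleWeightModule k H Γ E) : vermaHeadMk f Np E ≠ 0 := by
  intro h
  have := hT.vermaHead_simple hE
  have := IsSimpleModule.nontrivial (SkewMonoidAlgebra A Γ) (vermaHead f Np E)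
  have h1 := span_range_vermaHeadMk (f := f) (Np := Np) (E := E)
  rw [h] at h1
  refine bot_ne_top (α := Submodule (SkewMonoidAlgebra A Γ) (vermaHead f Np E)) ?_
  rw [← h1, eq_comm, Submodule.span_eq_bot]
  rintro _ ⟨e, rfl⟩
  rfl

/-- A simple module with a nonzero singular map from `E` is isomorphic to `V(E)`. -/
theorem IsTriangular.vermaHead_iso (hT : IsTriangular Γ T f Bp Np)
    (hE : IsSimpleWeightModule k H Γ E) (hM : IsSimpleModule (SkewMonoidAlgebra A Γ) M)
    (hψ : IsSingularMap f Np ψ) (h0 : ψ ≠ 0) : (vermaHead f Np E).Iso M := by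
  obtain ⟨Φ, hΦ⟩ := hψ.exists_lift
  have h1 : Φ ≠ 0 := fun h => h0 (LinearMap.ext fun e => by rw [← hΦ, h]; rfl)
  have h2 := LinearMap.surjective_of_ne_zero h1
  have h3 := LinearMap.isCoatom_ker_of_surjective h2
  -- The kernel is a maximal submodule contained in the sum of the proper ones, which is itself
  -- proper; so the two agree.
  have h4 : sSup {N : Submodule (SkewMonoidAlgebra A Γ) (verma f Np E) | N ≠ ⊤} =
      LinearMap.ker Φ := by
    have h5 : LinearMap.ker Φ ≤
      sSup {N : Submodule (SkewMonoidAlgebra A Γ) (verma f Np E) | N ≠ ⊤} := le_sSup h3.1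
    exact (h3.le_iff.1 h5).resolve_left (hT.isCoatom_sSup hE).1
  exact ⟨(Submodule.quotEquivOfEq _ _ h4).trans (Φ.quotKerEquivOfSurjective h2)⟩

/-- Endomorphisms of a simple highest weight module are determined by their restriction to the
highest weight part. -/
theorem IsTriangular.exists_scalar (hT : IsTriangular Γ T f Bp Np)
    (hE : IsSimpleWeightModule k H Γ E) (hM : IsSimpleModule (SkewMonoidAlgebra A Γ) M)
    (hψ : IsSingularMap f Np ψ) (h0 : ψ ≠ 0)
    (hend : ∀ φ : E →ₗ[SkewMonoidAlgebra H Γ] E, ∃ c : k, ∀ e, φ e = c • e)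
    (φ : M →ₗ[SkewMonoidAlgebra A Γ] M) : ∃ c : k, ∀ m, φ m = c • m := by
  have := hE.simple
  have := IsSimpleModule.nontrivial (SkewMonoidAlgebra H Γ) E
  obtain ⟨lam, -, htop⟩ := hE.exists_orbit
  have hinj := hψ.injective h0
  have hgen := IsSingularMap.span_range_eq_top (A := A) (Γ := Γ) h0
  -- Endomorphisms preserve weights, and vectors of orbit weight lie in the range of `ψ`; so `φ`
  -- restricts to the copy of `E`.
  have h1 : ∀ e, φ (ψ e) ∈ LinearMap.range ψ := fun e => by
    have he : e ∈ ⨆ γ : Γ, weightSpace (inclAlg k H Γ) E (dualAct γ lam) := by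
      rw [htop]; exact Submodule.mem_top
    induction he using Submodule.iSup_induction' with
    | mem γ e he =>
      exact hT.mem_range hψ hgen htop (γ := γ) ((hψ.comp φ).map_mem_weightSpace he)
    | zero => rw [map_zero, map_zero]; exact Submodule.zero_mem _
    | add x y _ _ hx hy => rw [map_add, map_add]; exact Submodule.add_mem _ hx hy
  let e₁ := LinearEquiv.ofInjective ψ hinj
  let φ₀ : E →ₗ[k] E := e₁.symm.toLinearMap ∘ₗ
    LinearMap.codRestrict (LinearMap.range ψ) (φ.restrictScalars k ∘ₗ ψ) h1
  have hφ₀ : ∀ e, ψ (φ₀ e) = φ (ψ e) := fun e =>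
    congrArg Subtype.val (e₁.apply_symm_apply ⟨φ (ψ e), h1 e⟩)
  obtain ⟨c, hc⟩ := hend (skewLinearMap φ₀
    (fun h e => hinj (by rw [hφ₀, hψ.map_H, hψ.map_H, map_smul, hφ₀]))
    (fun γ e => hinj (by rw [hφ₀, hψ.map_group, hψ.map_group, map_smul, hφ₀])))
  refine ⟨c, fun m => ?_⟩
  have hm : m ∈ Submodule.span (SkewMonoidAlgebra A Γ) (Set.range ψ) := by
    rw [hgen]; exact Submodule.mem_top
  induction hm using Submodule.span_induction with
  | mem m hm =>
    obtain ⟨e, rfl⟩ := hm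
    rw [← hφ₀, ← map_smul, ← hc e]; rfl
  | zero => simp
  | add x y _ _ hx hy => rw [map_add, hx, hy, smul_add]
  | smul r x _ hx => rw [map_smul, hx, smul_comm_of_algebra]

end HighestWeight

section CategoryO

variable {k A H Γ : Type u} [Field k] [Ring A] [Algebra k A] [Ring H] [Algebra k H] [Group Γ]
  [MulSemiringAction Γ A] [SMulCommClass Γ k A] [MulSemiringAction Γ H] [SMulCommClass Γ k H]
  {f : H →ₐ[k] A} {Np : Submodule k A} {Bp : Subalgebra k A}
  {T : ℤ → (H →ₐ[k] k) → (H →ₐ[k] k) → Prop}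
  {E : AlgModule k (SkewMonoidAlgebra H Γ)} {M M' : AlgModule k (SkewMonoidAlgebra A Γ)}
  {ψ : E →ₗ[k] M}

/-! ### Locally finite vectors -/

/-- Any finite-dimensional space containing `B₊ m` will do, which makes closure under sums and
tensor products easy. -/
theorem finiteDimensional_span_iff {m : M} :
    FiniteDimensional k ↥(Submodule.span k (Set.range fun b : Bp => inclAlg k A Γ b • m)) ↔
      ∃ F : Submodule k M, FiniteDimensional k F ∧ ∀ b ∈ Bp, inclAlg k A Γ b • m ∈ F := by
  refine ⟨fun h => ⟨_, h, fun b hb => Submodule.subset_span ⟨⟨b, hb⟩, rfl⟩⟩, ?_⟩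
  rintro ⟨F, hF, h⟩
  refine Submodule.finiteDimensional_of_le (S₂ := F) ?_
  rw [Submodule.span_le]
  rintro _ ⟨b, rfl⟩
  exact h b b.2

variable (Bp M) in
/-- The subspace of vectors on which `B₊` acts locally finitely. -/
def locallyFinitePart : Submodule k M where
  carrier := {m | ∃ F : Submodule k M, FiniteDimensional k F ∧ ∀ b ∈ Bp, inclAlg k A Γ b • m ∈ F}
  zero_mem' := ⟨⊥, inferInstance, fun b _ => by rw [smul_zero]; exact Submodule.zero_mem _⟩
  add_mem' := by
    rintro x y ⟨F, hF, hx⟩ ⟨F', hF', hy⟩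
    exact ⟨F ⊔ F', inferInstance, fun b hb => by
      rw [smul_add]
      exact Submodule.add_mem _ (Submodule.mem_sup_left (hx b hb))
        (Submodule.mem_sup_right (hy b hb))⟩
  smul_mem' := by
    rintro c x ⟨F, hF, hx⟩
    exact ⟨F, hF, fun b hb => by
      rw [smul_comm_of_algebra]; exact F.smul_mem _ (hx b hb)⟩

omit [MulSemiringAction Γ H] [SMulCommClass Γ k H] in
theorem IsCategoryO.of_iso (e : M.Iso M') (hM : IsCategoryO f Bp M) : IsCategoryO f Bp M' := by
  obtain ⟨e⟩ := e
  refine ⟨?_, ?_, fun lam => ?_, fun m => ?_⟩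
  · have := hM.finitelyGenerated
    exact Module.Finite.equiv e
  · exact hM.semisimple.of_surjective e.toLinearMap e.surjective
  · have := hM.finite_weightSpace lam
    exact Module.Finite.equiv (weightSpaceEquiv e lam)
  · obtain ⟨F, hF, h⟩ := finiteDimensional_span_iff.1 (hM.locallyFinite (e.symm m))
    refine finiteDimensional_span_iff.2 ⟨F.map (e.restrictScalars k).toLinearMap, inferInstance,
      fun b hb => ⟨_, h b hb, ?_⟩⟩
    change e (inclAlg k A Γ b • e.symm m) = _
    rw [map_smul, e.apply_symm_apply]

omit [MulSemiringAction Γ H] [SMulCommClass Γ k H] in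
theorem IsSimpleInO.of_iso (e : M.Iso M') (hM : IsSimpleInO f Bp M) : IsSimpleInO f Bp M' := by
  have := hM.2
  exact ⟨hM.1.of_iso e, IsSimpleModule.congr e.some.symm⟩

/-! ### Existence of singular vectors -/

theorem weightSpace_pull_skewMap (hf : ∀ (γ : Γ) (h : H), f (γ • h) = γ • f h)
    (lam : H →ₐ[k] k) :
    weightSpace (inclAlg k H Γ) (M.pull (skewMap f hf)) lam =
      weightSpace ((inclAlg k A Γ).comp f) M lam := by
  ext m
  refine forall_congr' fun h => ?_
  change skewMap f hf (inclAlg k H Γ h) • (show M from m) = _ ↔ _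
  rw [skewMap_inclAlg]
  rfl

/-- Start from a weight vector `v` and take a nonzero weight vector of maximal height in `B₊ v`;
raising elements must kill it. -/
theorem IsTriangular.exists_singular_vector [Nontrivial M] (hT : IsTriangular Γ T f Bp Np)
    (hM : IsWeightSemisimple ((inclAlg k A Γ).comp f) M)
    (hfin : ∀ m : M, FiniteDimensional k
      ↥(Submodule.span k (Set.range fun b : Bp => inclAlg k A Γ b • m))) :
    ∃ (lam : H →ₐ[k] k) (m : M), m ∈ weightSpace ((inclAlg k A Γ).comp f) M lam ∧ m ≠ 0 ∧
      ∀ n ∈ Np, inclAlg k A Γ n • m = 0 := by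
  obtain ⟨mu, v, hv, h0⟩ := exists_weight_vector _ hM
  let D : Set ℤ := {d | ∃ b ∈ Bp, ∃ nu, T d mu nu ∧
    inclAlg k A Γ b • v ∈ weightSpace ((inclAlg k A Γ).comp f) M nu ∧ inclAlg k A Γ b • v ≠ 0}
  -- Vectors of different heights have different weights and so are independent in the
  -- finite-dimensional span of `B₊ v`; hence only finitely many heights occur.
  have hD : D.Finite := by
    have := hfin v
    choose b hb nu hnu hmem hne using fun d : D => d.2
    have hli : LinearIndependent k fun d : D => inclAlg k A Γ (b d) • v :=
      linearIndependent_of_weight ((inclAlg k A Γ).comp f) (wt := nu)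
        (fun d e hde => Subtype.ext (hT.unique (hnu d) (by rw [hde]; exact hnu e))) hmem hne
    have hli' : LinearIndependent k (fun d : D => (⟨inclAlg k A Γ (b d) • v,
        Submodule.subset_span ⟨⟨b d, hb d⟩, rfl⟩⟩ :
        ↥(Submodule.span k (Set.range fun b : Bp => inclAlg k A Γ b • v)))) :=
      LinearIndependent.of_comp (Submodule.subtype _) hli
    have := hli'.finite_of_isNoetherian
    exact Set.toFinite D
  have h0D : (0 : ℤ) ∈ D := ⟨1, one_mem _, mu, hT.refl mu, by simpa using hv, by simpa using h0⟩
  obtain ⟨d, ⟨b, hb, nu, hnu, hmem, hne⟩, hmax⟩ := Set.exists_max_image D id hD ⟨0, h0D⟩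
  refine ⟨nu, _, hmem, hne, fun n hn => ?_⟩
  have hn' := hT.Np_le_span hn
  induction hn' using Submodule.span_induction with
  | mem n hn' =>
    obtain ⟨hn, e, he, hsh⟩ := hn'
    obtain ⟨ka, h1, h2⟩ := hsh M nu _ hmem
    -- A nonzero `n b v` would be a weight vector of height `d + e > d`, against maximality.
    by_contra hne'
    rw [smul_smul, ← map_mul] at h2 hne'
    have := hmax (d + e) ⟨n * b, Bp.mul_mem (hT.Np_le hn) hb, ka, hT.trans hnu h1, h2, hne'⟩
    simp only [id] at this
    omega
  | zero => rw [map_zero, zero_smul]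
  | add x y hx' hy' hx hy =>
    have hle : ∀ z ∈ Submodule.span k {n | n ∈ Np ∧ ∃ d > 0, Shift Γ f T d n}, z ∈ Np :=
      fun z hz => Submodule.span_le (p := Np).2 (fun _ h => h.1) hz
    rw [map_add, add_smul, hx (hle x hx'), hy (hle y hy'), add_zero]
  | smul c x hx' hx =>
    have hle : ∀ z ∈ Submodule.span k {n | n ∈ Np ∧ ∃ d > 0, Shift Γ f T d n}, z ∈ Np :=
      fun z hz => Submodule.span_le (p := Np).2 (fun _ h => h.1) hz
    rw [map_smul, smul_assoc, hx (hle x hx'), smul_zero]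

theorem exists_simple_submodule_of_finite {R : Type u} [Ring R] [Algebra k R] (E : AlgModule k R)
    [FiniteDimensional k E] [Nontrivial E] : ∃ S : Submodule R E, IsSimpleModule R S := by
  have : IsArtinian R E := isArtinian_of_tower k inferInstance
  obtain ⟨S, hS, -⟩ := (eq_bot_or_exists_atom_le (⊤ : Submodule R E)).resolve_left top_ne_bot
  exact ⟨S, isSimpleModule_iff_isAtom.2 hS⟩

theorem AlgModule.finiteDimensional_sub {R : Type u} [Ring R] [Algebra k R] (E : AlgModule k R)
    [FiniteDimensional k E] (S : Submodule R E) : FiniteDimensional k (E.sub S) :=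
  FiniteDimensional.finiteDimensional_submodule (S.restrictScalars k)

theorem AlgModule.semisimple_sub {R : Type u} [Ring R] [Algebra k R] {g : H →ₐ[k] R}
    (E : AlgModule k R) (hE : IsWeightSemisimple g E) (S : Submodule R E) :
    IsWeightSemisimple g (E.sub S) :=
  hE.submodule S

/-- A locally finite weight module contains a simple `H ⋊ Γ`-module of singular vectors. -/
theorem IsTriangular.exists_singularMap [Finite Γ] [Nontrivial M]
    (hT : IsTriangular Γ T f Bp Np) (hM : IsWeightSemisimple ((inclAlg k A Γ).comp f) M)
    (hfin : ∀ m : M, FiniteDimensional k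
      ↥(Submodule.span k (Set.range fun b : Bp => inclAlg k A Γ b • m))) :
    ∃ (E : AlgModule k (SkewMonoidAlgebra H Γ)) (ψ : E →ₗ[k] M), IsSimpleWeightModule k H Γ E ∧
      IsSingularMap f Np ψ ∧ ψ ≠ 0 := by
  obtain ⟨lam, m, hm, h0, hN⟩ := hT.exists_singular_vector hM hfin
  have hf := hT.equivariant
  let P := M.pull (skewMap f hf)
  -- Since Γ is finite and `m` is a weight vector, the span of the orbit of `m` is
  -- finite-dimensional and stable under `H` and Γ.
  let W : Submodule k P := Submodule.span k (Set.range fun γ : Γ =>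
    (show P from SkewMonoidAlgebra.of A Γ γ • m))
  have hPH : ∀ (h : H) (x : P), inclAlg k H Γ h • x =
      (show P from inclAlg k A Γ (f h) • (show M from x)) := fun h x => by
    change (show P from skewMap f hf (inclAlg k H Γ h) • (show M from x)) = _
    rw [skewMap_inclAlg]
  have hPΓ : ∀ (γ : Γ) (x : P), SkewMonoidAlgebra.of H Γ γ • x =
      (show P from SkewMonoidAlgebra.of A Γ γ • (show M from x)) := fun γ x => by
    change (show P from skewMap f hf (SkewMonoidAlgebra.of H Γ γ) • (show M from x)) = _
    rw [skewMap_of]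
  let U : Submodule (SkewMonoidAlgebra H Γ) P := skewSubmodule W
    (fun h x hx => by
      induction hx using Submodule.span_induction with
      | mem x hx =>
        obtain ⟨γ, rfl⟩ := hx
        rw [hPH]
        have h1 := of_smul_mem_weightSpace hf γ hm h
        have h2 : (dualAct γ lam) h • (show P from SkewMonoidAlgebra.of A Γ γ • m) ∈ W :=
          W.smul_mem _ (Submodule.subset_span ⟨γ, rfl⟩)
        rw [AlgHom.comp_apply] at h1
        change inclAlg k A Γ (f h) • SkewMonoidAlgebra.of A Γ γ • m ∈ W
        rw [h1]
        exact h2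
      | zero => rw [smul_zero]; exact W.zero_mem
      | add x y _ _ hx hy => rw [smul_add]; exact W.add_mem hx hy
      | smul c x _ hx => rw [smul_comm_of_algebra]; exact W.smul_mem c hx)
    (fun γ x hx => by
      induction hx using Submodule.span_induction with
      | mem x hx =>
        obtain ⟨γ', rfl⟩ := hx
        rw [hPΓ]
        refine Submodule.subset_span ⟨γ * γ', ?_⟩
        change SkewMonoidAlgebra.of A Γ (γ * γ') • m = _
        rw [map_mul, mul_smul]
      | zero => rw [smul_zero]; exact W.zero_mem
      | add x y _ _ hx hy => rw [smul_add]; exact W.add_mem hx hy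
      | smul c x _ hx => rw [smul_comm_of_algebra]; exact W.smul_mem c hx)
  -- Here `n γ m = γ γ⁻¹(n) m`, and `γ⁻¹(n)` is in `N₊`, so it kills `m`.
  have hUN : ∀ x ∈ U, ∀ n ∈ Np, inclAlg k A Γ n • (show M from x) = 0 := fun x hx n hn => by
    change x ∈ W at hx
    induction hx using Submodule.span_induction with
    | mem x hx =>
      obtain ⟨γ, rfl⟩ := hx
      have h1 : n = γ • γ⁻¹ • n := (smul_inv_smul γ n).symm
      change inclAlg k A Γ n • SkewMonoidAlgebra.of A Γ γ • m = 0
      rw [h1, smul_smul, of_mul_inclAlg, mul_smul, hN _ (hT.smul_Np _ n hn), smul_zero]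
    | zero => exact smul_zero (A := M) _
    | add x y _ _ hx hy => exact (smul_add _ _ _).trans (by rw [hx, hy, add_zero])
    | smul c x _ hx =>
      exact (smul_comm_of_algebra (R := SkewMonoidAlgebra A Γ) c _ (show M from x)).trans
        (by rw [hx, smul_zero])
  have hU : FiniteDimensional k U := FiniteDimensional.span_of_finite k (Set.finite_range _)
  have hmU : (show P from m) ∈ U := Submodule.subset_span ⟨1, by
    change SkewMonoidAlgebra.of A Γ 1 • m = m
    rw [map_one, one_smul]⟩
  have : FiniteDimensional k (P.sub U) := hU
  have : Nontrivial (P.sub U) := ⟨⟨⟨_, hmU⟩, (0 : U), fun h => h0 (congrArg Subtype.val h)⟩⟩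
  obtain ⟨S, hS⟩ := exists_simple_submodule_of_finite (P.sub U)
  have hPss : IsWeightSemisimple (inclAlg k H Γ) P :=
    (iSup_congr fun mu => weightSpace_pull_skewMap hf mu).trans hM
  refine ⟨(P.sub U).sub S, (show P →ₗ[k] M from LinearMap.id) ∘ₗ (U.subtype.restrictScalars k) ∘ₗ
    (S.subtype.restrictScalars k), ⟨hS, (P.sub U).finiteDimensional_sub S,
      (P.sub U).semisimple_sub (P.semisimple_sub hPss U) S⟩, ⟨fun h e => ?_, fun γ e => ?_, fun n hn e => ?_⟩, ?_⟩
  · exact hPH h _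
  · exact hPΓ γ _
  · exact hUN _ (show U from (show S from e).1).2 n hn
  · intro h
    have := IsSimpleModule.nontrivial (SkewMonoidAlgebra H Γ) S
    obtain ⟨e, he⟩ := exists_ne (0 : S)
    exact he (Subtype.ext (Subtype.ext (LinearMap.congr_fun h e)))

/-- A simple object of `𝒪` is isomorphic to some `V(E)`. -/
theorem IsTriangular.exists_vermaHead_iso [Finite Γ] (hT : IsTriangular Γ T f Bp Np)
    (hM : IsSimpleInO f Bp M) :
    ∃ E : AlgModule k (SkewMonoidAlgebra H Γ), IsSimpleWeightModule k H Γ E ∧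
      M.Iso (vermaHead f Np E) := by
  have := hM.2
  have := IsSimpleModule.nontrivial (SkewMonoidAlgebra A Γ) M
  obtain ⟨E, ψ, hE, hψ, h0⟩ := hT.exists_singularMap hM.1.semisimple hM.1.locallyFinite
  exact ⟨E, hE, (hT.vermaHead_iso hE hM.2 hψ h0).symm⟩

/-! ### Highest weight modules are in `𝒪` -/

/-- The spanning criterion is applied to the family that is the full weight space at weights on or
below the orbit and zero at all others. -/
theorem IsTriangular.exists_height [Finite Γ] (hT : IsTriangular Γ T f Bp Np)
    (hψ : IsSingularMap f Np ψ)
    (hgen : Submodule.span (SkewMonoidAlgebra A Γ) (Set.range ψ) = ⊤)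
    {lam : H →ₐ[k] k} (htop : ⨆ γ : Γ, weightSpace (inclAlg k H Γ) E (dualAct γ lam) = ⊤)
    {mu : H →ₐ[k] k} {m : M} (hm : m ∈ weightSpace ((inclAlg k A Γ).comp f) M mu) (h0 : m ≠ 0) :
    ∃ (γ : Γ), ∃ d ≤ 0, T d (dualAct γ lam) mu := by
  by_contra hc
  let N : (H →ₐ[k] k) → Submodule k M := fun mu =>
    weightSpace ((inclAlg k A Γ).comp f) M mu ⊓
      ⨆ (_ : ∃ (γ : Γ), ∃ d ≤ 0, T d (dualAct γ lam) mu), ⊤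
  have h1 : ⨆ mu, N mu = ⊤ := hT.iSup_eq_top hψ hgen htop
    (fun γ e he => ⟨hψ.map_mem_weightSpace he, by
      rw [iSup_pos ⟨γ, 0, le_rfl, hT.refl _⟩]; exact Submodule.mem_top⟩)
    (fun mu ⟨γ, d, hd, hmu⟩ => le_inf le_rfl (by
      rw [iSup_pos ⟨γ, d, hd.le, hmu⟩]; exact le_top))
  have h2 := (mem_of_mem_iSup_weightSpace _ (N := N) (fun mu => inf_le_left)
    (by rw [h1]; exact Submodule.mem_top) hm).2
  rw [iSup_neg hc] at h2
  exact h0 ((Submodule.mem_bot k).1 h2)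

/-- Operators lowering past the height of `mu` cannot contribute to `M_mu`. So `M` is the sum of the
finite-dimensional `F ψ(E)` and of the other weight spaces, and `M_mu` embeds in the quotient by the
latter. -/
theorem IsFiniteTriangular.finite_weightSpace [Finite Γ] [FiniteDimensional k E]
    (hT : IsFiniteTriangular Γ T f Bp Np) (hψ : IsSingularMap f Np ψ)
    (hgen : Submodule.span (SkewMonoidAlgebra A Γ) (Set.range ψ) = ⊤)
    {lam : H →ₐ[k] k} (htop : ⨆ γ : Γ, weightSpace (inclAlg k H Γ) E (dualAct γ lam) = ⊤)
    (mu : H →ₐ[k] k) : FiniteDimensional k (weightSpace ((inclAlg k A Γ).comp f) M mu) := by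
  -- The bound `D` is the height of `mu` relative to the orbit; if `mu` is not comparable with the
  -- orbit, any value works and 0 is taken.
  obtain ⟨D, hD⟩ : ∃ D : ℤ, ∀ d < D, ∀ γ : Γ, ¬ T d (dualAct γ lam) mu := by
    by_cases h : ∃ (d : ℤ) (γ : Γ), T d (dualAct γ lam) mu
    · obtain ⟨d, γ, h⟩ := h
      exact ⟨d, fun e he γ' h' => he.ne (hT.toIsHeight.eq h' h)⟩
    · push Not at h
      exact ⟨0, fun d _ γ => h d γ⟩
  obtain ⟨F, hF, hspan⟩ := hT.lower_finite D
  let S : Submodule k M := Submodule.map₂ ((Algebra.lsmul k k M).toLinearMap ∘ₗ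
    (inclAlg k A Γ).toLinearMap) F (LinearMap.range ψ)
  have hS : FiniteDimensional k S := by
    have h1 : (LinearMap.range ψ).FG := (Submodule.fg_iff_finiteDimensional _).2 inferInstance
    exact (Submodule.fg_iff_finiteDimensional _).1
      (((Submodule.fg_iff_finiteDimensional _).2 hF).map₂ _ h1)
  let W : Submodule k M := ⨆ nu, ⨆ (_ : nu ≠ mu), weightSpace ((inclAlg k A Γ).comp f) M nu
  have htop' : ∀ m, m ∈ S ⊔ W := hψ.mem_of_span hgen
      (L := {b | b ∈ F ∨ ∃ d < D, Shift Γ f T d b}) hspan htop (by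
    rintro b (hb | ⟨d, hd, hb⟩) γ e he
    · exact Submodule.mem_sup_left (Submodule.apply_mem_map₂ ((Algebra.lsmul k k M).toLinearMap ∘ₗ
        (inclAlg k A Γ).toLinearMap) hb ⟨e, rfl⟩)
    · obtain ⟨nu, h3, h4⟩ := hb M _ _ (hψ.map_mem_weightSpace he)
      refine Submodule.mem_sup_right (Submodule.mem_iSup_of_mem nu
        (Submodule.mem_iSup_of_mem ?_ h4))
      rintro rfl
      exact hD d hd γ h3)
  have hsurj : Function.Surjective (W.mkQ ∘ₗ S.subtype) := fun q => by
    obtain ⟨m, rfl⟩ := W.mkQ_surjective q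
    obtain ⟨s, hs, w, hw, rfl⟩ := Submodule.mem_sup.1 (htop' m)
    refine ⟨⟨s, hs⟩, ?_⟩
    rw [map_add, (Submodule.Quotient.mk_eq_zero W).2 hw |> (fun h => (show W.mkQ w = 0 from h)),
      add_zero]
    rfl
  have hq : FiniteDimensional k (M ⧸ W) := Module.Finite.of_surjective _ hsurj
  refine FiniteDimensional.of_injective (W.mkQ ∘ₗ (weightSpace ((inclAlg k A Γ).comp f) M mu).subtype)
    ?_
  rw [injective_iff_map_eq_zero]
  intro m hm
  have h1 : (m : M) ∈ W := (Submodule.Quotient.mk_eq_zero W).1 hm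
  have h2 := mem_of_mem_iSup_weightSpace _
    (N := fun nu => ⨆ (_ : nu ≠ mu), weightSpace ((inclAlg k A Γ).comp f) M nu)
    (fun nu => iSup_le fun _ => le_rfl) h1 m.2
  simp only [ne_eq, not_true_eq_false, iSup_false, Submodule.mem_bot] at h2
  exact Subtype.ext h2

/-- No weight lies above the orbit, so on a vector of height `d ≤ 0` operators raising by more than
`-d` vanish. What remains of `B₊` is finite-dimensional. -/
theorem IsFiniteTriangular.locallyFinite [Finite Γ]
    (hT : IsFiniteTriangular Γ T f Bp Np) (hψ : IsSingularMap f Np ψ)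
    (hgen : Submodule.span (SkewMonoidAlgebra A Γ) (Set.range ψ) = ⊤)
    {lam : H →ₐ[k] k} (htop : ⨆ γ : Γ, weightSpace (inclAlg k H Γ) E (dualAct γ lam) = ⊤)
    (m : M) : m ∈ locallyFinitePart Bp M := by
  have key : ∀ mu, weightSpace ((inclAlg k A Γ).comp f) M mu ≤ locallyFinitePart Bp M := by
    intro mu m hm
    by_cases h0 : m = 0
    · rw [h0]; exact Submodule.zero_mem _
    obtain ⟨γ, d, hd, hmu⟩ := hT.exists_height hψ hgen htop hm h0
    obtain ⟨F, hF, hle⟩ := hT.raise_finite (-d)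
    let ev : A →ₗ[k] M := ((Algebra.lsmul k k M).toLinearMap ∘ₗ (inclAlg k A Γ).toLinearMap).flip m
    refine ⟨F.map ev, inferInstance, fun b hb => ?_⟩
    obtain ⟨x, hx, y, hy, rfl⟩ := Submodule.mem_sup.1 (hle hb)
    have hy0 : inclAlg k A Γ y • m = 0 := by
      clear hb
      induction hy using Submodule.span_induction with
      | mem y hy =>
        obtain ⟨d', hd', hy⟩ := hy
        obtain ⟨nu, h1, h2⟩ := hy M _ _ hm
        by_contra hne
        obtain ⟨γ', e, he, h3⟩ := hT.exists_height hψ hgen htop h2 hne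
        have := hT.toIsHeight.eq (hT.trans hmu h1) h3
        omega
      | zero => rw [map_zero, zero_smul]
      | add x y _ _ hx hy => rw [map_add, add_smul, hx, hy, add_zero]
      | smul c x _ hx => rw [map_smul, smul_assoc, hx, smul_zero]
    rw [map_add, add_smul, hy0, add_zero]
    exact ⟨x, hx, rfl⟩
  have h1 : m ∈ ⨆ mu, weightSpace ((inclAlg k A Γ).comp f) M mu := by
    rw [hT.weightSemisimple hψ hgen htop]; exact Submodule.mem_top
  exact iSup_le key h1

/-- `V(E)` is a simple object of `𝒪`. -/
theorem IsFiniteTriangular.isSimpleInO_vermaHead [Finite Γ]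
    (hT : IsFiniteTriangular Γ T f Bp Np) (hE : IsSimpleWeightModule k H Γ E) :
    IsSimpleInO f Bp (vermaHead f Np E) := by
  have hs := hT.vermaHead_simple hE
  have := hE.finite
  obtain ⟨lam, -, htop⟩ := hE.exists_orbit
  have hψ := isSingularMap_vermaHeadMk (f := f) (Np := Np) (E := E)
  have hgen := span_range_vermaHeadMk (f := f) (Np := Np) (E := E)
  exact ⟨⟨inferInstance, hT.weightSemisimple hψ hgen htop,
    hT.finite_weightSpace hψ hgen htop,
    fun m => finiteDimensional_span_iff.2 (hT.locallyFinite hψ hgen htop m)⟩, hs⟩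

end CategoryO

/-! ### Schur's lemma -/

section Schur

variable {k H Γ : Type u} [Field k] [Ring H] [Algebra k H] [Group Γ]
  [MulSemiringAction Γ H] [SMulCommClass Γ k H]

/-- If Γ is trivial, the line through a weight vector is already a submodule, so `E` is
one-dimensional over any field. Otherwise this is Schur's lemma over an algebraically closed field.
-/
theorem IsSimpleWeightModule.exists_scalar {E : AlgModule k (SkewMonoidAlgebra H Γ)}
    (hE : IsSimpleWeightModule k H Γ E) (h : Subsingleton Γ ∨ IsAlgClosed k)
    (φ : E →ₗ[SkewMonoidAlgebra H Γ] E) : ∃ c : k, ∀ e, φ e = c • e := by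
  have := hE.simple
  have := hE.finite
  have := IsSimpleModule.nontrivial (SkewMonoidAlgebra H Γ) E
  rcases h with h | h
  · obtain ⟨lam, e, he, h0⟩ := exists_weight_vector (inclAlg k H Γ) hE.semisimple
    let S : Submodule (SkewMonoidAlgebra H Γ) E := skewSubmodule (k ∙ e)
      (fun h x hx => by
        obtain ⟨c, rfl⟩ := Submodule.mem_span_singleton.1 hx
        rw [smul_comm_of_algebra, he h, smul_comm]
        exact Submodule.smul_mem _ _ hx)
      (fun γ x hx => by rwa [Subsingleton.elim γ 1, map_one, one_smul])
    have hS : S = ⊤ := (eq_bot_or_eq_top S).resolve_left fun h => h0 (by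
      have : e ∈ S := Submodule.mem_span_singleton_self e
      rwa [h, Submodule.mem_bot] at this)
    have hmem : ∀ x, ∃ c : k, c • e = x := fun x => Submodule.mem_span_singleton.1 (by
      have : x ∈ S := by rw [hS]; exact Submodule.mem_top
      exact this)
    obtain ⟨c, hc⟩ := hmem (φ e)
    refine ⟨c, fun x => ?_⟩
    obtain ⟨d, rfl⟩ := hmem x
    rw [LinearMap.map_smul_of_tower, ← hc, smul_comm]
  · obtain ⟨c, rfl⟩ := (IsSimpleModule.algebraMap_end_bijective_of_isAlgClosed k
      (A := SkewMonoidAlgebra H Γ) (V := E)).2 φ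
    exact ⟨c, fun e => rfl⟩

/-- Density: a simple module with scalar endomorphisms only admits arbitrary operations on finite
linearly independent families. -/
theorem exists_smul_basis {R : Type u} [Ring R] [Algebra k R] (M : AlgModule k R)
    [IsSimpleModule R M] (hend : ∀ φ : M →ₗ[R] M, ∃ c : k, ∀ e, φ e = c • e) {κ : Type*}
    (b : Module.Basis κ k M) (s : Finset κ) (j : κ) (m : M) :
    ∃ r : R, r • b j = m ∧ ∀ l ∈ s, l ≠ j → r • b l = 0 := by
  classical
  let g : M →ₗ[k] M := b.constr k (fun l => if l = j then m else 0)
  have hg : ∀ l, g (b l) = if l = j then m else 0 := fun l => b.constr_basis k _ l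
  -- Since all `R`-endomorphisms are scalars, every `k`-linear map commutes with them, and the
  -- density theorem applies to it.
  let g' : Module.End (Module.End R M) M :=
    { toFun := g
      map_add' := map_add g
      map_smul' := fun φ x => by
        obtain ⟨c, hc⟩ := hend φ
        change g (φ x) = φ (g x)
        rw [hc, hc, map_smul] }
  obtain ⟨r, hr⟩ := jacobson_density g' ((insert j s).image b)
  have hr' : ∀ l ∈ insert j s, r • b l = if l = j then m else 0 := fun l hl => by
    rw [← hg, ← hr _ (Finset.mem_image_of_mem _ hl)]; rfl
  refine ⟨r, by rw [hr' j (Finset.mem_insert_self _ _), if_pos rfl], fun l hl hne => ?_⟩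
  rw [hr' l (Finset.mem_insert_of_mem hl), if_neg hne]

end Schur

/-! ### Tensor products of skew group rings -/

/-- The skew group ring is generated as a ring by `A` and Γ; this suits properties that are stable
under products, such as commutation and formulas for actions. -/
theorem skew_induction {A Γ : Type u} [Ring A] [Group Γ] [MulSemiringAction Γ A]
    {P : SkewMonoidAlgebra A Γ → Prop} (r : SkewMonoidAlgebra A Γ)
    (incl : ∀ a, P (SkewMonoidAlgebra.single 1 a)) (of : ∀ γ, P (SkewMonoidAlgebra.of A Γ γ))
    (add : ∀ x y, P x → P y → P (x + y)) (mul : ∀ x y, P x → P y → P (x * y)) : P r := by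
  induction r using SkewMonoidAlgebra.induction_on with
  | zero => rw [← SkewMonoidAlgebra.single_zero (1 : Γ)]; exact incl 0
  | single γ a =>
    have : SkewMonoidAlgebra.single γ a =
        SkewMonoidAlgebra.single 1 a * SkewMonoidAlgebra.of A Γ γ := by
      simp [SkewMonoidAlgebra.single_mul_single]
    rw [this]; exact mul _ _ (incl a) (of γ)
  | add x y hx hy => exact add x y hx hy

theorem liftNCAlgHom_inclAlg {k A B Γ : Type u} [Field k] [Ring A] [Algebra k A] [Ring B]
    [Algebra k B] [Group Γ] [MulSemiringAction Γ A] [SMulCommClass Γ k A] (f : A →ₐ[k] B)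
    (g : Γ →* B) (h : ∀ {x y}, f (y • x) * g y = g y * f x) (a : A) :
    SkewMonoidAlgebra.liftNCAlgHom f g h (inclAlg k A Γ a) = f a := by
  simp [inclAlg_apply, SkewMonoidAlgebra.liftNCAlgHom, SkewMonoidAlgebra.liftNCRingHom]

theorem liftNCAlgHom_of {k A B Γ : Type u} [Field k] [Ring A] [Algebra k A] [Ring B]
    [Algebra k B] [Group Γ] [MulSemiringAction Γ A] [SMulCommClass Γ k A] (f : A →ₐ[k] B)
    (g : Γ →* B) (h : ∀ {x y}, f (y • x) * g y = g y * f x) (γ : Γ) :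
    SkewMonoidAlgebra.liftNCAlgHom f g h (SkewMonoidAlgebra.of A Γ γ) = g γ := by
  simp [SkewMonoidAlgebra.liftNCAlgHom, SkewMonoidAlgebra.liftNCRingHom]

section Tensor

variable {k : Type u} [Field k] {n : ℕ} {A Γ : Fin n → Type u} [∀ i, Ring (A i)]
  [∀ i, Algebra k (A i)] [∀ i, Group (Γ i)]
  [∀ i, MulSemiringAction (Γ i) (A i)] [∀ i, SMulCommClass (Γ i) k (A i)]

theorem mulSingle_smul_singleAlgHom (i : Fin n) (γ : Γ i) (a : A i) :
    (Pi.mulSingle i γ : ∀ j, Γ j) • PiTensorProduct.singleAlgHom (R := k) (A := A) i a =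
      PiTensorProduct.singleAlgHom (R := k) (A := A) i (γ • a) := by
  rw [PiTensorProduct.singleAlgHom_apply, PiTensorProduct.singleAlgHom_apply, tensorAction_tprod]
  congr 1
  funext j
  by_cases hj : j = i
  · subst hj; simp
  · simp [hj]

theorem mulSingle_smul_singleAlgHom_of_ne {i j : Fin n} (hij : i ≠ j) (γ : Γ i) (a : A j) :
    (Pi.mulSingle i γ : ∀ j, Γ j) • PiTensorProduct.singleAlgHom (R := k) (A := A) j a =
      PiTensorProduct.singleAlgHom (R := k) (A := A) j a := by
  rw [PiTensorProduct.singleAlgHom_apply, tensorAction_tprod]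
  congr 1
  funext l
  by_cases hl : l = i
  · subst hl; simp [hij]
  · simp [hl]

theorem single_smul_mul_single (i : Fin n) {a : A i} {γ : Γ i} :
    ((inclAlg k (⨂[k] i, A i) (∀ i, Γ i)).comp (PiTensorProduct.singleAlgHom i)) (γ • a) *
        ((SkewMonoidAlgebra.of (⨂[k] i, A i) (∀ i, Γ i)).comp (MonoidHom.mulSingle Γ i)) γ =
      ((SkewMonoidAlgebra.of (⨂[k] i, A i) (∀ i, Γ i)).comp (MonoidHom.mulSingle Γ i)) γ *
        ((inclAlg k (⨂[k] i, A i) (∀ i, Γ i)).comp (PiTensorProduct.singleAlgHom i)) a := by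
  simp only [AlgHom.comp_apply, MonoidHom.comp_apply, MonoidHom.mulSingle_apply]
  rw [← mulSingle_smul_singleAlgHom, of_mul_inclAlg]

variable (k A Γ) in
/-- The inclusion of the `i`-th factor `Aᵢ ⋊ Γᵢ` in `A ⋊ Γ`. -/
def skewSingle (i : Fin n) :
    SkewMonoidAlgebra (A i) (Γ i) →ₐ[k] SkewMonoidAlgebra (⨂[k] i, A i) (∀ i, Γ i) :=
  SkewMonoidAlgebra.liftNCAlgHom ((inclAlg k _ _).comp (PiTensorProduct.singleAlgHom i))
    ((SkewMonoidAlgebra.of _ _).comp (MonoidHom.mulSingle Γ i)) (single_smul_mul_single i)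

theorem skewSingle_inclAlg (i : Fin n) (a : A i) : skewSingle k A Γ i (inclAlg k _ _ a) =
    inclAlg k _ _ (PiTensorProduct.singleAlgHom (R := k) (A := A) i a) :=
  liftNCAlgHom_inclAlg _ _ (single_smul_mul_single i) a

theorem skewSingle_of (i : Fin n) (γ : Γ i) : skewSingle k A Γ i (SkewMonoidAlgebra.of _ _ γ) =
    SkewMonoidAlgebra.of _ _ (Pi.mulSingle i γ) :=
  liftNCAlgHom_of _ _ (single_smul_mul_single i) γ

theorem commute_skewSingle {i j : Fin n} (hij : i ≠ j) (x : SkewMonoidAlgebra (A i) (Γ i))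
    (y : SkewMonoidAlgebra (A j) (Γ j)) : Commute (skewSingle k A Γ i x) (skewSingle k A Γ j y) := by
  induction x using skew_induction with
  | add x x' hx hx' => rw [map_add]; exact hx.add_left hx'
  | mul x x' hx hx' => rw [map_mul]; exact hx.mul_left hx'
  | incl a =>
    induction y using skew_induction with
    | add x x' hx hx' => rw [map_add]; exact hx.add_right hx'
    | mul x x' hx hx' => rw [map_mul]; exact hx.mul_right hx'
    | incl a' =>
      rw [← inclAlg_apply (k := k), ← inclAlg_apply (k := k), skewSingle_inclAlg, skewSingle_inclAlg]
      exact (Commute.tprod (Pi.mulSingle_commute hij a a')).map (inclAlg k _ _)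
    | of γ' =>
      rw [← inclAlg_apply (k := k), skewSingle_inclAlg, skewSingle_of, Commute, SemiconjBy, ← of_mul_inclAlg,
        mulSingle_smul_singleAlgHom_of_ne hij.symm]
  | of γ =>
    induction y using skew_induction with
    | add x x' hx hx' => rw [map_add]; exact hx.add_right hx'
    | mul x x' hx hx' => rw [map_mul]; exact hx.mul_right hx'
    | incl a' =>
      rw [← inclAlg_apply (k := k), skewSingle_inclAlg, skewSingle_of, Commute, SemiconjBy, ← of_mul_inclAlg,
        mulSingle_smul_singleAlgHom_of_ne hij]
    | of γ' =>
      rw [skewSingle_of, skewSingle_of]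
      exact (Pi.mulSingle_commute hij γ γ').map (SkewMonoidAlgebra.of _ _)

variable (k A Γ) in
/-- The multiplicative map `(r₁, …, rₙ) ↦ r₁ ⊗ ⋯ ⊗ rₙ` from `∏ (Aᵢ ⋊ Γᵢ)` to `A ⋊ Γ`. -/
def skewTensor : (∀ i, SkewMonoidAlgebra (A i) (Γ i)) →*
    SkewMonoidAlgebra (⨂[k] i, A i) (∀ i, Γ i) :=
  MonoidHom.noncommPiCoprod (fun i => (skewSingle k A Γ i).toRingHom.toMonoidHom)
    fun _ _ hij x y => commute_skewSingle hij x y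

theorem skewTensor_mulSingle (i : Fin n) (r : SkewMonoidAlgebra (A i) (Γ i)) :
    skewTensor k A Γ (Pi.mulSingle i r) = skewSingle k A Γ i r :=
  MonoidHom.noncommPiCoprod_mulSingle (fun i => (skewSingle k A Γ i).toRingHom.toMonoidHom) i r

/-- Both sides are monoid homomorphisms out of a finite product, so it is enough to compare them on
each factor. -/
theorem skewTensor_inclAlg (a : ∀ i, A i) :
    skewTensor k A Γ (fun i => inclAlg k _ _ (a i)) =
      inclAlg k _ _ (PiTensorProduct.tprod k a) := by
  have : (skewTensor k A Γ).comp (MonoidHom.piMap fun i => (inclAlg k (A i) (Γ i)).toRingHom.toMonoidHom) =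
      (inclAlg k (⨂[k] i, A i) (∀ i, Γ i)).toRingHom.toMonoidHom.comp
        (PiTensorProduct.tprodMonoidHom k) := by
    refine MonoidHom.pi_ext fun i x => ?_
    have h : (MonoidHom.piMap fun i => (inclAlg k (A i) (Γ i)).toRingHom.toMonoidHom) (Pi.mulSingle i x) =
        Pi.mulSingle i (inclAlg k (A i) (Γ i) x) := by
      funext j
      exact (Pi.apply_mulSingle (fun i => inclAlg k (A i) (Γ i)) (fun i => map_one _) i x j)
    rw [MonoidHom.comp_apply, h, skewTensor_mulSingle, skewSingle_inclAlg]
    rfl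
  exact DFunLike.congr_fun this a

theorem skewTensor_of (γ : ∀ i, Γ i) :
    skewTensor k A Γ (fun i => SkewMonoidAlgebra.of _ _ (γ i)) =
      SkewMonoidAlgebra.of _ _ γ := by
  have : (skewTensor k A Γ).comp (MonoidHom.piMap fun i => SkewMonoidAlgebra.of (A i) (Γ i)) =
      SkewMonoidAlgebra.of (⨂[k] i, A i) (∀ i, Γ i) := by
    refine MonoidHom.pi_ext fun i x => ?_
    have h : (MonoidHom.piMap fun i => SkewMonoidAlgebra.of (A i) (Γ i)) (Pi.mulSingle i x) =
        Pi.mulSingle i (SkewMonoidAlgebra.of (A i) (Γ i) x) := by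
      funext j
      exact (Pi.apply_mulSingle (fun i => SkewMonoidAlgebra.of (A i) (Γ i)) (fun i => map_one _)
        i x j)
    rw [MonoidHom.comp_apply, h, skewTensor_mulSingle, skewSingle_of]
  exact DFunLike.congr_fun this γ

/-- With the `i`-th entry isolated as a single factor, additivity in that entry is that of the
algebra map `skewSingle`. -/
theorem skewTensor_update (r : ∀ i, SkewMonoidAlgebra (A i) (Γ i)) (i : Fin n)
    (x : SkewMonoidAlgebra (A i) (Γ i)) : skewTensor k A Γ (Function.update r i x) =
      skewTensor k A Γ (Function.update r i 1) * skewSingle k A Γ i x := by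
  rw [← skewTensor_mulSingle, ← map_mul]
  congr 1
  funext j
  by_cases hj : j = i
  · subst hj; simp
  · simp [hj]

variable (k A Γ) in
/-- `skewTensor` as a multilinear map. -/
def skewTensorMultilinear : MultilinearMap k (fun i => SkewMonoidAlgebra (A i) (Γ i))
    (SkewMonoidAlgebra (⨂[k] i, A i) (∀ i, Γ i)) where
  toFun := skewTensor k A Γ
  map_update_add' {inst} r i x y := by
    rw [Subsingleton.elim inst (instDecidableEqFin n)]
    rw [skewTensor_update, map_add, mul_add, ← skewTensor_update, ← skewTensor_update]
  map_update_smul' {inst} r i c x := by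
    rw [Subsingleton.elim inst (instDecidableEqFin n)]
    rw [skewTensor_update, map_smul, mul_smul_comm, ← skewTensor_update]

/-! ### Tensor products of modules -/

variable {M N : ∀ i, AlgModule k (SkewMonoidAlgebra (A i) (Γ i))}

variable (M) in
/-- The underlying space of `tensorModule M` is `⨂ Mᵢ`. -/
def tensorModuleEquiv : (⨂[k] i, M i) ≃ₗ[k] tensorModule M := LinearEquiv.refl k _

variable (M) in
/-- The pure tensor `m₁ ⊗ ⋯ ⊗ mₙ` in `tensorModule M`. -/
def tmk : MultilinearMap k (fun i => M i) (tensorModule M) :=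
  (tensorModuleEquiv M).toLinearMap.compMultilinearMap (PiTensorProduct.tprod k)

theorem tensorModule_hom_ext {V : Type*} [AddCommGroup V] [Module k V]
    {φ φ' : tensorModule M →ₗ[k] V} (h : ∀ m, φ (tmk M m) = φ' (tmk M m)) : φ = φ' :=
  PiTensorProduct.ext (R := k) (MultilinearMap.ext h)

theorem span_range_tmk : Submodule.span k (Set.range (tmk M)) = ⊤ :=
  PiTensorProduct.span_tprod_eq_top

theorem tensorModule_mem {W : Submodule k (tensorModule M)} (h : ∀ m, tmk M m ∈ W)
    (t : tensorModule M) : t ∈ W := by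
  have : (⊤ : Submodule k (tensorModule M)) ≤ W := by
    rw [← span_range_tmk, Submodule.span_le]
    rintro _ ⟨m, rfl⟩
    exact h m
  exact this Submodule.mem_top

theorem inclAlg_smul_tmk (a : ∀ i, A i) (m : ∀ i, M i) :
    inclAlg k (⨂[k] i, A i) (∀ i, Γ i) (PiTensorProduct.tprod k a) • tmk M m =
      tmk M fun i => inclAlg k (A i) (Γ i) (a i) • m i :=
  tensorModule_smul_tprod M a 1 m

theorem of_smul_tmk (γ : ∀ i, Γ i) (m : ∀ i, M i) :
    SkewMonoidAlgebra.of (⨂[k] i, A i) (∀ i, Γ i) γ • tmk M m =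
      tmk M fun i => SkewMonoidAlgebra.of (A i) (Γ i) (γ i) • m i :=
  tensorModule_smul_tprod M 1 γ m

theorem skewSingle_smul_tmk (i : Fin n) (r : SkewMonoidAlgebra (A i) (Γ i)) (m : ∀ i, M i) :
    skewSingle k A Γ i r • tmk M m = tmk M (Function.update m i (r • m i)) := by
  induction r using skew_induction generalizing m with
  | incl a =>
    rw [← inclAlg_apply (k := k), skewSingle_inclAlg, PiTensorProduct.singleAlgHom_apply,
      inclAlg_smul_tmk]
    congr 1
    funext j
    by_cases hj : j = i
    · subst hj; simp
    · simp [hj]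
  | of γ =>
    rw [skewSingle_of, of_smul_tmk]
    congr 1
    funext j
    by_cases hj : j = i
    · subst hj; simp
    · simp [hj]
  | add x y hx hy => rw [map_add, add_smul, hx, hy, add_smul, MultilinearMap.map_update_add]
  | mul x y hx hy =>
    rw [map_mul, mul_smul, hy, hx, Function.update_idem, Function.update_self, mul_smul]

/-- Both actions are multiplicative in `r`, so only tuples with a single nontrivial entry need to be
checked. -/
theorem skewTensor_smul_tmk (r : ∀ i, SkewMonoidAlgebra (A i) (Γ i)) (m : ∀ i, M i) :
    skewTensor k A Γ r • tmk M m = tmk M fun i => r i • m i := by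
  have : (tensorRep M).toRingHom.toMonoidHom.comp (skewTensor k A Γ) =
      PiTensorProduct.mapMonoidHom.comp
        (MonoidHom.piMap fun i => (Algebra.lsmul k k (M i) : SkewMonoidAlgebra (A i) (Γ i) →ₐ[k] _).toRingHom.toMonoidHom) := by
    refine MonoidHom.pi_ext fun i x => ?_
    rw [MonoidHom.comp_apply, skewTensor_mulSingle]
    refine PiTensorProduct.ext (MultilinearMap.ext fun m => ?_)
    refine (skewSingle_smul_tmk i x m).trans ?_
    change PiTensorProduct.tprod k _ = PiTensorProduct.map _ (PiTensorProduct.tprod k m)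
    rw [PiTensorProduct.map_tprod]
    congr 1
    funext j
    change _ = (Pi.mulSingle i x : ∀ i, SkewMonoidAlgebra (A i) (Γ i)) j • m j
    by_cases hj : j = i
    · subst hj; simp
    · simp [hj]
  have h2 := LinearMap.congr_fun (DFunLike.congr_fun this r) (PiTensorProduct.tprod k m)
  refine h2.trans ?_
  exact PiTensorProduct.map_tprod _ m

/-- The tensor product of bases. -/
def tensorBasis {κ : Fin n → Type*} (b : ∀ i, Module.Basis (κ i) k (M i)) :
    Module.Basis (∀ i, κ i) k (tensorModule M) :=
  (Basis.piTensorProduct b).map (tensorModuleEquiv M)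

theorem tensorBasis_apply {κ : Fin n → Type*} (b : ∀ i, Module.Basis (κ i) k (M i))
    (p : ∀ i, κ i) : tensorBasis b p = tmk M fun i => b i (p i) := by
  rw [tensorBasis, Module.Basis.map_apply, Basis.piTensorProduct_apply]; rfl

theorem tensorBasis_repr_tmk {κ : Fin n → Type*} (b : ∀ i, Module.Basis (κ i) k (M i))
    (m : ∀ i, M i) (p : ∀ i, κ i) :
    (tensorBasis b).repr (tmk M m) p = ∏ i, (b i).repr (m i) (p i) :=
  Basis.piTensorProduct_repr_tprod_apply b m p

/-- Coordinates of a pure tensor in a tensor basis are products of coordinates; a nonzero one is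
chosen in each factor. -/
theorem tmk_ne_zero {m : ∀ i, M i} (hm : ∀ i, m i ≠ 0) : tmk M m ≠ 0 := by
  let b := fun i => Module.Basis.ofVectorSpace k (M i)
  have h : ∀ i, ∃ j, (b i).repr (m i) j ≠ 0 := fun i => by
    by_contra! hc
    exact hm i ((b i).repr.map_eq_zero_iff.1 (Finsupp.ext hc))
  choose p hp using h
  intro h0
  have := tensorBasis_repr_tmk b m p
  rw [h0, map_zero, Finsupp.zero_apply] at this
  exact Finset.prod_ne_zero_iff.2 (fun i _ => hp i) this.symm

/-- The tensor product of simple modules with scalar endomorphisms only is simple. -/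
theorem tensorModule_simple (hM : ∀ i, IsSimpleModule (SkewMonoidAlgebra (A i) (Γ i)) (M i))
    (hend : ∀ i, ∀ φ : M i →ₗ[SkewMonoidAlgebra (A i) (Γ i)] M i, ∃ c : k, ∀ e, φ e = c • e) :
    IsSimpleModule (SkewMonoidAlgebra (⨂[k] i, A i) (∀ i, Γ i)) (tensorModule M) := by
  classical
  let b := fun i => Module.Basis.ofVectorSpace k (M i)
  rw [isSimpleModule_iff_toSpanSingleton_surjective]
  refine ⟨?_, fun w hw => ?_⟩
  · have h : ∀ i, ∃ m : M i, m ≠ 0 := fun i =>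
      have := IsSimpleModule.nontrivial (SkewMonoidAlgebra (A i) (Γ i)) (M i)
      exists_ne 0
    choose m hm using h
    exact ⟨_, _, tmk_ne_zero hm⟩
  · obtain ⟨p, hp⟩ : ∃ p, (tensorBasis b).repr w p ≠ 0 := by
      by_contra! hc
      exact hw ((tensorBasis b).repr.map_eq_zero_iff.1 (Finsupp.ext hc))
    rw [← LinearMap.range_eq_top, LinearMap.range_toSpanSingleton, eq_top_iff]
    intro t _
    refine tensorModule_mem (W := (Submodule.span _ {w}).restrictScalars k) (fun m => ?_) t
    -- Density in each factor: `r i` sends the `p i`-th basis vector to the target and kills the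
    -- other `i`-th factors occurring in `w`. The product of the `r i` then isolates the `p`-th term
    -- of `w`.
    have h : ∀ i, ∃ r : SkewMonoidAlgebra (A i) (Γ i), r • b i (p i) = m i ∧
        ∀ l ∈ ((tensorBasis b).repr w).support.image (fun q => q i), l ≠ p i → r • b i l = 0 :=
      fun i => exists_smul_basis (M i) (hend i) (b i) _ (p i) (m i)
    choose r hr hr' using h
    have h1 : skewTensor k A Γ r • w = (tensorBasis b).repr w p • tmk M m := by
      conv_lhs => rw [← (tensorBasis b).linearCombination_repr w]
      rw [Finsupp.linearCombination_apply, Finsupp.sum, Finset.smul_sum, Finset.sum_eq_single p]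
      · rw [smul_comm_of_algebra, tensorBasis_apply, skewTensor_smul_tmk]
        simp only [hr]
      · intro q hq hqp
        obtain ⟨i, hi⟩ := Function.ne_iff.1 hqp
        rw [smul_comm_of_algebra, tensorBasis_apply, skewTensor_smul_tmk,
          (tmk M).map_coord_zero i (hr' i _ (Finset.mem_image_of_mem _ hq) hi), smul_zero]
      · intro hn
        rw [Finsupp.notMem_support_iff.1 hn, zero_smul, smul_zero]
    have h2 : tmk M m = ((tensorBasis b).repr w p)⁻¹ • skewTensor k A Γ r • w := by
      rw [h1, smul_smul, inv_mul_cancel₀ hp, one_smul]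
    rw [h2]
    exact Submodule.smul_mem _ _ (Submodule.smul_mem (Submodule.span _ {w}) _
      (Submodule.mem_span_singleton_self w))

/-- `A ⋊ Γ`-linearity of maps from a tensor product may be tested on pure tensors. -/
theorem map_inclAlg_smul_of_tmk {V : AlgModule k (SkewMonoidAlgebra (⨂[k] i, A i) (∀ i, Γ i))}
    {φ : tensorModule M →ₗ[k] V}
    (h : ∀ (r : ∀ i, SkewMonoidAlgebra (A i) (Γ i)) m,
      φ (tmk M fun i => r i • m i) = skewTensor k A Γ r • φ (tmk M m))
    (a : ⨂[k] i, A i) (t : tensorModule M) :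
    φ (inclAlg k (⨂[k] i, A i) (∀ i, Γ i) a • t) = inclAlg k (⨂[k] i, A i) (∀ i, Γ i) a • φ t := by
  induction a using PiTensorProduct.induction_on with
  | smul_tprod c a =>
    have : φ ∘ₗ Algebra.lsmul k k _ (inclAlg k (⨂[k] i, A i) (∀ i, Γ i) (PiTensorProduct.tprod k a)) =
        Algebra.lsmul k k _ (inclAlg k (⨂[k] i, A i) (∀ i, Γ i) (PiTensorProduct.tprod k a)) ∘ₗ φ :=
      tensorModule_hom_ext fun m => by
        simp only [LinearMap.comp_apply, Algebra.lsmul_coe]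
        rw [inclAlg_smul_tmk, h, skewTensor_inclAlg]
    have := LinearMap.congr_fun this t
    simp only [LinearMap.comp_apply, Algebra.lsmul_coe] at this
    rw [map_smul (inclAlg k (⨂[k] i, A i) (∀ i, Γ i)), smul_assoc, smul_assoc, φ.map_smul, this]
  | add x y hx hy => rw [map_add, add_smul, add_smul, map_add, hx, hy]

theorem map_of_smul_of_tmk {V : AlgModule k (SkewMonoidAlgebra (⨂[k] i, A i) (∀ i, Γ i))}
    {φ : tensorModule M →ₗ[k] V}
    (h : ∀ (r : ∀ i, SkewMonoidAlgebra (A i) (Γ i)) m,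
      φ (tmk M fun i => r i • m i) = skewTensor k A Γ r • φ (tmk M m))
    (γ : ∀ i, Γ i) (t : tensorModule M) :
    φ (SkewMonoidAlgebra.of (⨂[k] i, A i) (∀ i, Γ i) γ • t) = SkewMonoidAlgebra.of (⨂[k] i, A i) (∀ i, Γ i) γ • φ t := by
  have : φ ∘ₗ Algebra.lsmul k k _ (SkewMonoidAlgebra.of (⨂[k] i, A i) (∀ i, Γ i) γ) =
      Algebra.lsmul k k _ (SkewMonoidAlgebra.of (⨂[k] i, A i) (∀ i, Γ i) γ) ∘ₗ φ :=
    tensorModule_hom_ext fun m => by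
      simp only [LinearMap.comp_apply, Algebra.lsmul_coe]
      rw [of_smul_tmk, h, skewTensor_of]
  exact LinearMap.congr_fun this t

/-- A map from a tensor product which is compatible with the actions on pure tensors is linear. -/
def tensorLinearMap {V : AlgModule k (SkewMonoidAlgebra (⨂[k] i, A i) (∀ i, Γ i))}
    (φ : tensorModule M →ₗ[k] V)
    (h : ∀ (r : ∀ i, SkewMonoidAlgebra (A i) (Γ i)) m,
      φ (tmk M fun i => r i • m i) = skewTensor k A Γ r • φ (tmk M m)) :
    tensorModule M →ₗ[SkewMonoidAlgebra (⨂[k] i, A i) (∀ i, Γ i)] V :=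
  skewLinearMap φ (map_inclAlg_smul_of_tmk h) (map_of_smul_of_tmk h)

theorem tensorModule_iso (e : ∀ i, (M i).Iso (N i)) :
    (tensorModule M).Iso (tensorModule N) := by
  let φ : tensorModule M ≃ₗ[k] tensorModule N :=
    (tensorModuleEquiv M).symm ≪≫ₗ
      PiTensorProduct.congr (fun i => (e i).some.restrictScalars k) ≪≫ₗ tensorModuleEquiv N
  have hφ : ∀ m, φ (tmk M m) = tmk N fun i => (e i).some (m i) := fun m =>
    PiTensorProduct.congr_tprod _ m
  exact ⟨LinearEquiv.ofBijective (tensorLinearMap φ.toLinearMap fun r m => by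
    simp only [LinearEquiv.coe_coe]
    rw [hφ, hφ, skewTensor_smul_tmk]
    simp only [map_smul]) φ.bijective⟩

end Tensor

section Tensor

variable {k : Type u} [Field k] {n : ℕ} {A H Γ : Fin n → Type u} [∀ i, Ring (A i)]
  [∀ i, Algebra k (A i)] [∀ i, Ring (H i)] [∀ i, Algebra k (H i)] [∀ i, Group (Γ i)]
  [∀ i, MulSemiringAction (Γ i) (A i)] [∀ i, SMulCommClass (Γ i) k (A i)]
  [∀ i, MulSemiringAction (Γ i) (H i)] [∀ i, SMulCommClass (Γ i) k (H i)]

/-! ### Recovering the factors of a tensor product of simple modules -/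

section Factors

variable {M N : ∀ i, AlgModule k (SkewMonoidAlgebra (A i) (Γ i))}

theorem prod_erase_update_self {ι R : Type*} [Fintype ι] [DecidableEq ι] [CommMonoid R]
    {X : ι → Type*} (u : ∀ i, X i → R) (m : ∀ i, X i) (i : ι) (z : X i) :
    ∏ l ∈ Finset.univ.erase i, u l (Function.update m i z l) =
      ∏ l ∈ Finset.univ.erase i, u l (m l) :=
  Finset.prod_congr rfl fun l hl => by rw [Function.update_of_ne (Finset.ne_of_mem_erase hl)]

theorem prod_erase_update_of_ne {ι R : Type*} [Fintype ι] [DecidableEq ι] [CommMonoid R]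
    {X : ι → Type*} (u : ∀ i, X i → R) (m : ∀ i, X i) {i j : ι} (hj : j ≠ i) (z : X j) :
    ∏ l ∈ Finset.univ.erase i, u l (Function.update m j z l) =
      u j z * ∏ l ∈ (Finset.univ.erase i).erase j, u l (m l) := by
  rw [← Finset.mul_prod_erase _ _ (Finset.mem_erase.2 ⟨hj, Finset.mem_univ j⟩),
    Function.update_self]
  congr 1
  exact Finset.prod_congr rfl fun l hl => by
    rw [Function.update_of_ne (Finset.ne_of_mem_erase hl)]

/-- Contraction of all the factors of a tensor product but the `i`-th one. -/
def tensorContract (i : Fin n) (u : ∀ j, N j →ₗ[k] k) : tensorModule N →ₗ[k] N i :=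
  PiTensorProduct.lift <| MultilinearMap.mk'
    (fun m => (∏ j ∈ Finset.univ.erase i, u j (m j)) • m i)
    (fun m j x y => by
      by_cases hj : j = i
      · subst hj
        simp only [prod_erase_update_self (fun l => u l), Function.update_self, smul_add]
      · simp only [prod_erase_update_of_ne (fun l => u l) m hj,
          Function.update_of_ne (Ne.symm hj), map_add, add_mul, add_smul])
    (fun m j c x => by
      by_cases hj : j = i
      · subst hj
        simp only [prod_erase_update_self (fun l => u l), Function.update_self]
        rw [smul_comm]
      · simp only [prod_erase_update_of_ne (fun l => u l) m hj,
          Function.update_of_ne (Ne.symm hj), map_smul, smul_eq_mul, mul_assoc, mul_smul])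

theorem tensorContract_tmk (i : Fin n) (u : ∀ j, N j →ₗ[k] k) (m : ∀ j, N j) :
    tensorContract i u (tmk N m) = (∏ j ∈ Finset.univ.erase i, u j (m j)) • m i :=
  PiTensorProduct.lift.tprod m

/-- The `i`-th slot is untouched by the contraction, so the action of the `i`-th factor survives. -/
theorem tensorContract_smul (i : Fin n) (u : ∀ j, N j →ₗ[k] k)
    (r : SkewMonoidAlgebra (A i) (Γ i)) (t : tensorModule N) :
    tensorContract i u (skewSingle k A Γ i r • t) = r • tensorContract i u t := by
  have : tensorContract i u ∘ₗ Algebra.lsmul k k _ (skewSingle k A Γ i r) =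
      Algebra.lsmul k k _ r ∘ₗ tensorContract i u :=
    tensorModule_hom_ext fun m => by
      simp only [LinearMap.comp_apply, Algebra.lsmul_coe]
      rw [skewSingle_smul_tmk, tensorContract_tmk, tensorContract_tmk, smul_comm_of_algebra,
        Function.update_self]
      congr 1
      exact Finset.prod_congr rfl fun l hl => by
        rw [Function.update_of_ne (Finset.ne_of_mem_erase hl)]
  exact LinearMap.congr_fun this t

/-- A nonzero coordinate of `t` is still visible after contracting with coordinate functionals, so
such a contraction is nonzero. -/
theorem repr_tensorContract {κ : Fin n → Type*} (b : ∀ i, Module.Basis (κ i) k (N i))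
    (p : ∀ i, κ i) (i : Fin n) (t : tensorModule N) :
    (b i).repr (tensorContract i (fun j => (b j).coord (p j)) t) (p i) =
      (tensorBasis b).repr t p := by
  have : (b i).coord (p i) ∘ₗ tensorContract i (fun j => (b j).coord (p j)) =
      (tensorBasis b).coord p :=
    tensorModule_hom_ext fun m => by
      simp only [LinearMap.comp_apply, Module.Basis.coord_apply]
      rw [tensorContract_tmk, tensorBasis_repr_tmk, map_smul, Finsupp.smul_apply, smul_eq_mul,
        ← Finset.mul_prod_erase _ _ (Finset.mem_univ i), mul_comm]
      rfl
  exact LinearMap.congr_fun this t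

/-- To recover the `i`-th isomorphism, fix nonzero vectors in the other slots, apply `e`, and
contract the other slots by functionals chosen to keep the result nonzero. A nonzero map between
simple modules is bijective. -/
theorem tensorModule_iso_iff
    (hM : ∀ i, IsSimpleModule (SkewMonoidAlgebra (A i) (Γ i)) (M i))
    (hN : ∀ i, IsSimpleModule (SkewMonoidAlgebra (A i) (Γ i)) (N i)) :
    (tensorModule M).Iso (tensorModule N) ↔ ∀ i, (M i).Iso (N i) := by
  refine ⟨fun ⟨e⟩ i => ?_, tensorModule_iso⟩
  have h : ∀ i, ∃ m : M i, m ≠ 0 := fun i =>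
    have := IsSimpleModule.nontrivial (SkewMonoidAlgebra (A i) (Γ i)) (M i)
    exists_ne 0
  choose m hm using h
  let b := fun i => Module.Basis.ofVectorSpace k (N i)
  have hne : e (tmk M m) ≠ 0 := fun h => tmk_ne_zero hm (e.map_eq_zero_iff.1 h)
  obtain ⟨p, hp⟩ : ∃ p, (tensorBasis b).repr (e (tmk M m)) p ≠ 0 := by
    by_contra! hc
    exact hne ((tensorBasis b).repr.map_eq_zero_iff.1 (Finsupp.ext hc))
  let g : M i →ₗ[SkewMonoidAlgebra (A i) (Γ i)] N i :=
    { toFun := fun x => tensorContract i (fun j => (b j).coord (p j))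
        (e (tmk M (Function.update m i x)))
      map_add' := fun x y => by rw [(tmk M).map_update_add, map_add, map_add]
      map_smul' := fun r x => by
        have : tmk M (Function.update m i (r • x)) =
            skewSingle k A Γ i r • tmk M (Function.update m i x) := by
          rw [skewSingle_smul_tmk, Function.update_idem, Function.update_self]
        rw [this, e.map_smul, tensorContract_smul]
        rfl }
  refine ⟨LinearEquiv.ofBijective g (LinearMap.bijective_of_ne_zero fun h0 => hp ?_)⟩
  have h1 : g (m i) = 0 := by rw [h0, LinearMap.zero_apply]
  have h2 : g (m i) = tensorContract i (fun j => (b j).coord (p j)) (e (tmk M m)) := by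
    change tensorContract i _ (e (tmk M (Function.update m i (m i)))) = _
    rw [Function.update_eq_self]
  rw [← repr_tensorContract b p i, ← h2, h1, map_zero, Finsupp.zero_apply]

end Factors

/-! ### Simple modules over a tensor product are tensor products -/

section Decomposition

variable {V : AlgModule k (SkewMonoidAlgebra (⨂[k] i, A i) (∀ i, Γ i))}

/-- The factors commute, so each entry can in turn be brought next to `v` and exchanged for one with
the same effect on `v`. -/
theorem skewTensor_smul_congr {v : V} {r r' : ∀ i, SkewMonoidAlgebra (A i) (Γ i)}
    (h : ∀ i, skewSingle k A Γ i (r i) • v = skewSingle k A Γ i (r' i) • v) :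
    skewTensor k A Γ r • v = skewTensor k A Γ r' • v := by
  classical
  have key : ∀ s : Finset (Fin n), skewTensor k A Γ (s.piecewise r' r) • v =
      skewTensor k A Γ r • v := by
    intro s
    induction s using Finset.induction_on with
    | empty => rw [Finset.piecewise_empty]
    | insert j s hj ih =>
      rw [← ih, Finset.piecewise_insert, skewTensor_update, mul_smul, ← h, ← mul_smul,
        ← skewTensor_update]
      congr 2
      have : s.piecewise r' r j = r j := Finset.piecewise_eq_of_notMem _ _ _ hj
      rw [← this, Function.update_eq_self]
  have := key Finset.univ
  rw [Finset.piecewise_univ] at this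
  exact this.symm

/-- A finite-dimensional module contains a vector generating a simple module over every factor. -/
theorem exists_simple_vector [FiniteDimensional k V] [Nontrivial V] (s : Finset (Fin n)) :
    ∃ v : V, v ≠ 0 ∧ ∀ i ∈ s, ∀ r : SkewMonoidAlgebra (A i) (Γ i),
      skewSingle k A Γ i r • v ≠ 0 → ∃ r', skewSingle k A Γ i r' • skewSingle k A Γ i r • v = v := by
  induction s using Finset.induction_on with
  | empty =>
    obtain ⟨v, hv⟩ := exists_ne (0 : V)
    exact ⟨v, hv, by simp⟩
  | insert i s hi ih =>
    obtain ⟨v, hv, hs⟩ := ih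
    let P := V.pull (skewSingle k A Γ i)
    let v₀ : P := v
    -- The new vector is taken in a simple submodule of the module generated by `v` over the `i`-th
    -- factor, so it has the form `a v`.
    let W := P.sub (Submodule.span (SkewMonoidAlgebra (A i) (Γ i)) {v₀})
    have : FiniteDimensional k P := inferInstanceAs (FiniteDimensional k V)
    have : FiniteDimensional k W := P.finiteDimensional_sub _
    have : Nontrivial W := ⟨⟨v₀, Submodule.mem_span_singleton_self v₀⟩, 0,
      fun h => hv (congrArg Subtype.val h)⟩
    obtain ⟨S, hS⟩ := exists_simple_submodule_of_finite W
    have := IsSimpleModule.nontrivial (SkewMonoidAlgebra (A i) (Γ i)) S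
    obtain ⟨⟨⟨v', hv'⟩, hvS⟩, hv0⟩ := exists_ne (0 : S)
    obtain ⟨a, rfl⟩ := Submodule.mem_span_singleton.1 hv'
    refine ⟨skewSingle k A Γ i a • v, fun h => hv0 (Subtype.ext (Subtype.ext h)),
      fun j hj r hr => ?_⟩
    rcases Finset.mem_insert.1 hj with rfl | hj
    · let x : S := ⟨⟨a • v₀, hv'⟩, hvS⟩
      obtain ⟨r', hr'⟩ := (isSimpleModule_iff_toSpanSingleton_surjective.1 hS).2 (r • x)
        (fun h => hr (congrArg Subtype.val (congrArg Subtype.val h))) x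
      exact ⟨r', congrArg Subtype.val (congrArg Subtype.val hr')⟩
    -- The property for an earlier factor `j` passes from `v` to `a v` because `a` commutes with
    -- that factor.
    · have hij : i ≠ j := fun h => hi (h ▸ hj)
      have hc := fun (y : SkewMonoidAlgebra (A j) (Γ j)) (w : V) =>
        show skewSingle k A Γ j y • skewSingle k A Γ i a • w =
          skewSingle k A Γ i a • skewSingle k A Γ j y • w by
        rw [← mul_smul, ← (commute_skewSingle hij a y).eq, mul_smul]
      rw [hc] at hr ⊢
      obtain ⟨r', hr'⟩ := hs j hj r fun h => hr (by rw [h, smul_zero])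
      exact ⟨r', by rw [hc, hr']⟩

theorem weightSpace_le_weightSpace_pull (lam : (⨂[k] i, H i) →ₐ[k] k) (i : Fin n)
    (V : AlgModule k (SkewMonoidAlgebra (⨂[k] i, H i) (∀ i, Γ i))) :
    weightSpace (inclAlg k (⨂[k] i, H i) (∀ i, Γ i)) V lam ≤
      weightSpace (inclAlg k (H i) (Γ i)) (V.pull (skewSingle k H Γ i))
        (lam.comp (PiTensorProduct.singleAlgHom i)) := fun m hm h => by
  change skewSingle k H Γ i (inclAlg k (H i) (Γ i) h) • m = _
  rw [skewSingle_inclAlg, hm]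
  rfl

/-- Let `v` generate a simple module `xᵢ` over every factor. Then `r₁ v ⊗ ⋯ ⊗ rₙ v ↦ (r₁ ⋯ rₙ) v` is
a well-defined nonzero map from the simple module `⨂ xᵢ` to `V`, hence an isomorphism. -/
theorem IsSimpleWeightModule.exists_tensor
    {V : AlgModule k (SkewMonoidAlgebra (⨂[k] i, H i) (∀ i, Γ i))}
    (hV : IsSimpleWeightModule k (⨂[k] i, H i) (∀ i, Γ i) V)
    (hk : ∀ i, Subsingleton (Γ i) ∨ IsAlgClosed k) :
    ∃ x : ∀ i, AlgModule k (SkewMonoidAlgebra (H i) (Γ i)),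
      (∀ i, IsSimpleWeightModule k (H i) (Γ i) (x i)) ∧ V.Iso (tensorModule x) := by
  have := hV.finite
  have := hV.simple
  have := IsSimpleModule.nontrivial (SkewMonoidAlgebra (⨂[k] i, H i) (∀ i, Γ i)) V
  obtain ⟨v, hv, hs⟩ := exists_simple_vector (V := V) Finset.univ
  let P := fun i => V.pull (skewSingle k H Γ i)
  let v₀ : ∀ i, P i := fun i => v
  let x := fun i => (P i).sub (Submodule.span (SkewMonoidAlgebra (H i) (Γ i)) {v₀ i})
  let w : ∀ i, x i := fun i => ⟨v₀ i, Submodule.mem_span_singleton_self (v₀ i)⟩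
  let val : ∀ i, x i → V := fun i y => y.1
  have hx : ∀ i (y : x i), ∃ r : SkewMonoidAlgebra (H i) (Γ i), r • w i = y := fun i y => by
    obtain ⟨r, hr⟩ := Submodule.mem_span_singleton.1 y.2
    exact ⟨r, Subtype.ext hr⟩
  have hsimple : ∀ i, IsSimpleWeightModule k (H i) (Γ i) (x i) := fun i => by
    have : FiniteDimensional k (P i) := inferInstanceAs (FiniteDimensional k V)
    refine ⟨isSimpleModule_iff_toSpanSingleton_surjective.2
      ⟨⟨w i, 0, fun h => hv (congrArg Subtype.val h)⟩, fun y hy z => ?_⟩,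
      (P i).finiteDimensional_sub _, (P i).semisimple_sub ?_ _⟩
    · obtain ⟨r, rfl⟩ := hx i y
      obtain ⟨r', rfl⟩ := hx i z
      obtain ⟨q, hq⟩ := hs i (Finset.mem_univ i) r fun h => hy (Subtype.ext h)
      refine ⟨r' * q, Subtype.ext ?_⟩
      change skewSingle k H Γ i (r' * q) • skewSingle k H Γ i r • v = skewSingle k H Γ i r' • v
      rw [map_mul, mul_smul, hq]
    · rw [IsWeightSemisimple, eq_top_iff]
      have h := hV.semisimple
      rw [IsWeightSemisimple, eq_top_iff] at h
      exact h.trans (iSup_le fun lam => (weightSpace_le_weightSpace_pull lam i V).trans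
        (le_iSup _ _))
  have hend := fun i => (hsimple i).exists_scalar (hk i)
  have htens := tensorModule_simple (fun i => (hsimple i).simple) hend
  -- A `k`-linear choice of `r` with `r v = y` makes the formula multilinear; linearity over the
  -- skew group ring follows because the choice does not matter.
  have hsec : ∀ i, ∃ σ : x i →ₗ[k] SkewMonoidAlgebra (H i) (Γ i), ∀ y, σ y • w i = y := fun i => by
    obtain ⟨σ, hσ⟩ := LinearMap.exists_rightInverse_of_surjective
      ((LinearMap.toSpanSingleton (SkewMonoidAlgebra (H i) (Γ i)) (x i) (w i)).restrictScalars k)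
      (LinearMap.range_eq_top.2 (hx i))
    exact ⟨σ, fun y => LinearMap.congr_fun hσ y⟩
  choose σ hσ using hsec
  have hσ' : ∀ i y, skewSingle k H Γ i (σ i y) • v = val i y := fun i y =>
    congrArg Subtype.val (hσ i y)
  let β : tensorModule x →ₗ[k] V := PiTensorProduct.lift
    (((LinearMap.toSpanSingleton (SkewMonoidAlgebra (⨂[k] i, H i) (∀ i, Γ i)) V
      v).restrictScalars k).compMultilinearMap
      ((skewTensorMultilinear k H Γ).compLinearMap σ))
  have hβ : ∀ m, β (tmk x m) = skewTensor k H Γ (fun i => σ i (m i)) • v := fun m =>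
    PiTensorProduct.lift.tprod m
  let β' := tensorLinearMap β fun r m => by
    rw [hβ, hβ, ← mul_smul, ← map_mul]
    refine skewTensor_smul_congr fun i => ?_
    rw [hσ', Pi.mul_apply, map_mul, mul_smul, hσ']
    rfl
  refine ⟨x, hsimple, ⟨(LinearEquiv.ofBijective β' (LinearMap.bijective_of_ne_zero
    fun h0 => hv ?_)).symm⟩⟩
  have h1 : β (tmk x w) = 0 := LinearMap.congr_fun h0 (tmk x w)
  have h2 : skewTensor k H Γ (fun i => σ i (w i)) • v = skewTensor k H Γ 1 • v :=
    skewTensor_smul_congr fun i => by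
      rw [hσ', Pi.one_apply, map_one, one_smul]
  rw [hβ, h2, map_one, one_smul] at h1
  exact h1

end Decomposition

end Tensor

/-! ### Bases of weight vectors -/

section WeightBasis

variable {k H R : Type u} [Field k] [Ring H] [Algebra k H] [Ring R] [Algebra k R]
  {f : H →ₐ[k] R} {M : Type u} [AddCommGroup M] [Module k M] [Module R M] [IsScalarTower k R M]

theorem IsWeightSemisimple.exists_basis (hM : IsWeightSemisimple f M) :
    ∃ (κ : Type u) (b : Module.Basis κ k M) (wt : κ → H →ₐ[k] k),
      ∀ j, b j ∈ weightSpace f M (wt j) := by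
  have hs : ⊤ ≤ Submodule.span k {m : M | ∃ lam, m ∈ weightSpace f M lam} := by
    rw [← hM]
    exact iSup_le fun lam m hm => Submodule.subset_span ⟨lam, hm⟩
  have h := fun j => Module.Basis.ofSpan_subset hs (Set.mem_range_self j)
  choose wt hwt using h
  exact ⟨_, Module.Basis.ofSpan hs, wt, hwt⟩

variable {κ : Type*} (b : Module.Basis κ k M) {wt : κ → H →ₐ[k] k}

theorem isWeightSemisimple_of_basis (hb : ∀ j, b j ∈ weightSpace f M (wt j)) :
    IsWeightSemisimple f M := by
  rw [IsWeightSemisimple, eq_top_iff, ← b.span_eq, Submodule.span_le]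
  rintro _ ⟨j, rfl⟩
  exact Submodule.mem_iSup_of_mem (wt j) (hb j)

theorem span_eq_weightSpace (hb : ∀ j, b j ∈ weightSpace f M (wt j)) (lam : H →ₐ[k] k) :
    Submodule.span k (Set.range fun j : {j // wt j = lam} => b j) = weightSpace f M lam := by
  refine le_antisymm (Submodule.span_le.2 ?_) fun m hm => ?_
  · rintro _ ⟨⟨j, rfl⟩, rfl⟩
    exact hb j
  · have h1 : m ∈ ⨆ j, k ∙ b j := by
      rw [← Submodule.span_range_eq_iSup, b.span_eq]
      exact Submodule.mem_top
    have h2 := mem_iSup_of_mem_weightSpace f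
      (fun j => (Submodule.span_singleton_le_iff_mem _ _).2 (hb j)) h1 hm
    have h3 : ⨆ (j) (_ : wt j = lam), k ∙ b j ≤
        Submodule.span k (Set.range fun j : {j // wt j = lam} => b j) :=
      iSup₂_le fun j hj => (Submodule.span_singleton_le_iff_mem _ _).2
        (Submodule.subset_span ⟨⟨j, hj⟩, rfl⟩)
    exact h3 h2

/-- The vectors of weight `lam` in a basis of weight vectors form a basis of the weight space. -/
def weightSpaceBasis (hb : ∀ j, b j ∈ weightSpace f M (wt j)) (lam : H →ₐ[k] k) :
    Module.Basis {j // wt j = lam} k (weightSpace f M lam) :=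
  (Module.Basis.span (b.linearIndependent.comp (fun j : {j // wt j = lam} => j.1)
    Subtype.val_injective)).map (LinearEquiv.ofEq _ _ (span_eq_weightSpace b hb lam))

end WeightBasis

section Tensor

variable {k : Type u} [Field k] {n : ℕ} {A H Γ : Fin n → Type u} [∀ i, Ring (A i)]
  [∀ i, Algebra k (A i)] [∀ i, Ring (H i)] [∀ i, Algebra k (H i)] [∀ i, Group (Γ i)]
  [∀ i, MulSemiringAction (Γ i) (A i)] [∀ i, SMulCommClass (Γ i) k (A i)]

/-! ### Weights of a tensor product of algebras -/

/-- The weight of `⨂ Hᵢ` with components `lamᵢ`. -/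
def tensorWeight (lam : ∀ i, H i →ₐ[k] k) : (⨂[k] i, H i) →ₐ[k] k :=
  (PiTensorProduct.constantBaseRingEquiv (Fin n) k).toAlgHom.comp (tensorAlgHom lam)

theorem tensorWeight_tprod (lam : ∀ i, H i →ₐ[k] k) (h : ∀ i, H i) :
    tensorWeight lam (PiTensorProduct.tprod k h) = ∏ i, lam i (h i) := by
  rw [tensorWeight, AlgHom.comp_apply, tensorAlgHom_tprod]
  exact PiTensorProduct.constantBaseRingEquiv_tprod _

/-- The components of a weight of `⨂ Hᵢ`. -/
def weightPart (lam : (⨂[k] i, H i) →ₐ[k] k) (i : Fin n) : H i →ₐ[k] k :=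
  lam.comp (PiTensorProduct.singleAlgHom (R := k) (A := H) i)

theorem weightPart_tensorWeight (lam : ∀ i, H i →ₐ[k] k) :
    weightPart (tensorWeight lam) = lam := by
  funext i
  refine AlgHom.ext fun h => ?_
  rw [weightPart, AlgHom.comp_apply, PiTensorProduct.singleAlgHom_apply, tensorWeight_tprod,
    Finset.prod_eq_single i]
  · simp
  · intro j _ hj
    simp [hj]
  · simp

theorem weightPart_injective : Function.Injective (weightPart (k := k) (H := H)) :=
  fun _ _ h => PiTensorProduct.algHom_ext fun i => congrFun h i

theorem tensorWeight_weightPart (lam : (⨂[k] i, H i) →ₐ[k] k) :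
    tensorWeight (weightPart lam) = lam :=
  weightPart_injective (weightPart_tensorWeight _)

theorem tensorWeight_eq_iff {lam : ∀ i, H i →ₐ[k] k} {mu : (⨂[k] i, H i) →ₐ[k] k} :
    tensorWeight lam = mu ↔ ∀ i, lam i = weightPart mu i := by
  rw [← funext_iff]
  constructor
  · rintro rfl; exact (weightPart_tensorWeight lam).symm
  · rintro rfl; exact tensorWeight_weightPart mu

theorem weightPart_bijective : Function.Bijective (weightPart (k := k) (H := H)) :=
  ⟨weightPart_injective, fun lam => ⟨tensorWeight lam, weightPart_tensorWeight lam⟩⟩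

theorem tensorAlgHom_id : tensorAlgHom (fun i => AlgHom.id k (H i)) = AlgHom.id k (⨂[k] i, H i) :=
  PiTensorProduct.algHom_ext fun i => AlgHom.ext fun h => by
    simp only [AlgHom.comp_apply, PiTensorProduct.singleAlgHom_apply, tensorAlgHom_tprod,
      AlgHom.id_apply]

/-! ### Weights of a tensor product of modules -/

section Modules

variable {f : ∀ i, H i →ₐ[k] A i} {M : ∀ i, AlgModule k (SkewMonoidAlgebra (A i) (Γ i))}

theorem tmk_mem_weightSpace {lam : ∀ i, H i →ₐ[k] k} {m : ∀ i, M i}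
    (hm : ∀ i, m i ∈ weightSpace ((inclAlg k (A i) (Γ i)).comp (f i)) (M i) (lam i)) :
    tmk M m ∈ weightSpace ((inclAlg k (⨂[k] i, A i) (∀ i, Γ i)).comp (tensorAlgHom f))
      (tensorModule M) (tensorWeight lam) := fun h => by
  induction h using PiTensorProduct.induction_on with
  | smul_tprod c h =>
    rw [map_smul, map_smul, smul_assoc, smul_assoc, tensorWeight_tprod, AlgHom.comp_apply,
      tensorAlgHom_tprod, inclAlg_smul_tmk, ← MultilinearMap.map_smul_univ]
    congr 2
    funext i
    exact hm i (h i)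
  | add x y hx hy => rw [map_add, map_add, add_smul, add_smul, hx, hy]

theorem tensorModule_semisimple
    (hM : ∀ i, IsWeightSemisimple ((inclAlg k (A i) (Γ i)).comp (f i)) (M i)) :
    IsWeightSemisimple ((inclAlg k (⨂[k] i, A i) (∀ i, Γ i)).comp (tensorAlgHom f))
      (tensorModule M) := by
  choose κ b wt hb using fun i => (hM i).exists_basis
  exact isWeightSemisimple_of_basis (tensorBasis b) fun p => by
    rw [tensorBasis_apply]
    exact tmk_mem_weightSpace fun i => hb i (p i)

/-- A tensor product of weight bases is a weight basis, and a basis tensor has weight `mu` exactly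
when each factor has the corresponding component. Stating this through index types yields both
finiteness and the product formula for dimensions. -/
theorem tensorModule_weightSpace
    (hM : ∀ i, IsWeightSemisimple ((inclAlg k (A i) (Γ i)).comp (f i)) (M i))
    (mu : (⨂[k] i, H i) →ₐ[k] k) :
    ∃ κ : Fin n → Type u,
      (∀ i, Nonempty (Module.Basis (κ i) k
        (weightSpace ((inclAlg k (A i) (Γ i)).comp (f i)) (M i) (weightPart mu i)))) ∧
      Nonempty (Module.Basis (∀ i, κ i) k
        (weightSpace ((inclAlg k (⨂[k] i, A i) (∀ i, Γ i)).comp (tensorAlgHom f))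
          (tensorModule M) mu)) := by
  choose κ b wt hb using fun i => (hM i).exists_basis
  refine ⟨fun i => {j // wt i j = weightPart mu i},
    fun i => ⟨weightSpaceBasis (b i) (hb i) _⟩, ?_⟩
  have h := weightSpaceBasis (tensorBasis b) (wt := fun p => tensorWeight fun i => wt i (p i))
    (fun p => by
      rw [tensorBasis_apply]
      exact tmk_mem_weightSpace (f := f) fun i => hb i (p i)) mu
  exact ⟨h.reindex ((Equiv.subtypeEquivRight fun p => tensorWeight_eq_iff).trans
    (Equiv.subtypePiEquivPi (p := fun i j => wt i j = weightPart mu i)))⟩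

theorem character_tensorModule
    (hM : ∀ i, IsWeightSemisimple ((inclAlg k (A i) (Γ i)).comp (f i)) (M i))
    (mu : (⨂[k] i, H i) →ₐ[k] k) :
    character (A := ⨂[k] i, A i) (Γ := ∀ i, Γ i) (tensorAlgHom f) (tensorModule M) mu =
      ∏ i, character (f i) (M i) (weightPart mu i) := by
  obtain ⟨κ, h1, ⟨b⟩⟩ := tensorModule_weightSpace hM mu
  rw [character, Module.finrank_eq_nat_card_basis b, Nat.card_pi]
  exact Finset.prod_congr rfl fun i _ => (Module.finrank_eq_nat_card_basis (h1 i).some).symm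

/-- For a pure tensor, the image of `⨂ Fᵢ` contains its `B₊`-orbit if each `Fᵢ` contains the orbit
of the `i`-th factor. -/
theorem locallyFinite_tensorModule {B : ∀ i, Subalgebra k (A i)}
    (hM : ∀ i (m : M i), m ∈ locallyFinitePart (B i) (M i)) (t : tensorModule M) :
    t ∈ locallyFinitePart (A := ⨂[k] i, A i) (Γ := ∀ i, Γ i) (tensorSubalgebra B)
      (tensorModule M) := by
  refine tensorModule_mem (fun m => ?_) t
  choose F hF hm using fun i => hM i (m i)
  refine ⟨LinearMap.range (PiTensorProduct.lift ((tmk M).compLinearMap fun i => (F i).subtype)),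
    inferInstance, ?_⟩
  suffices ∀ b : ⨂[k] i, B i, inclAlg k (⨂[k] i, A i) (∀ i, Γ i)
      (tensorAlgHom (fun i => (B i).val) b) • tmk M m ∈ LinearMap.range (PiTensorProduct.lift
        ((tmk M).compLinearMap fun i => (F i).subtype)) by
    rintro _ ⟨b, rfl⟩
    exact this b
  intro b
  induction b using PiTensorProduct.induction_on with
  | smul_tprod c b =>
    rw [map_smul, map_smul, smul_assoc]
    refine Submodule.smul_mem _ _ ?_
    refine ⟨PiTensorProduct.tprod k fun i => ⟨inclAlg k (A i) (Γ i) (b i) • m i,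
      hm i _ (b i).2⟩, ?_⟩
    rw [PiTensorProduct.lift.tprod]
    rw [tensorAlgHom_tprod]
    exact (inclAlg_smul_tmk (fun i => (b i : A i)) m).symm
  | add x y hx hy =>
    rw [map_add, map_add, add_smul]
    exact Submodule.add_mem _ hx hy

/-- A tensor product of simple objects of the categories `𝒪ᵢ` with scalar endomorphisms only is a
simple object of `𝒪`. -/
theorem isSimpleInO_tensorModule {B : ∀ i, Subalgebra k (A i)}
    (hM : ∀ i, IsSimpleInO (f i) (B i) (M i))
    (hend : ∀ i, ∀ φ : M i →ₗ[SkewMonoidAlgebra (A i) (Γ i)] M i, ∃ c : k, ∀ e, φ e = c • e) :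
    IsSimpleInO (A := ⨂[k] i, A i) (Γ := ∀ i, Γ i) (tensorAlgHom f) (tensorSubalgebra B)
      (tensorModule M) := by
  have hs := tensorModule_simple (fun i => (hM i).2) hend
  refine ⟨⟨inferInstance, tensorModule_semisimple fun i => (hM i).1.semisimple, fun lam => ?_,
    fun m => finiteDimensional_span_iff.2 (locallyFinite_tensorModule
      (fun i m => finiteDimensional_span_iff.1 ((hM i).1.locallyFinite m)) m)⟩, hs⟩
  obtain ⟨κ, h1, ⟨b⟩⟩ := tensorModule_weightSpace (fun i => (hM i).1.semisimple) lam
  have : ∀ i, Finite (κ i) := fun i => by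
    have := (hM i).1.finite_weightSpace (weightPart lam i)
    exact Module.Finite.finite_basis (h1 i).some
  exact Module.Finite.of_basis b

end Modules

variable [∀ i, MulSemiringAction (Γ i) (H i)] [∀ i, SMulCommClass (Γ i) k (H i)]

theorem isSimpleWeightModule_tensorModule {E : ∀ i, AlgModule k (SkewMonoidAlgebra (H i) (Γ i))}
    (hE : ∀ i, IsSimpleWeightModule k (H i) (Γ i) (E i))
    (hk : ∀ i, Subsingleton (Γ i) ∨ IsAlgClosed k) :
    IsSimpleWeightModule k (⨂[k] i, H i) (∀ i, Γ i) (tensorModule E) where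
  simple := tensorModule_simple (fun i => (hE i).simple) fun i => (hE i).exists_scalar (hk i)
  finite := by
    have := fun i => (hE i).finite
    exact Module.Finite.equiv (tensorModuleEquiv E)
  semisimple := by
    have := tensorModule_semisimple (f := fun i => AlgHom.id k (H i)) (M := E)
      fun i => (hE i).semisimple
    rwa [tensorAlgHom_id] at this

/-! ### Tensor products of singular maps -/

section Singular

variable {f : ∀ i, H i →ₐ[k] A i} {B : ∀ i, Subalgebra k (A i)} {N : ∀ i, Submodule k (A i)}
  {E : ∀ i, AlgModule k (SkewMonoidAlgebra (H i) (Γ i))}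
  {M : ∀ i, AlgModule k (SkewMonoidAlgebra (A i) (Γ i))}

/-- The tensor product of linear maps `Eᵢ → Mᵢ`. -/
def tensorMap (ψ : ∀ i, E i →ₗ[k] M i) : tensorModule E →ₗ[k] tensorModule M :=
  PiTensorProduct.lift ((tmk M).compLinearMap ψ)

theorem tensorMap_tmk (ψ : ∀ i, E i →ₗ[k] M i) (e : ∀ i, E i) :
    tensorMap ψ (tmk E e) = tmk M fun i => ψ i (e i) := PiTensorProduct.lift.tprod e

theorem tensorMap_ne_zero {ψ : ∀ i, E i →ₗ[k] M i} (h : ∀ i, ψ i ≠ 0) : tensorMap ψ ≠ 0 := by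
  have h' : ∀ i, ∃ e, ψ i e ≠ 0 := fun i => by
    by_contra! hc
    exact h i (LinearMap.ext hc)
  choose e he using h'
  intro h0
  apply tmk_ne_zero he
  rw [← tensorMap_tmk, h0, LinearMap.zero_apply]

theorem isSingularMap_tensorMap {ψ : ∀ i, E i →ₗ[k] M i}
    (hψ : ∀ i, IsSingularMap (f i) (N i) (ψ i)) :
    IsSingularMap (A := ⨂[k] i, A i) (Γ := ∀ i, Γ i) (tensorAlgHom f) (tensorAugmentation B N)
      (E := tensorModule E) (M := tensorModule M) (tensorMap ψ) where
  map_H h t := by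
    induction h using PiTensorProduct.induction_on with
    | smul_tprod c h =>
      have : tensorMap ψ ∘ₗ Algebra.lsmul k k _ (inclAlg k (⨂[k] i, H i) (∀ i, Γ i)
            (PiTensorProduct.tprod k h)) =
          Algebra.lsmul k k _ (inclAlg k (⨂[k] i, A i) (∀ i, Γ i)
            (tensorAlgHom f (PiTensorProduct.tprod k h))) ∘ₗ tensorMap ψ :=
        tensorModule_hom_ext fun e => by
          simp only [LinearMap.comp_apply, Algebra.lsmul_coe]
          rw [inclAlg_smul_tmk, tensorMap_tmk, tensorMap_tmk, tensorAlgHom_tprod,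
            inclAlg_smul_tmk]
          simp only [(hψ _).map_H]
      have := LinearMap.congr_fun this t
      simp only [LinearMap.comp_apply, Algebra.lsmul_coe] at this
      rw [map_smul (inclAlg k (⨂[k] i, H i) (∀ i, Γ i)), map_smul (tensorAlgHom f),
        map_smul (inclAlg k (⨂[k] i, A i) (∀ i, Γ i)), smul_assoc, smul_assoc,
        (tensorMap ψ).map_smul, this]
    | add x y hx hy => rw [map_add, map_add, map_add, add_smul, add_smul, map_add, hx, hy]
  map_group γ t := by
    have : tensorMap ψ ∘ₗ Algebra.lsmul k k _ (SkewMonoidAlgebra.of (⨂[k] i, H i) (∀ i, Γ i) γ) =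
        Algebra.lsmul k k _ (SkewMonoidAlgebra.of (⨂[k] i, A i) (∀ i, Γ i) γ) ∘ₗ tensorMap ψ :=
      tensorModule_hom_ext fun e => by
        simp only [LinearMap.comp_apply, Algebra.lsmul_coe]
        rw [of_smul_tmk, tensorMap_tmk, tensorMap_tmk, of_smul_tmk]
        simp only [(hψ _).map_group]
    exact LinearMap.congr_fun this t
  map_Np a ha t := by
    induction ha using Submodule.span_induction with
    | mem a ha =>
      obtain ⟨b, -, ⟨i, hi⟩, rfl⟩ := ha
      have : Algebra.lsmul k k _ (inclAlg k (⨂[k] i, A i) (∀ i, Γ i)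
            (PiTensorProduct.tprod k b)) ∘ₗ tensorMap ψ = 0 :=
        tensorModule_hom_ext fun e => by
          simp only [LinearMap.comp_apply, Algebra.lsmul_coe, LinearMap.zero_apply]
          rw [tensorMap_tmk, inclAlg_smul_tmk]
          exact (tmk M).map_coord_zero i ((hψ i).map_Np _ hi _)
      exact LinearMap.congr_fun this t
    | zero => rw [map_zero, zero_smul]
    | add x y _ _ hx hy => rw [map_add, add_smul, hx, hy, add_zero]
    | smul c x _ hx => rw [map_smul, smul_assoc, hx, smul_zero]

end Singular

end Tensor

/-- The slots are expanded one at a time: those in `s` range over spans, the others over the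
spanning sets. -/
theorem multilinearMap_mem_of_span {k ι V : Type*} [Field k] [Fintype ι] [DecidableEq ι]
    {X : ι → Type*} [∀ i, AddCommGroup (X i)] [∀ i, Module k (X i)] [AddCommGroup V] [Module k V]
    (g : MultilinearMap k X V) {S : ∀ i, Set (X i)} {W : Submodule k V}
    (hW : ∀ s : ∀ i, X i, (∀ i, s i ∈ S i) → g s ∈ W) {m : ∀ i, X i}
    (hm : ∀ i, m i ∈ Submodule.span k (S i)) : g m ∈ W := by
  have key : ∀ (s : Finset ι) (m : ∀ i, X i), (∀ i ∈ s, m i ∈ Submodule.span k (S i)) →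
      (∀ i ∉ s, m i ∈ S i) → g m ∈ W := by
    intro s
    induction s using Finset.induction_on with
    | empty => exact fun m _ h => hW m fun i => h i (by simp)
    | insert j s hj ih =>
      intro m h1 h2
      have h3 : Submodule.span k (S j) ≤ W.comap (g.toLinearMap m j) :=
        Submodule.span_le.2 fun x hx => ih _
          (fun i hi => by
            rw [Function.update_of_ne (ne_of_mem_of_not_mem hi hj)]
            exact h1 i (Finset.mem_insert_of_mem hi))
          (fun i hi => by
            by_cases hij : i = j
            · subst hij; rwa [Function.update_self]
            · rw [Function.update_of_ne hij]
              exact h2 i fun h => (Finset.mem_insert.1 h).elim hij hi)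
      have h4 := h3 (h1 j (Finset.mem_insert_self j s))
      rwa [Submodule.mem_comap, MultilinearMap.toLinearMap_apply, Function.update_eq_self] at h4
  exact key Finset.univ m (fun i _ => hm i) (by simp)

section Tensor

variable {k : Type u} [Field k] {n : ℕ} {A H Γ : Fin n → Type u} [∀ i, Ring (A i)]
  [∀ i, Algebra k (A i)] [∀ i, Ring (H i)] [∀ i, Algebra k (H i)] [∀ i, Group (Γ i)]
  [∀ i, MulSemiringAction (Γ i) (A i)] [∀ i, SMulCommClass (Γ i) k (A i)]

/-! ### Heights on the weights of a tensor product -/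

/-- The sum of the heights of the components. -/
def tensorHeight (T : ∀ i, ℤ → (H i →ₐ[k] k) → (H i →ₐ[k] k) → Prop) (d : ℤ)
    (lam mu : (⨂[k] i, H i) →ₐ[k] k) : Prop :=
  ∃ e : Fin n → ℤ, ∑ i, e i = d ∧ ∀ i, T i (e i) (weightPart lam i) (weightPart mu i)

theorem tprod_piecewise_insert (a : ∀ i, A i) {j : Fin n} {s : Finset (Fin n)} (hj : j ∉ s) :
    PiTensorProduct.tprod k ((insert j s).piecewise a 1) =
      PiTensorProduct.singleAlgHom (R := k) (A := A) j (a j) *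
        PiTensorProduct.tprod k (s.piecewise a 1) := by
  rw [PiTensorProduct.singleAlgHom_apply, PiTensorProduct.tprod_mul_tprod]
  congr 1
  funext i
  by_cases hi : i = j
  · subst hi; simp [hj]
  · simp [hi, Finset.piecewise]

section Shift

variable {f : ∀ i, H i →ₐ[k] A i}

theorem tensorAlgHom_singleAlgHom (i : Fin n) (h : H i) :
    tensorAlgHom f (PiTensorProduct.singleAlgHom (R := k) (A := H) i h) =
      PiTensorProduct.singleAlgHom (R := k) (A := A) i (f i h) := by
  rw [PiTensorProduct.singleAlgHom_apply, PiTensorProduct.singleAlgHom_apply, tensorAlgHom_tprod]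
  congr 1
  funext j
  exact Pi.apply_mulSingle (fun i => f i) (fun i => map_one _) i h j

variable {V : AlgModule k (SkewMonoidAlgebra (⨂[k] i, A i) (∀ i, Γ i))}

/-- The algebra `⨂ Hᵢ` is generated by its factors, so a weight can be tested on each factor
separately. -/
theorem mem_weightSpace_of_parts {lam : (⨂[k] i, H i) →ₐ[k] k} {m : V}
    (hm : ∀ i, (show V.pull (skewSingle k A Γ i) from m) ∈
      weightSpace ((inclAlg k (A i) (Γ i)).comp (f i)) (V.pull (skewSingle k A Γ i))
        (weightPart lam i)) :
    m ∈ weightSpace ((inclAlg k (⨂[k] i, A i) (∀ i, Γ i)).comp (tensorAlgHom f)) V lam := by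
  have hm' : ∀ i h, inclAlg k (⨂[k] i, A i) (∀ i, Γ i) (tensorAlgHom f
      (PiTensorProduct.singleAlgHom (R := k) (A := H) i h)) • m = lam
      (PiTensorProduct.singleAlgHom (R := k) (A := H) i h) • m := fun i h => by
    rw [tensorAlgHom_singleAlgHom, ← skewSingle_inclAlg]
    exact hm i h
  intro h
  induction h using PiTensorProduct.induction_on with
  | smul_tprod c h =>
    have key : ∀ s : Finset (Fin n), inclAlg k (⨂[k] i, A i) (∀ i, Γ i) (tensorAlgHom f
        (PiTensorProduct.tprod k (s.piecewise h 1))) • m =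
        lam (PiTensorProduct.tprod k (s.piecewise h 1)) • m := by
      intro s
      induction s using Finset.induction_on with
      | empty =>
        rw [Finset.piecewise_empty]
        change inclAlg k (⨂[k] i, A i) (∀ i, Γ i) (tensorAlgHom f 1) • m = lam 1 • m
        rw [map_one, map_one, map_one, one_smul, one_smul]
      | insert j s hj ih =>
        rw [tprod_piecewise_insert _ hj, map_mul, map_mul, map_mul, mul_smul, ih,
          smul_comm_of_algebra, hm', smul_smul, mul_comm]
    have := key Finset.univ
    rw [Finset.piecewise_univ] at this
    rw [map_smul, map_smul, smul_assoc, smul_assoc, AlgHom.comp_apply, this]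
  | add x y hx hy => rw [map_add, map_add, add_smul, add_smul, hx, hy]

theorem mem_weightSpace_part {lam : (⨂[k] i, H i) →ₐ[k] k} {m : V}
    (hm : m ∈ weightSpace ((inclAlg k (⨂[k] i, A i) (∀ i, Γ i)).comp (tensorAlgHom f)) V lam)
    (i : Fin n) : (show V.pull (skewSingle k A Γ i) from m) ∈
      weightSpace ((inclAlg k (A i) (Γ i)).comp (f i)) (V.pull (skewSingle k A Γ i))
        (weightPart lam i) := fun h => by
  change skewSingle k A Γ i (inclAlg k (A i) (Γ i) (f i h)) • m = _
  rw [skewSingle_inclAlg, ← tensorAlgHom_singleAlgHom]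
  exact hm _

variable {T : ∀ i, ℤ → (H i →ₐ[k] k) → (H i →ₐ[k] k) → Prop}

/-- The entries are applied one at a time. The `j`-th moves only the `j`-th component of the weight,
because it commutes with the other factors, and the heights add up. -/
theorem shift_tprod {d : Fin n → ℤ} {a : ∀ i, A i}
    (ha : ∀ i, Shift (Γ i) (f i) (T i) (d i) (a i)) :
    Shift (∀ i, Γ i) (tensorAlgHom f) (tensorHeight T) (∑ i, d i) (PiTensorProduct.tprod k a) := by
  intro V lam m hm
  have key : ∀ s : Finset (Fin n), ∃ mu : (⨂[k] i, H i) →ₐ[k] k,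
      (∀ i ∈ s, T i (d i) (weightPart lam i) (weightPart mu i)) ∧
      (∀ i ∉ s, weightPart mu i = weightPart lam i) ∧
      inclAlg k (⨂[k] i, A i) (∀ i, Γ i) (PiTensorProduct.tprod k (s.piecewise a 1)) • m ∈
        weightSpace ((inclAlg k (⨂[k] i, A i) (∀ i, Γ i)).comp (tensorAlgHom f)) V mu := by
    intro s
    induction s using Finset.induction_on with
    | empty =>
      refine ⟨lam, by simp, fun _ _ => rfl, ?_⟩
      rw [Finset.piecewise_empty]
      change inclAlg k (⨂[k] i, A i) (∀ i, Γ i) 1 • m ∈ _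
      rwa [map_one, one_smul]
    | insert j s hj ih =>
      obtain ⟨mu, h1, h2, h3⟩ := ih
      set x := inclAlg k (⨂[k] i, A i) (∀ i, Γ i) (PiTensorProduct.tprod k (s.piecewise a 1)) • m
      obtain ⟨nu, h4, h5⟩ := ha j (V.pull (skewSingle k A Γ j)) _ _ (mem_weightSpace_part h3 j)
      have hpart := weightPart_tensorWeight (Function.update (weightPart mu) j nu)
      refine ⟨tensorWeight (Function.update (weightPart mu) j nu), fun i hi => ?_, fun i hi => ?_,
        mem_weightSpace_of_parts fun i => ?_⟩
      · rw [hpart]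
        rcases Finset.mem_insert.1 hi with rfl | hi
        · rw [Function.update_self, ← h2 i hj]; exact h4
        · rw [Function.update_of_ne (ne_of_mem_of_not_mem hi hj)]; exact h1 i hi
      · rw [Finset.mem_insert, not_or] at hi
        rw [hpart, Function.update_of_ne hi.1, h2 i hi.2]
      · rw [hpart, tprod_piecewise_insert _ hj, map_mul, mul_smul, ← skewSingle_inclAlg]
        by_cases hij : i = j
        · subst hij
          rw [Function.update_self]
          exact h5
        · rw [Function.update_of_ne hij]
          intro h
          have h6 := mem_weightSpace_part h3 i h
          change skewSingle k A Γ i (inclAlg k (A i) (Γ i) (f i h)) •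
            skewSingle k A Γ j (inclAlg k (A j) (Γ j) (a j)) • x = weightPart mu i h •
            skewSingle k A Γ j (inclAlg k (A j) (Γ j) (a j)) • x
          change skewSingle k A Γ i (inclAlg k (A i) (Γ i) (f i h)) • x =
            weightPart mu i h • x at h6
          rw [← mul_smul, (commute_skewSingle hij _ _).eq, mul_smul, h6, smul_comm_of_algebra]
  obtain ⟨mu, h1, -, h3⟩ := key Finset.univ
  rw [Finset.piecewise_univ] at h3
  exact ⟨mu, ⟨d, rfl, fun i => h1 i (Finset.mem_univ i)⟩, h3⟩

theorem shift_one {A H Γ : Type u} [Ring A] [Algebra k A] [Ring H] [Algebra k H] [Group Γ]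
    [MulSemiringAction Γ A] [SMulCommClass Γ k A] {f : H →ₐ[k] A}
    {T : ℤ → (H →ₐ[k] k) → (H →ₐ[k] k) → Prop} (hT : ∀ lam, T 0 lam lam) : Shift Γ f T 0 1 :=
  fun M lam m hm => ⟨lam, hT lam, by rwa [map_one, one_smul]⟩

end Shift

/-! ### Tensor products of triangular decompositions -/

variable [∀ i, MulSemiringAction (Γ i) (H i)] [∀ i, SMulCommClass (Γ i) k (H i)]

theorem weightPart_dualAct (γ : ∀ i, Γ i) (lam : (⨂[k] i, H i) →ₐ[k] k) (i : Fin n) :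
    weightPart (dualAct γ lam) i = dualAct (γ i) (weightPart lam i) := by
  refine AlgHom.ext fun h => ?_
  rw [dualAct_apply]
  simp only [weightPart, AlgHom.comp_apply]
  rw [dualAct_apply, PiTensorProduct.singleAlgHom_apply, PiTensorProduct.singleAlgHom_apply,
    tensorAction_tprod]
  congr 2
  funext j
  by_cases hj : j = i
  · subst hj; simp
  · simp [hj]

theorem isHeight_tensorHeight {T : ∀ i, ℤ → (H i →ₐ[k] k) → (H i →ₐ[k] k) → Prop}
    (hT : ∀ i, IsHeight (Γ i) (T i)) : IsHeight (∀ i, Γ i) (tensorHeight T) where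
  refl lam := ⟨0, by simp, fun i => (hT i).refl _⟩
  symm := fun ⟨e, he, h⟩ => ⟨-e, by simp [← he], fun i => (hT i).symm (h i)⟩
  trans := fun ⟨e, he, h⟩ ⟨e', he', h'⟩ => ⟨e + e', by simp [← he, ← he', Finset.sum_add_distrib],
    fun i => (hT i).trans (h i) (h' i)⟩
  unique := fun ⟨e, he, h⟩ ⟨e', he', h'⟩ => by
    rw [← he, ← he']
    exact Finset.sum_congr rfl fun i _ => (hT i).unique (h i) (h' i)
  smul γ _ _ _ := fun ⟨e, he, h⟩ => ⟨e, he, fun i => by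
    rw [weightPart_dualAct, weightPart_dualAct]
    exact (hT i).smul (γ i) (h i)⟩

theorem IsTriangular.smul_Bp {A H Γ : Type u} [Ring A] [Algebra k A] [Ring H] [Algebra k H]
    [Group Γ] [MulSemiringAction Γ A] [SMulCommClass Γ k A] [MulSemiringAction Γ H]
    [SMulCommClass Γ k H] {T : ℤ → (H →ₐ[k] k) → (H →ₐ[k] k) → Prop} {f : H →ₐ[k] A}
    {Bp : Subalgebra k A} {Np : Submodule k A} (hT : IsTriangular Γ T f Bp Np) (γ : Γ) {b : A}
    (hb : b ∈ Bp) : γ • b ∈ Bp := by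
  obtain ⟨x, hx, y, hy, rfl⟩ := Submodule.mem_sup.1 (hT.Bp_le_sup hb)
  obtain ⟨c, rfl⟩ := Submodule.mem_span_singleton.1 hx
  rw [smul_add, smul_comm, smul_one]
  exact Bp.add_mem (Bp.smul_mem Bp.one_mem c) (hT.Np_le (hT.smul_Np γ y hy))

/-- Each property is checked on pure tensors of homogeneous elements. Raising or lowering entries
combined with identities never cancel in height, since all have heights of the same sign. -/
theorem IsTriangular.tensor {T : ∀ i, ℤ → (H i →ₐ[k] k) → (H i →ₐ[k] k) → Prop}
    {f : ∀ i, H i →ₐ[k] A i} {B : ∀ i, Subalgebra k (A i)} {N : ∀ i, Submodule k (A i)}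
    (hT : ∀ i, IsTriangular (Γ i) (T i) (f i) (B i) (N i)) :
    IsTriangular (∀ i, Γ i) (tensorHeight T) (tensorAlgHom f) (tensorSubalgebra B)
      (tensorAugmentation B N) where
  toIsHeight := isHeight_tensorHeight fun i => (hT i).toIsHeight
  equivariant γ h := by
    induction h using PiTensorProduct.induction_on with
    | smul_tprod c h =>
      rw [smul_comm γ c, map_smul (tensorAlgHom f), map_smul (tensorAlgHom f), smul_comm γ c, tensorAction_tprod, tensorAlgHom_tprod,
        tensorAlgHom_tprod, tensorAction_tprod]
      simp only [(hT _).equivariant]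
    | add x y hx hy => rw [smul_add, map_add, map_add, smul_add, hx, hy]
  Np_le := Submodule.span_le.2 (by
    rintro _ ⟨b, hb, -, rfl⟩
    exact ⟨PiTensorProduct.tprod k fun i => ⟨b i, hb i⟩, tensorAlgHom_tprod _ _⟩)
  smul_Np γ a ha := by
    induction ha using Submodule.span_induction with
    | mem a ha =>
      obtain ⟨b, hb, ⟨i, hi⟩, rfl⟩ := ha
      rw [tensorAction_tprod]
      exact Submodule.subset_span ⟨_, fun i => (hT i).smul_Bp (γ i) (hb i),
        ⟨i, (hT i).smul_Np _ _ hi⟩, rfl⟩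
    | zero => rw [smul_zero]; exact Submodule.zero_mem _
    | add x y _ _ hx hy => rw [smul_add]; exact Submodule.add_mem _ hx hy
    | smul c x _ hx => rw [smul_comm]; exact Submodule.smul_mem _ _ hx
  Np_le_span := Submodule.span_le.2 (by
    rintro _ ⟨b, hb, ⟨j, hj⟩, rfl⟩
    -- Slot `j` must have positive height and the others only nonnegative height, which suffices for
    -- a positive sum.
    refine multilinearMap_mem_of_span (PiTensorProduct.tprod k)
      (S := fun i => {c | c ∈ B i ∧ (i = j → c ∈ N i) ∧
        ∃ d ≥ 0, (i = j → d > 0) ∧ Shift (Γ i) (f i) (T i) d c}) (fun s hs => ?_) fun i => ?_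
    · choose h1 h2 d h3 h4 h5 using hs
      exact Submodule.subset_span ⟨Submodule.subset_span ⟨s, h1, ⟨j, h2 j rfl⟩, rfl⟩,
        ∑ i, d i, Finset.sum_pos' (fun i _ => h3 i) ⟨j, Finset.mem_univ j, h4 j rfl⟩,
        shift_tprod h5⟩
    · have h1 : ∀ c ∈ N i, c ∈ Submodule.span k {c | c ∈ B i ∧ (i = j → c ∈ N i) ∧
          ∃ d ≥ 0, (i = j → d > 0) ∧ Shift (Γ i) (f i) (T i) d c} := fun c hc =>
        Submodule.span_mono (s := {n | n ∈ N i ∧ ∃ d > 0, Shift (Γ i) (f i) (T i) d n})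
          (by
            rintro c ⟨hc, d, hd, hs⟩
            exact ⟨(hT i).Np_le hc, fun _ => hc, d, hd.le, fun _ => hd, hs⟩)
          ((hT i).Np_le_span hc)
      by_cases hij : i = j
      · subst hij; exact h1 _ hj
      · obtain ⟨x, hx, y, hy, h⟩ := Submodule.mem_sup.1 ((hT i).Bp_le_sup (hb i))
        rw [← h]
        refine Submodule.add_mem _ (Submodule.span_mono ?_ hx) (h1 y hy)
        rintro _ rfl
        exact ⟨(B i).one_mem, fun h => absurd h hij, 0, le_rfl, fun h => absurd h hij,
          shift_one (hT i).refl⟩)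
  Bp_le_sup := by
    suffices ∀ b : ⨂[k] i, B i, tensorAlgHom (fun i => (B i).val) b ∈
        Submodule.span k {1} ⊔ tensorAugmentation B N by
      rintro _ ⟨b, rfl⟩
      exact this b
    intro b
    induction b using PiTensorProduct.induction_on with
    | smul_tprod c b =>
      rw [map_smul, tensorAlgHom_tprod]
      refine Submodule.smul_mem _ _ (multilinearMap_mem_of_span (PiTensorProduct.tprod k)
        (S := fun i => {c | c = 1 ∨ c ∈ N i}) (fun s hs => ?_) fun i => ?_)
      · by_cases h : ∃ i, s i ∈ N i
        · refine Submodule.mem_sup_right (Submodule.subset_span ⟨s, fun i => ?_, h, rfl⟩)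
          rcases hs i with hi | hi
          · rw [hi]; exact (B i).one_mem
          · exact (hT i).Np_le hi
        · push Not at h
          have : s = 1 := funext fun i => (hs i).resolve_right (h i)
          subst this
          exact Submodule.mem_sup_left (Submodule.mem_span_singleton_self 1)
      · have := (hT i).Bp_le_sup (b i).2
        refine (sup_le (Submodule.span_mono ?_) fun c hc => Submodule.subset_span (Or.inr hc) :
          _ ≤ Submodule.span k {c | c = 1 ∨ c ∈ N i}) this
        rintro _ rfl
        exact Or.inl rfl
    | add x y hx hy => rw [map_add]; exact Submodule.add_mem _ hx hy
  span_lower := by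
    rw [eq_top_iff, ← PiTensorProduct.span_tprod_eq_top, Submodule.span_le]
    rintro _ ⟨a, rfl⟩
    refine multilinearMap_mem_of_span (PiTensorProduct.tprod k) (fun s hs => ?_) fun i => by
      rw [(hT i).span_lower]; exact Submodule.mem_top
    choose b h c hs hb hc using hs
    refine Submodule.subset_span ⟨PiTensorProduct.tprod k b, PiTensorProduct.tprod k h,
      PiTensorProduct.tprod k c, ?_, ?_, ?_⟩
    · rw [tensorAlgHom_tprod, PiTensorProduct.tprod_mul_tprod, PiTensorProduct.tprod_mul_tprod]
      congr 1
      exact funext hs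
    -- Entries equal to 1 have height 0 and the others are strictly lowering; one of the latter
    -- makes the sum negative.
    · by_cases hb1 : b = 1
      · exact Or.inl (by rw [hb1]; rfl)
      · obtain ⟨j, hj⟩ := Function.ne_iff.1 hb1
        have : ∀ i, ∃ d ≤ 0, (b i ≠ 1 → d < 0) ∧ Shift (Γ i) (f i) (T i) d (b i) := fun i => by
          by_cases hi : b i = 1
          · exact ⟨0, le_rfl, fun h => absurd hi h, by rw [hi]; exact shift_one (hT i).refl⟩
          · obtain ⟨d, hd, hs⟩ := (hb i).resolve_left hi
            exact ⟨d, hd.le, fun _ => hd, hs⟩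
        choose d h1 h2 h3 using this
        exact Or.inr ⟨∑ i, d i, Finset.sum_neg' (fun i _ => h1 i)
          ⟨j, Finset.mem_univ j, h2 j hj⟩, shift_tprod h3⟩
    · by_cases hc1 : ∃ i, c i ∈ N i
      · refine Or.inr (Submodule.subset_span ⟨c, fun i => ?_, hc1, rfl⟩)
        rcases hc i with hi | hi
        · rw [hi]; exact (B i).one_mem
        · exact (hT i).Np_le hi
      · push Not at hc1
        have : c = 1 := funext fun i => (hc i).resolve_right (hc1 i)
        exact Or.inl (by rw [this]; rfl)
  exists_proj := by
    choose p h1 h2 h3 using fun i => (hT i).exists_proj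
    have htp : ∀ a, PiTensorProduct.map p (PiTensorProduct.tprod k a) =
      PiTensorProduct.tprod k fun i => p i (a i) := fun a => PiTensorProduct.map_tprod p a
    refine ⟨PiTensorProduct.map p, ?_, fun a h => ?_, fun a t ht => ?_⟩
    · change PiTensorProduct.map p (PiTensorProduct.tprod k 1) = PiTensorProduct.tprod k 1
      rw [htp]
      congr 1
      exact funext h1
    · induction a using PiTensorProduct.induction_on with
      | smul_tprod c a =>
        induction h using PiTensorProduct.induction_on with
        | smul_tprod c' h =>
          rw [map_smul, map_smul, smul_mul_smul_comm, smul_mul_smul_comm, map_smul,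
            tensorAlgHom_tprod, PiTensorProduct.tprod_mul_tprod, htp, htp,
            PiTensorProduct.tprod_mul_tprod]
          congr 2
          exact funext fun i => h2 i _ _
        | add x y hx hy => rw [map_add, mul_add, map_add, hx, hy, mul_add]
      | add x y hx hy => rw [add_mul, map_add, map_add, hx, hy, add_mul]
    · induction ht using Submodule.span_induction with
      | mem t ht =>
        obtain ⟨b, -, ⟨i, hi⟩, rfl⟩ := ht
        induction a using PiTensorProduct.induction_on with
        | smul_tprod c a =>
          rw [smul_mul_assoc, map_smul, PiTensorProduct.tprod_mul_tprod, htp,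
            (PiTensorProduct.tprod k).map_coord_zero i (h3 i _ _ hi), smul_zero]
        | add x y hx hy => rw [add_mul, map_add, hx, hy, add_zero]
      | zero => rw [mul_zero, map_zero]
      | add x y _ _ hx hy => rw [mul_add, map_add, hx, hy, add_zero]
      | smul c x _ hx => rw [mul_smul_comm, map_smul, hx, smul_zero]

end Tensor

/-! ### Regular triangular algebras -/

section RTA

variable {k A : Type u} [Field k] [Ring A] [Algebra k A]

namespace RTA

variable (S : RTA k A)

theorem act_injective {θ θ' : S.P} {lam : S.H →ₐ[k] k} (h : S.act θ lam = S.act θ' lam) :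
    θ = θ' := by
  have : S.act (θ'⁻¹ * θ) lam = lam := by
    rw [map_mul, Equiv.Perm.mul_apply, h, ← Equiv.Perm.mul_apply, ← map_mul, inv_mul_cancel,
      map_one, Equiv.Perm.one_apply]
  exact (inv_mul_eq_one.1 (S.act_free _ _ this)).symm

theorem act₀_injective {a b : S.P₀} {lam : S.H₀ →ₐ[k] k}
    (h : S.act₀ (Multiplicative.ofAdd a) lam = S.act₀ (Multiplicative.ofAdd b) lam) : a = b := by
  have : S.act₀ (Multiplicative.ofAdd (-b + a)) lam = lam := by
    rw [ofAdd_add, map_mul, Equiv.Perm.mul_apply, h, ← Equiv.Perm.mul_apply, ← map_mul,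
      ← ofAdd_add, neg_add_cancel, ofAdd_zero, map_one, Equiv.Perm.one_apply]
  exact (neg_add_eq_zero.1 (S.act₀_free _ _ this)).symm

/-- Multiplicativity of the map from `P` to `P₀` is forced by freeness of the action on restricted
weights. -/
theorem proj_mul (θ θ' : S.P) : S.proj (θ * θ') = S.proj θ + S.proj θ' := by
  refine S.act₀_injective (lam := restrictWeight S.H₀_le S.zeroG) ?_
  rw [← S.restrict_act, map_mul, Equiv.Perm.mul_apply, S.restrict_act, S.restrict_act, ofAdd_add,
    map_mul, Equiv.Perm.mul_apply]

/-- The height of an element of the root lattice. -/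
def latticeHeight : S.P₀ →ₗ[ℤ] ℤ := S.simpleRoot.constr ℤ fun _ => (1 : ℤ)

theorem latticeHeight_apply (a : S.P₀) : S.latticeHeight a = ∑ j, S.simpleRoot.repr a j := by
  rw [latticeHeight, Module.Basis.constr_apply_fintype]
  simp [Module.Basis.equivFun_apply]

theorem latticeHeight_simpleRoot (j : Fin S.rank) : S.latticeHeight (S.simpleRoot j) = 1 :=
  S.simpleRoot.constr_basis ℤ _ j

theorem eq_zero_of_latticeHeight {a : S.P₀} (ha : ∀ j, 0 ≤ S.simpleRoot.repr a j)
    (h : S.latticeHeight a = 0) : a = 0 := by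
  rw [latticeHeight_apply, Finset.sum_eq_zero_iff_of_nonneg fun j _ => ha j] at h
  exact S.simpleRoot.repr.map_eq_zero_iff.1 (Finsupp.ext fun j => h j (Finset.mem_univ j))

theorem finite_latticeHeight_le (D : ℤ) :
    {a : S.P₀ | (∀ j, 0 ≤ S.simpleRoot.repr a j) ∧ S.latticeHeight a ≤ D}.Finite := by
  refine Set.Finite.of_injOn (f := S.simpleRoot.equivFun) (t := Set.Icc 0 fun _ => D) ?_
    S.simpleRoot.equivFun.injective.injOn (Set.finite_Icc _ _)
  rintro a ⟨h1, h2⟩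
  refine ⟨fun j => h1 j, fun j => le_trans ?_ h2⟩
  rw [latticeHeight_apply]
  exact Finset.single_le_sum (f := fun j => S.simpleRoot.repr a j) (fun j _ => h1 j)
    (Finset.mem_univ j)

theorem finite_le_latticeHeight (D : ℤ) :
    {a : S.P₀ | (∀ j, S.simpleRoot.repr a j ≤ 0) ∧ D ≤ S.latticeHeight a}.Finite := by
  refine ((S.finite_latticeHeight_le (-D)).preimage neg_injective.injOn).subset ?_
  rintro a ⟨h1, h2⟩
  refine ⟨fun j => ?_, ?_⟩
  · rw [map_neg, Finsupp.neg_apply]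
    exact neg_nonneg.2 (h1 j)
  · rw [map_neg]
    exact neg_le_neg h2

/-- The height of a weight in `P`. -/
def height (θ : S.P) : ℤ := S.latticeHeight (S.proj θ)

theorem height_mul (θ θ' : S.P) : S.height (θ * θ') = S.height θ + S.height θ' := by
  rw [height, proj_mul, map_add]; rfl

theorem height_one : S.height 1 = 0 := by
  have := S.height_mul 1 1
  rw [mul_one] at this
  linarith

theorem height_inv (θ : S.P) : S.height θ⁻¹ = -S.height θ := by
  have := S.height_mul θ⁻¹ θ
  rw [inv_mul_cancel, height_one] at this
  linarith

theorem height_nonneg {θ : S.P} (hθ : ∀ j, 0 ≤ S.simpleRoot.repr (S.proj θ) j) :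
    0 ≤ S.height θ := by
  rw [height, latticeHeight_apply]
  exact Finset.sum_nonneg fun j _ => hθ j

theorem height_nonpos {θ : S.P} (hθ : ∀ j, S.simpleRoot.repr (S.proj θ) j ≤ 0) :
    S.height θ ≤ 0 := by
  rw [height, latticeHeight_apply]
  exact Finset.sum_nonpos fun j _ => hθ j

theorem proj_eq_zero {θ : S.P} (hθ : ∀ j, 0 ≤ S.simpleRoot.repr (S.proj θ) j)
    (h : S.height θ = 0) : S.proj θ = 0 := S.eq_zero_of_latticeHeight hθ h

theorem proj_eq_zero' {θ : S.P} (hθ : ∀ j, S.simpleRoot.repr (S.proj θ) j ≤ 0)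
    (h : S.height θ = 0) : S.proj θ = 0 := by
  refine neg_eq_zero.1 (S.eq_zero_of_latticeHeight (fun j => ?_) ?_)
  · rw [map_neg, Finsupp.neg_apply]
    exact neg_nonneg.2 (hθ j)
  · rw [map_neg]
    exact neg_eq_zero.2 h

theorem restrict_act_zeroG {θ : S.P} (h : S.proj θ = 0) :
    restrictWeight S.H₀_le (S.act θ S.zeroG) = restrictWeight S.H₀_le S.zeroG := by
  rw [S.restrict_act, h, ofAdd_zero, map_one, Equiv.Perm.one_apply]

theorem proj_of_restrict_act_zeroG {θ : S.P}
    (h : restrictWeight S.H₀_le (S.act θ S.zeroG) = restrictWeight S.H₀_le S.zeroG) :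
    S.proj θ = 0 := by
  rw [S.restrict_act] at h
  exact S.act₀_free _ _ h

/-- The part of `A` of degree `θ`. -/
abbrev rootSpace (θ : S.P) : Submodule k A := weightSpace S.ad A (S.act θ S.zeroG)

theorem H_le_rootSpace : Subalgebra.toSubmodule S.H ≤ S.rootSpace 1 := fun a ha h => by
  rw [map_one, Equiv.Perm.one_apply]
  exact S.ad_H_eq h ⟨a, ha⟩

theorem mul_le_rootSpace (θ θ' : S.P) :
    S.rootSpace θ * S.rootSpace θ' ≤ S.rootSpace (θ * θ') :=
  Submodule.mul_le.2 fun a ha b hb => S.weight_mul θ θ' a b ha hb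

theorem toSubmodule_bot_eq_span : Subalgebra.toSubmodule (⊥ : Subalgebra k A) = k ∙ 1 := by
  rw [Algebra.toSubmodule_bot, Submodule.one_eq_span]

theorem Np_le : S.Np ≤ Subalgebra.toSubmodule S.Bp := iSup₂_le fun _ _ => inf_le_left

/-- For a degree in the positive cone, height zero means restricted degree zero. Thus the condition
on restricted weights defining `N₊` becomes positivity of the height. -/
theorem Np_eq : S.Np = ⨆ (θ : S.P) (_ : (∀ j, 0 ≤ S.simpleRoot.repr (S.proj θ) j) ∧
    0 < S.height θ), Subalgebra.toSubmodule S.Bp ⊓ S.rootSpace θ := by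
  refine le_antisymm (iSup₂_le fun lam hlam x hx => ?_) (iSup₂_le fun θ hθ => ?_)
  · have h1 : x ∈ ⨆ (θ : S.P), ⨆ (_ : ∀ j, 0 ≤ S.simpleRoot.repr (S.proj θ) j),
        Subalgebra.toSubmodule S.Bp ⊓ S.rootSpace θ := by
      rw [← S.Bp_eq]; exact hx.1
    have h2 := mem_iSup_of_mem_weightSpace S.ad (wt := fun θ => S.act θ S.zeroG)
      (fun θ => iSup_le fun _ => inf_le_right) h1 hx.2
    refine SetLike.le_def.1 (iSup_le fun θ => iSup_le fun hθ => iSup_le fun hpos => ?_) h2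
    refine le_iSup₂_of_le θ ⟨hpos, lt_of_le_of_ne (S.height_nonneg hpos) fun h => hlam ?_⟩ le_rfl
    rw [← hθ]
    exact S.restrict_act_zeroG (S.proj_eq_zero hpos h.symm)
  · refine le_iSup₂_of_le (S.act θ S.zeroG) (fun h => hθ.2.ne' ?_) le_rfl
    rw [height, S.proj_of_restrict_act_zeroG h, map_zero]

theorem Bp_le_sup : Subalgebra.toSubmodule S.Bp ≤ (k ∙ 1) ⊔ S.Np := by
  rw [S.Bp_eq]
  refine iSup₂_le fun θ hθ => ?_
  by_cases h : S.height θ = 0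
  · refine le_sup_of_le_left ?_
    rw [← toSubmodule_bot_eq_span, ← S.Bp_zero]
    exact le_iSup₂_of_le _ (S.restrict_act_zeroG (S.proj_eq_zero hθ h)) le_rfl
  · refine le_sup_of_le_right ?_
    rw [Np_eq]
    exact le_iSup₂_of_le θ ⟨hθ, lt_of_le_of_ne (S.height_nonneg hθ) (Ne.symm h)⟩ le_rfl

/-- The unit has weight `0_G`, while the part of `N₊` of that weight is zero; and `1 ≠ 0` since
`0_G(1) = 1`. -/
theorem one_notMem_Np : (1 : A) ∉ S.Np := fun h => by
  have h1 : (1 : A) ∈ weightSpace S.ad A S.zeroG := fun h => S.ad_H_eq h 1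
  have h2 := mem_iSup_of_mem_weightSpace S.ad (fun lam => iSup_le fun _ => inf_le_right) h h1
  have h3 : (1 : A) ∈ (⊥ : Submodule k A) := by
    refine SetLike.le_def.1 (iSup_le fun lam => iSup_le fun hlam => iSup_le fun hne => ?_) h2
    exact absurd (by rw [hlam]) hne
  have h4 : (1 : S.H) = 0 := Subtype.ext ((Submodule.mem_bot k).1 h3)
  have h5 := map_one S.zeroG
  rw [h4, map_zero] at h5
  exact zero_ne_one h5

theorem Bp_mul_Np : Subalgebra.toSubmodule S.Bp * S.Np ≤ S.Np := by
  have h : S.Np * S.Np ≤ S.Np := by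
    conv_lhs => rw [S.Np_eq]
    simp only [Submodule.iSup_mul, Submodule.mul_iSup]
    refine iSup₂_le fun θ hθ => iSup₂_le fun θ' hθ' => ?_
    rw [S.Np_eq]
    refine le_iSup₂_of_le (θ' * θ) ⟨fun j => ?_, ?_⟩ (le_inf ?_ ?_)
    · rw [proj_mul, map_add, Finsupp.add_apply]
      exact add_nonneg (hθ'.1 j) (hθ.1 j)
    · rw [height_mul]; exact add_pos hθ'.2 hθ.2
    · exact Submodule.mul_le.2 fun a ha b hb => S.Bp.mul_mem ha.1 hb.1
    · exact (mul_le_mul' inf_le_right inf_le_right).trans (S.mul_le_rootSpace θ' θ)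
  calc _ ≤ ((k ∙ 1) ⊔ S.Np) * S.Np := mul_le_mul' S.Bp_le_sup le_rfl
    _ ≤ S.Np := by
      rw [Submodule.sup_mul, ← Submodule.one_eq_span, one_mul]
      exact sup_le le_rfl h

/-- The product lies in `H B₊` and has degree `θ`. As `H` has degree 1, extracting the part of
degree `θ` leaves `H` times the `θ`-part of `B₊`. -/
theorem rootSpace_mul_H (θ : S.P) :
    (Subalgebra.toSubmodule S.Bp ⊓ S.rootSpace θ) * Subalgebra.toSubmodule S.H ≤
      Subalgebra.toSubmodule S.H * (Subalgebra.toSubmodule S.Bp ⊓ S.rootSpace θ) := by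
  refine Submodule.mul_le.2 fun c hc h hh => ?_
  have h1 : c * h ∈ Subalgebra.toSubmodule S.H * Subalgebra.toSubmodule S.Bp := by
    refine S.mul_H_Bp (Submodule.mul_mem_mul ?_ ?_)
    · rw [← one_mul c]
      exact Submodule.mul_mem_mul S.H.one_mem hc.1
    · rw [← mul_one h]
      exact Submodule.mul_mem_mul hh S.Bp.one_mem
  have h2 : c * h ∈ S.rootSpace θ := by
    have := S.weight_mul θ 1 c h hc.2 (S.H_le_rootSpace hh)
    rwa [mul_one] at this
  rw [S.Bp_eq, Submodule.mul_iSup] at h1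
  have h3 := mem_iSup_of_mem_weightSpace S.ad (wt := fun θ => S.act θ S.zeroG) (fun φ => by
    rw [Submodule.mul_iSup]
    refine iSup_le fun _ => (mul_le_mul' S.H_le_rootSpace inf_le_right).trans ?_
    exact (S.mul_le_rootSpace 1 φ).trans (by rw [one_mul])) h1 h2
  refine SetLike.le_def.1 (iSup_le fun φ => iSup_le fun hφ => mul_le_mul' le_rfl
    (iSup_le fun _ => ?_)) h3
  rw [S.act_injective hφ]

theorem Np_mul_H : S.Np * Subalgebra.toSubmodule S.H ≤ Subalgebra.toSubmodule S.H * S.Np := by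
  conv_lhs => rw [S.Np_eq]
  simp only [Submodule.iSup_mul]
  refine iSup₂_le fun θ hθ => (S.rootSpace_mul_H θ).trans (mul_le_mul' le_rfl ?_)
  rw [S.Np_eq]
  exact le_iSup₂_of_le θ hθ le_rfl

theorem span_tripleMul : Submodule.span k {a : A | ∃ b ∈ S.Bm, ∃ h ∈ S.H, ∃ c ∈ S.Bp,
    a = b * (h * c)} = ⊤ := by
  rw [eq_top_iff]
  rintro a -
  obtain ⟨t, rfl⟩ := S.triangular.2 a
  induction t using TensorProduct.induction_on with
  | zero => rw [map_zero]; exact Submodule.zero_mem _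
  | add x y hx hy => rw [map_add]; exact Submodule.add_mem _ hx hy
  | tmul b s =>
    induction s using TensorProduct.induction_on with
    | zero => rw [TensorProduct.tmul_zero, map_zero]; exact Submodule.zero_mem _
    | add x y hx hy => rw [TensorProduct.tmul_add, map_add]; exact Submodule.add_mem _ hx hy
    | tmul h c => exact Submodule.subset_span ⟨b, b.2, h, h.2, c, c.2, rfl⟩

/-- The projection of `A` onto `H` along a functional on `B₋` and `B₊`. -/
def cartanProj (g : A →ₗ[k] k) : A →ₗ[k] S.H :=
  (TensorProduct.lid k S.H).toLinearMap ∘ₗ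
    TensorProduct.map (g ∘ₗ S.Bm.val.toLinearMap) ((TensorProduct.rid k S.H).toLinearMap ∘ₗ
      TensorProduct.map LinearMap.id (g ∘ₗ S.Bp.val.toLinearMap)) ∘ₗ
    (LinearEquiv.ofBijective _ S.triangular).symm.toLinearMap

theorem cartanProj_mul (g : A →ₗ[k] k) (b : S.Bm) (h : S.H) (c : S.Bp) :
    S.cartanProj g ((b : A) * (h * c)) = (g b * g c) • h := by
  have : (LinearEquiv.ofBijective _ S.triangular).symm ((b : A) * (h * c)) =
      b ⊗ₜ[k] (h ⊗ₜ[k] c) :=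
    (LinearEquiv.symm_apply_eq _).2 rfl
  simp only [cartanProj, LinearMap.comp_apply, LinearEquiv.coe_coe, this, TensorProduct.map_tmul]
  simp [smul_smul, mul_comm]

/-- Right `H`-linearity comes from `N₊ H ⊆ H N₊`, and vanishing on `A N₊` from `B₊ N₊ ⊆ N₊`. -/
theorem exists_cartanProj : ∃ p : A →ₗ[k] S.H, p 1 = 1 ∧ (∀ a h, p (a * S.H.val h) = p a * h) ∧
    ∀ a, ∀ n ∈ S.Np, p (a * n) = 0 := by
  -- On `B₊` the functional `g` is the augmentation; on `B₋` only the value `g 1 = 1` matters, so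
  -- one functional serves both sides.
  obtain ⟨g, hg, hN⟩ := Submodule.exists_le_ker_of_notMem S.one_notMem_Np
  obtain ⟨g, hg, hN⟩ : ∃ g : A →ₗ[k] k, g 1 = 1 ∧ ∀ n ∈ S.Np, g n = 0 :=
    ⟨(g 1)⁻¹ • g, inv_mul_cancel₀ hg, fun n hn => by
      rw [LinearMap.smul_apply, hN hn, smul_zero]⟩
  have hzero : ∀ b ∈ S.Bm, ∀ h ∈ S.H, ∀ n ∈ S.Np, S.cartanProj g (b * (h * n)) = 0 :=
    fun b hb h hh n hn => by
      rw [S.cartanProj_mul g ⟨b, hb⟩ ⟨h, hh⟩ ⟨n, S.Np_le hn⟩, hN n hn, mul_zero, zero_smul]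
  have hind : ∀ {f f' : A →ₗ[k] S.H}, (∀ b ∈ S.Bm, ∀ h ∈ S.H, ∀ c ∈ S.Bp,
      f (b * (h * c)) = f' (b * (h * c))) → f = f' := fun {f f'} hf =>
    LinearMap.ext_on S.span_tripleMul (by
      rintro _ ⟨b, hb, h, hh, c, hc, rfl⟩
      exact hf b hb h hh c hc)
  refine ⟨S.cartanProj g, ?_, fun a h' => ?_, fun a n hn => ?_⟩
  · have := S.cartanProj_mul g 1 1 1
    simpa [hg] using this
  · have : S.cartanProj g ∘ₗ LinearMap.mulRight k (h' : A) =
        LinearMap.mulRight k h' ∘ₗ S.cartanProj g := hind fun b hb h hh c hc => by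
      simp only [LinearMap.comp_apply, LinearMap.mulRight_apply]
      obtain ⟨x, hx, n, hn, rfl⟩ := Submodule.mem_sup.1 (S.Bp_le_sup hc)
      obtain ⟨z, rfl⟩ := Submodule.mem_span_singleton.1 hx
      have h1 : S.cartanProj g (b * (h * n) * h') = 0 := by
        have h2 := S.Np_mul_H (Submodule.mul_mem_mul hn h'.2)
        rw [mul_assoc, mul_assoc]
        generalize n * (h' : A) = t at h2
        refine Submodule.mul_induction_on h2 (fun y hy m hm => ?_) fun x y hx hy => ?_
        · rw [← mul_assoc h]
          exact hzero b hb _ (S.H.mul_mem hh hy) m hm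
        · rw [mul_add, mul_add, map_add, hx, hy, add_zero]
      have h3 : ∀ y (hy : y ∈ S.H), S.cartanProj g (b * (y * 1)) = g b • (⟨y, hy⟩ : S.H) :=
          fun y hy => by
        have := S.cartanProj_mul g ⟨b, hb⟩ ⟨y, hy⟩ 1
        simpa [hg] using this
      rw [mul_add, mul_add, add_mul, map_add, map_add, h1, hzero b hb h hh n hn, add_zero,
        add_zero, mul_smul_comm, mul_smul_comm, smul_mul_assoc, map_smul, map_smul, h3 h hh,
        smul_mul_assoc]
      have h4 : b * (h * 1) * (h' : A) = b * (h * h' * 1) := by rw [mul_one, mul_one, mul_assoc]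
      rw [h4, h3 _ (S.H.mul_mem hh h'.2), smul_mul_assoc]
      rfl
    exact LinearMap.congr_fun this a
  · have : S.cartanProj g ∘ₗ LinearMap.mulRight k n = 0 := hind fun b hb h hh c hc => by
      simp only [LinearMap.comp_apply, LinearMap.mulRight_apply, LinearMap.zero_apply]
      rw [mul_assoc, mul_assoc]
      exact hzero b hb h hh _ (S.Bp_mul_Np (Submodule.mul_mem_mul hc hn))
    exact LinearMap.congr_fun this a

end RTA

end RTA

/-! ### Regular triangular algebras give abstract triangular decompositions -/

section SkewRTA

variable {k A Γ : Type u} [Field k] [Ring A] [Algebra k A]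

/-- `mu` is obtained from `lam` by the action of an element of `P` of height `d`. -/
def RTA.heightRel (S : RTA k A) (d : ℤ) (lam mu : S.H →ₐ[k] k) : Prop :=
  ∃ θ : S.P, S.height θ = d ∧ mu = S.act θ lam

variable [Group Γ] [MulSemiringAction Γ A] [SMulCommClass Γ k A]

theorem RTA.shift_of_mem_rootSpace (S : RTA k A) {θ : S.P} {a : A} (ha : a ∈ S.rootSpace θ) :
    Shift Γ S.H.val S.heightRel (S.height θ) a := fun M lam m hm =>
  ⟨S.act θ lam, ⟨θ, rfl, rfl⟩, S.weight_smul (M.pull (inclAlg k A Γ)) θ lam a m ha hm⟩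

theorem mul_mul_mem_of_span {X Y : Set A} {W : Submodule k A} {x b c : A}
    (hW : ∀ b ∈ X, ∀ c ∈ Y, b * x * c ∈ W) (hb : b ∈ Submodule.span k X)
    (hc : c ∈ Submodule.span k Y) : b * x * c ∈ W := by
  have h1 : ∀ b ∈ X, Submodule.span k Y ≤ W.comap (LinearMap.mulLeft k (b * x)) := fun b hb =>
    Submodule.span_le.2 fun c hc => hW b hb c hc
  have h2 : Submodule.span k X ≤ W.comap (LinearMap.mulRight k (x * c)) :=
    Submodule.span_le.2 fun b hb => by
      have := h1 b hb hc
      rwa [Submodule.mem_comap, LinearMap.mulLeft_apply, mul_assoc] at this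
  have := h2 hb
  rwa [Submodule.mem_comap, LinearMap.mulRight_apply, ← mul_assoc] at this

/-- The set `L` is arbitrary, so the triangular decomposition yields both the spanning condition and
its finite-dimensional refinement. -/
theorem RTA.span_lower_of_le (S : RTA k A) {L : Set A}
    (hL : Subalgebra.toSubmodule S.Bm ≤ Submodule.span k L) :
    Submodule.span k {a | ∃ (b : A) (h : S.H) (c : A), a = b * S.H.val h * c ∧
      b ∈ L ∧ (c = 1 ∨ c ∈ S.Np)} = ⊤ := by
  refine top_le_iff.1 (S.span_tripleMul.ge.trans (Submodule.span_le.2 ?_))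
  rintro _ ⟨b, hb, h, hh, c, hc, rfl⟩
  rw [← mul_assoc]
  refine mul_mul_mem_of_span (Y := {c | c = 1 ∨ c ∈ S.Np}) (fun b hb c hc =>
    Submodule.subset_span ⟨b, ⟨h, hh⟩, c, rfl, hb, hc⟩) (hL hb) ?_
  have h1 : (k ∙ (1 : A)) ⊔ S.Np ≤ Submodule.span k {c | c = 1 ∨ c ∈ S.Np} :=
    sup_le ((Submodule.span_singleton_le_iff_mem _ _).2 (Submodule.subset_span (Or.inl rfl)))
      fun c hc => Submodule.subset_span (Or.inr hc)
  exact h1 (S.Bp_le_sup hc)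

theorem RTA.Bm_le_span (S : RTA k A) : Subalgebra.toSubmodule S.Bm ≤
    Submodule.span k {b | b = 1 ∨ ∃ d < 0, Shift Γ S.H.val S.heightRel d b} := by
  rw [S.Bm_eq]
  refine iSup₂_le fun θ hθ => ?_
  by_cases h : S.height θ = 0
  · have h1 : Subalgebra.toSubmodule S.Bm ⊓ S.rootSpace θ ≤ k ∙ 1 := by
      rw [← RTA.toSubmodule_bot_eq_span, ← S.Bm_zero]
      exact le_iSup₂_of_le _ (S.restrict_act_zeroG (S.proj_eq_zero' hθ h)) le_rfl
    refine h1.trans (Submodule.span_mono ?_)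
    rintro _ rfl
    exact Or.inl rfl
  · exact fun b hb => Submodule.subset_span (Or.inr ⟨_, lt_of_le_of_ne (S.height_nonpos hθ) h,
      S.shift_of_mem_rootSpace hb.2⟩)

namespace SkewRTA

variable (S : SkewRTA k A Γ)

/-- Compare the two descriptions of `γ(1 * 0_G)`, as `θ * 0_G` and as `θ * γ(0_G)`, and cancel `θ`.
-/
theorem dualAct_zeroG (γ : Γ) : dualAct γ S.zeroG = S.zeroG := by
  obtain ⟨θ, h1, h2⟩ := S.smul_act γ 1
  have h3 := h2 S.zeroG
  rw [h1] at h3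
  exact ((S.act θ).injective h3).symm

theorem restrictWeight_dualAct (γ : Γ) (lam : S.H →ₐ[k] k) :
    restrictWeight S.H₀_le (dualAct γ lam) =
      weightAct S.H₀ S.smul_H₀ γ (restrictWeight S.H₀_le lam) := rfl

/-- The action of `γ` on `P` preserves heights. -/
theorem height_eq {γ : Γ} {θ θ' : S.P}
    (h : ∀ lam : S.H →ₐ[k] k, dualAct γ (S.act θ lam) = S.act θ' (dualAct γ lam)) :
    S.height θ' = S.height θ := by
  have hex : ∀ θ : S.P, ∃ θ' : S.P, ∀ lam : S.H →ₐ[k] k,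
      dualAct γ (S.act θ lam) = S.act θ' (dualAct γ lam) := fun θ => by
    obtain ⟨θ', -, h⟩ := S.smul_act γ θ
    exact ⟨θ', h⟩
  have hres : ∀ {θ θ' : S.P}, (∀ lam : S.H →ₐ[k] k,
      dualAct γ (S.act θ lam) = S.act θ' (dualAct γ lam)) →
      weightAct S.H₀ S.smul_H₀ γ
        (S.act₀ (Multiplicative.ofAdd (S.proj θ)) (restrictWeight S.H₀_le S.zeroG)) =
      S.act₀ (Multiplicative.ofAdd (S.proj θ')) (restrictWeight S.H₀_le S.zeroG) :=
    fun {θ θ'} h => by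
      rw [← S.restrict_act, ← S.restrict_act, ← restrictWeight_dualAct, h, dualAct_zeroG]
  -- The map `c` describes how `γ` transforms `P`; freeness makes it multiplicative.
  choose c hc using hex
  choose s hs using S.proj_surjective
  have hmul : ∀ θ φ, c (θ * φ) = c θ * c φ := fun θ φ => S.act_injective (lam := S.zeroG) (by
    have h1 := hc (θ * φ) S.zeroG
    rw [dualAct_zeroG] at h1
    rw [← h1, map_mul, Equiv.Perm.mul_apply, hc, hc, dualAct_zeroG, map_mul,
      Equiv.Perm.mul_apply])
  have hproj : ∀ {θ φ θ' : S.P}, S.proj θ = S.proj φ → (∀ lam : S.H →ₐ[k] k,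
      dualAct γ (S.act θ lam) = S.act θ' (dualAct γ lam)) → S.proj θ' = S.proj (c φ) :=
    fun {θ φ θ'} h h' => S.act₀_injective (by rw [← hres h', ← hres (hc φ), h])
  -- Passing to restricted weights, the image of `c θ` depends only on the image of `θ`, so `c`
  -- descends to an additive map of `P₀`. It sends simple roots to simple roots and therefore
  -- preserves heights.
  let C : S.P₀ →+ S.P₀ := AddMonoidHom.mk' (fun a => S.proj (c (s a))) fun a b => by
    rw [← S.proj_mul, ← hmul]
    exact hproj (by rw [hs, S.proj_mul, hs, hs]) (hc _)
  have hC : S.latticeHeight ∘ₗ C.toIntLinearMap = S.latticeHeight :=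
    S.simpleRoot.ext fun j => by
      obtain ⟨j', hj'⟩ := S.smul_simpleRoot γ j
      have h1 := hres (hc (s (S.simpleRoot j)))
      rw [hs, hj'] at h1
      change S.latticeHeight (S.proj (c (s (S.simpleRoot j)))) = _
      rw [← S.act₀_injective h1, S.latticeHeight_simpleRoot, S.latticeHeight_simpleRoot]
  change S.latticeHeight (S.proj θ') = S.latticeHeight (S.proj θ)
  rw [hproj (hs (S.proj θ)).symm h]
  exact LinearMap.congr_fun hC (S.proj θ)

theorem isHeight : IsHeight Γ S.heightRel where
  refl lam := ⟨1, S.height_one, by rw [map_one, Equiv.Perm.one_apply]⟩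
  symm := by
    rintro _ lam _ ⟨θ, rfl, rfl⟩
    refine ⟨θ⁻¹, S.height_inv θ, ?_⟩
    rw [← Equiv.Perm.mul_apply, ← map_mul, inv_mul_cancel, map_one, Equiv.Perm.one_apply]
  trans := by
    rintro _ _ lam _ _ ⟨θ, rfl, rfl⟩ ⟨φ, rfl, rfl⟩
    refine ⟨φ * θ, by rw [S.height_mul, add_comm], ?_⟩
    rw [map_mul, Equiv.Perm.mul_apply]
  unique := by
    rintro _ _ lam _ ⟨θ, rfl, rfl⟩ ⟨φ, rfl, h⟩
    rw [S.act_injective h]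
  smul := by
    rintro γ _ lam _ ⟨θ, rfl, rfl⟩
    obtain ⟨θ', -, h⟩ := S.smul_act γ θ
    exact ⟨θ', S.height_eq h, h lam⟩

theorem isTriangular : IsTriangular Γ S.heightRel S.H.val S.Bp S.Np where
  toIsHeight := S.isHeight
  equivariant _ _ := rfl
  Np_le := S.toRTA.Np_le
  smul_Np := S.smul_Np
  Np_le_span := by
    conv_lhs => rw [S.toRTA.Np_eq]
    refine iSup₂_le fun θ hθ b hb => Submodule.subset_span ⟨?_, _, hθ.2,
      S.shift_of_mem_rootSpace hb.2⟩
    rw [S.toRTA.Np_eq]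
    exact Submodule.mem_iSup_of_mem θ (Submodule.mem_iSup_of_mem hθ hb)
  Bp_le_sup := S.toRTA.Bp_le_sup
  span_lower := S.toRTA.span_lower_of_le S.toRTA.Bm_le_span
  exists_proj := S.toRTA.exists_cartanProj

/-- Only finitely many elements of a cone in the root lattice have bounded height, and regularity
makes each corresponding piece finite-dimensional. -/
theorem isFiniteTriangular : IsFiniteTriangular Γ S.heightRel S.H.val S.Bp S.Np where
  toIsTriangular := S.isTriangular
  lower_finite D := by
    let I := {a : S.P₀ | (∀ j, S.simpleRoot.repr a j ≤ 0) ∧ D ≤ S.latticeHeight a}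
    have : Finite I := S.finite_le_latticeHeight D
    let F : I → Submodule k A := fun a => ⨆ (lam : S.H →ₐ[k] k) (_ : restrictWeight S.H₀_le lam =
      S.act₀ (Multiplicative.ofAdd a.1) (restrictWeight S.H₀_le S.zeroG)),
        Subalgebra.toSubmodule S.Bm ⊓ weightSpace S.ad A lam
    have hF : ∀ a, FiniteDimensional k (F a) := fun a => S.Bm_finite a.1 a.2.1
    refine ⟨⨆ a, F a, inferInstance, S.toRTA.span_lower_of_le ?_⟩
    rw [S.Bm_eq]
    refine iSup₂_le fun θ hθ b hb => Submodule.subset_span ?_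
    by_cases h : D ≤ S.height θ
    · refine Or.inl (Submodule.mem_iSup_of_mem ⟨S.proj θ, hθ, h⟩ ?_)
      exact Submodule.mem_iSup_of_mem (S.act θ S.zeroG)
        (Submodule.mem_iSup_of_mem (S.restrict_act θ S.zeroG) hb)
    · exact Or.inr ⟨_, not_le.1 h, S.shift_of_mem_rootSpace hb.2⟩
  raise_finite D := by
    let I := {a : S.P₀ | (∀ j, 0 ≤ S.simpleRoot.repr a j) ∧ S.latticeHeight a ≤ D}
    have : Finite I := S.finite_latticeHeight_le D
    let F : I → Submodule k A := fun a => ⨆ (lam : S.H →ₐ[k] k) (_ : restrictWeight S.H₀_le lam =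
      S.act₀ (Multiplicative.ofAdd a.1) (restrictWeight S.H₀_le S.zeroG)),
        Subalgebra.toSubmodule S.Bp ⊓ weightSpace S.ad A lam
    have hF : ∀ a, FiniteDimensional k (F a) := fun a => S.Bp_finite a.1 a.2.1
    refine ⟨⨆ a, F a, inferInstance, ?_⟩
    conv_lhs => rw [S.Bp_eq]
    refine iSup₂_le fun θ hθ b hb => ?_
    by_cases h : S.height θ ≤ D
    · refine Submodule.mem_sup_left (Submodule.mem_iSup_of_mem ⟨S.proj θ, hθ, h⟩ ?_)
      exact Submodule.mem_iSup_of_mem (S.act θ S.zeroG)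
        (Submodule.mem_iSup_of_mem (S.restrict_act θ S.zeroG) hb)
    · exact Submodule.mem_sup_right (Submodule.subset_span ⟨_, not_le.1 h,
        S.shift_of_mem_rootSpace hb.2⟩)

end SkewRTA

end SkewRTA

theorem IsSingularMap.comp_equiv {k A H Γ : Type u} [Field k] [Ring A] [Algebra k A] [Ring H]
    [Algebra k H] [Group Γ] [MulSemiringAction Γ A] [SMulCommClass Γ k A] [MulSemiringAction Γ H]
    [SMulCommClass Γ k H] {f : H →ₐ[k] A} {Np : Submodule k A}
    {E E' : AlgModule k (SkewMonoidAlgebra H Γ)} {M : AlgModule k (SkewMonoidAlgebra A Γ)}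
    {ψ : E →ₗ[k] M} (hψ : IsSingularMap f Np ψ) (e : E' ≃ₗ[SkewMonoidAlgebra H Γ] E) :
    IsSingularMap f Np (ψ ∘ₗ (e.restrictScalars k).toLinearMap) where
  map_H h x := by
    change ψ (e _) = _ • ψ (e x)
    rw [e.map_smul, hψ.map_H]
  map_group γ x := by
    change ψ (e _) = _ • ψ (e x)
    rw [e.map_smul, hψ.map_group]
  map_Np n hn x := hψ.map_Np n hn _

theorem character_eq_of_iso {k A H Γ : Type u} [Field k] [Ring A] [Algebra k A] [Ring H]
    [Algebra k H] [Group Γ] [MulSemiringAction Γ A] [SMulCommClass Γ k A] {f : H →ₐ[k] A}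
    {M M' : AlgModule k (SkewMonoidAlgebra A Γ)} (h : M.Iso M') (lam : H →ₐ[k] k) :
    character f M lam = character f M' lam :=
  (weightSpaceEquiv h.some lam).finrank_eq

/-! ### Simple objects over the tensor product -/

namespace SkewRTA

variable {k : Type u} [Field k] {n : ℕ} {A Γ : Fin n → Type u} [∀ i, Ring (A i)]
  [∀ i, Algebra k (A i)] [∀ i, Group (Γ i)]
  [∀ i, MulSemiringAction (Γ i) (A i)] [∀ i, SMulCommClass (Γ i) k (A i)]
  (S : ∀ i, SkewRTA k (A i) (Γ i))

theorem tensor_isTriangular : IsTriangular (∀ i, Γ i)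
    (tensorHeight fun i => (S i).heightRel) (tensorInclH S) (tensorSubalgebra fun i => (S i).Bp)
    (tensorAugmentation (fun i => (S i).Bp) fun i => (S i).Np) :=
  IsTriangular.tensor fun i => (S i).isTriangular

variable [∀ i, Finite (Γ i)] {S} {x : ∀ i, (S i).CartanModule}

theorem simpleModule_exists_scalar (hk : ∀ i, Subsingleton (Γ i) ∨ IsAlgClosed k)
    (hx : ∀ i, (S i).MemX (x i)) (i : Fin n)
    (φ : (S i).simpleModule (x i) →ₗ[SkewMonoidAlgebra (A i) (Γ i)] (S i).simpleModule (x i)) :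
    ∃ c : k, ∀ e, φ e = c • e :=
  (S i).isTriangular.exists_scalar (hx i) ((S i).isTriangular.vermaHead_simple (hx i))
    isSingularMap_vermaHeadMk ((S i).isTriangular.vermaHeadMk_ne_zero (hx i))
    ((hx i).exists_scalar (hk i)) φ

/-- The left side is simple, and the tensor product of the canonical maps `xᵢ → Vᵢ(xᵢ)` is a nonzero
singular map from `⨂ xᵢ` into it. -/
theorem tensorModule_simpleModule_iso (hk : ∀ i, Subsingleton (Γ i) ∨ IsAlgClosed k)
    (hx : ∀ i, (S i).MemX (x i)) : (tensorModule fun i => (S i).simpleModule (x i)).Iso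
      (tensorSimpleModule S (tensorCartanModule S x)) :=
  ((tensor_isTriangular S).vermaHead_iso (isSimpleWeightModule_tensorModule hx hk)
    (tensorModule_simple (fun i => (S i).isTriangular.vermaHead_simple (hx i))
      (simpleModule_exists_scalar hk hx))
    (isSingularMap_tensorMap fun _ => isSingularMap_vermaHeadMk)
    (tensorMap_ne_zero fun i => (S i).isTriangular.vermaHeadMk_ne_zero (hx i))).symm

/-- A simple object is `V(E)` for some simple `E`, which splits as `⨂ xᵢ`. In the other direction,
membership in `𝒪` is inherited from the factors, so no finiteness of the tensor decomposition is
required. -/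
theorem tensorIsSimpleObject_iff (hk : ∀ i, Subsingleton (Γ i) ∨ IsAlgClosed k)
    (V : AlgModule k (SkewMonoidAlgebra (⨂[k] j, A j) (∀ j, Γ j))) :
    TensorIsSimpleObject S V ↔ ∃ x : ∀ j, (S j).CartanModule, (∀ j, (S j).MemX (x j)) ∧
      V.Iso (tensorModule fun j => (S j).simpleModule (x j)) := by
  refine ⟨fun hV => ?_, fun ⟨x, hx, h⟩ => ?_⟩
  · obtain ⟨E, hE, hVE⟩ := (tensor_isTriangular S).exists_vermaHead_iso hV
    obtain ⟨x, hx, ⟨e⟩⟩ := hE.exists_tensor hk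
    refine ⟨x, hx, hVE.trans (AlgModule.Iso.trans ?_ (tensorModule_simpleModule_iso hk hx).symm)⟩
    -- That `V(E)` depends only on the isomorphism class of `E` is seen by composing its canonical
    -- map with `⨂ xᵢ ≅ E`.
    refine AlgModule.Iso.symm ((tensor_isTriangular S).vermaHead_iso
      (isSimpleWeightModule_tensorModule hx hk) ((tensor_isTriangular S).vermaHead_simple hE)
      (isSingularMap_vermaHeadMk.comp_equiv e.symm) fun h0 => ?_)
    refine (tensor_isTriangular S).vermaHeadMk_ne_zero hE (LinearMap.ext fun y => ?_)
    have h1 := LinearMap.congr_fun h0 (e y)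
    simp only [LinearMap.comp_apply, LinearEquiv.coe_coe, LinearEquiv.restrictScalars_apply,
      LinearEquiv.symm_apply_apply] at h1
    exact h1
  · exact IsSimpleInO.of_iso h.symm (isSimpleInO_tensorModule
      (fun i => (S i).isFiniteTriangular.isSimpleInO_vermaHead (hx i))
      (simpleModule_exists_scalar hk hx))

theorem tensorIsSimpleObject_iff' (hk : ∀ i, Subsingleton (Γ i) ∨ IsAlgClosed k)
    (V : AlgModule k (SkewMonoidAlgebra (⨂[k] j, A j) (∀ j, Γ j))) :
    TensorIsSimpleObject S V ↔ ∃ W : ∀ j, AlgModule k (SkewMonoidAlgebra (A j) (Γ j)),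
      (∀ j, (S j).IsSimpleObject (W j)) ∧ V.Iso (tensorModule W) := by
  rw [tensorIsSimpleObject_iff hk]
  refine ⟨fun ⟨x, hx, h⟩ =>
    ⟨_, fun i => (S i).isFiniteTriangular.isSimpleInO_vermaHead (hx i), h⟩, fun ⟨W, hW, h⟩ => ?_⟩
  choose x hx e using fun i => (S i).isTriangular.exists_vermaHead_iso (hW i)
  exact ⟨x, hx, h.trans (tensorModule_iso e)⟩

end SkewRTA

end BGG

end

/-! ### The main theorem -/

open BGG SkewRTA in
theorem theorem14 {k : Type u} [Field k] {n : ℕ} (A Γ : Fin n → Type u) [∀ i, Ring (A i)]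
    [∀ i, Algebra k (A i)] [∀ i, Group (Γ i)] [∀ i, Finite (Γ i)]
    [∀ i, MulSemiringAction (Γ i) (A i)] [∀ i, SMulCommClass (Γ i) k (A i)]
    (S : ∀ i, SkewRTA k (A i) (Γ i))
    (hchar : ∀ i, Nontrivial (Γ i) → CharZero k)
    (hclosed : ∀ i, Nontrivial (Γ i) → IsAlgClosed k) :
    -- `X = ×ⱼ Xⱼ`: the map `(xⱼ)ⱼ ↦ ⨂ⱼ xⱼ` is a bijection on isomorphism classes
    ((∀ x : ∀ j, (S j).CartanModule,
        (∀ j, (S j).MemX (x j)) → TensorMemX S (tensorCartanModule S x)) ∧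
      (∀ x x' : ∀ j, (S j).CartanModule, (∀ j, (S j).MemX (x j)) → (∀ j, (S j).MemX (x' j)) →
        ((tensorCartanModule S x).Iso (tensorCartanModule S x') ↔ ∀ j, (x j).Iso (x' j))) ∧
      (∀ y : TensorCartanModule S, TensorMemX S y →
        ∃ x : ∀ j, (S j).CartanModule,
          (∀ j, (S j).MemX (x j)) ∧ y.Iso (tensorCartanModule S x))) ∧
    -- for `xⱼ ∈ Xⱼ`, each `Vⱼ(xⱼ)` is simple in `𝒪ⱼ`, and `⨂ⱼ Vⱼ(xⱼ)` is `V(⨂ⱼ xⱼ)`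
    (∀ x : ∀ j, (S j).CartanModule, (∀ j, (S j).MemX (x j)) →
      (∀ j, (S j).IsSimpleObject ((S j).simpleModule (x j))) ∧
      (tensorModule fun j => (S j).simpleModule (x j)).Iso
        (tensorSimpleModule S (tensorCartanModule S x))) ∧
    -- the simple objects of `𝒪` are exactly the modules `⨂ⱼ Vⱼ(xⱼ)` with `xⱼ ∈ Xⱼ`
    (∀ V : AlgModule k (SkewMonoidAlgebra (⨂[k] j, A j) (∀ j, Γ j)),
      TensorIsSimpleObject S V ↔
        ∃ x : ∀ j, (S j).CartanModule, (∀ j, (S j).MemX (x j)) ∧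
          V.Iso (tensorModule fun j => (S j).simpleModule (x j))) ∧
    -- that is, exactly the tensor products of simple objects of the `𝒪ⱼ`
    (∀ V : AlgModule k (SkewMonoidAlgebra (⨂[k] j, A j) (∀ j, Γ j)),
      TensorIsSimpleObject S V ↔
        ∃ W : ∀ j, AlgModule k (SkewMonoidAlgebra (A j) (Γ j)),
          (∀ j, (S j).IsSimpleObject (W j)) ∧ V.Iso (tensorModule W)) ∧
    -- the character of `V ≅ ⨂ⱼ Wⱼ` is the product of the characters of the `Wⱼ`, where
    -- `e(lam) = ∏ⱼ e(lamⱼ)` for a weight `lam = (lamⱼ)ⱼ` in `G = ×ⱼ Gⱼ`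
    Function.Bijective (weightComponents S) ∧
    (∀ (V : AlgModule k (SkewMonoidAlgebra (⨂[k] j, A j) (∀ j, Γ j)))
      (W : ∀ j, AlgModule k (SkewMonoidAlgebra (A j) (Γ j))),
      (∀ j, (S j).IsSimpleObject (W j)) → V.Iso (tensorModule W) →
        ∀ lam : TensorH S →ₐ[k] k,
          tensorCh S V lam = ∏ j, (S j).ch (W j) (weightComponents S lam j)) := by
  have hk : ∀ i, Subsingleton (Γ i) ∨ IsAlgClosed k := fun i =>
    (subsingleton_or_nontrivial (Γ i)).imp_right (hclosed i)
  refine ⟨⟨fun x hx => isSimpleWeightModule_tensorModule hx hk, fun x x' hx hx' =>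
      tensorModule_iso_iff (fun i => (hx i).simple) fun i => (hx' i).simple,
    fun y hy => hy.exists_tensor hk⟩,
    fun x hx => ⟨fun i => (S i).isFiniteTriangular.isSimpleInO_vermaHead (hx i),
      tensorModule_simpleModule_iso hk hx⟩,
    tensorIsSimpleObject_iff hk, tensorIsSimpleObject_iff' hk, weightPart_bijective,
    fun V W hW h lam => ?_⟩
  rw [tensorCh, character_eq_of_iso h]
  exact character_tensorModule (fun i => (hW i).1.semisimple) lam
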